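/- Let $p$ be a prime, let $K$ be a simplicial complex on $[m]=\{1,\dots,m\}$ that contains $\varnothing$ and all one-element subsets, and let $G_1,\dots,G_m$ be groups with $G_i\cong\mathbb Z_p^{n_i}$, $n_i\ge 0$. A $p$-central series on a group $G$ is a descending sequence of subgroups $G=\Gamma_1\supseteq\Gamma_2\supseteq\cdots$ such that $(\Gamma_k,\Gamma_l)\subseteq\Gamma_{k+l}$ and $g^p\in\Gamma_{pk}$ for all $g\in\Gamma_k$ and all $k,l\ge1$. Let $\gamma^{[p]}(G)$ be the smallest $p$-central series on $G$ (the lower $p$-central series), and let $$\mathrm{gr}_\bullet\gamma^{[p]}(G)=\bigoplus_{k\ge1}\gamma^{[p]}_k(G)/\gamma^{[p]}_{k+1}(G)$$ be the associated Lie algebra over $\mathbb Z_p$, with bracket $[\overline g,\overline h]=\overline{(g,h)}$ on homogeneous elements. A $p$-Lie algebra (restricted Lie algebra) over $\mathbb Z_p$ is a Lie algebra over $\mathbb Z_p$ with an operation $x\mapsto x^{[p]}$ such that: 1. $[x,y^{[p]}]=[\dots[[x,y],y],\dots,y]$, with $y$ occurring $p$ times on the right; 2. $(\alpha x)^{[p]}=\alpha^px^{[p]}$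 for $\alpha\in\mathbb Z_p$; 3. $(x+y)^{[p]}=x^{[p]}+y^{[p]}+\sum_{i=1}^{p-1}s_i(x,y)$, where $i\,s_i(x,y)$ is the coefficient of $\lambda^{i-1}$ in $[\dots[[x,\lambda x+y],\lambda x+y],\dots,\lambda x+y]$, with $p-1$ brackets. In the category of groups, and in the category of $p$-Lie algebras over $\mathbb Z_p$, the graph product of $X_1,\dots,X_m$ is the colimit $\mathbf X^K=\operatorname{colim}_{I\in K}\prod_{i\in I}X_i$ over the faces of $K$, where the maps $\prod_{i\in I}X_i\to\prod_{i\in J}X_i$ for $I\subseteq J$ are the canonical inclusions. Let $\iota_i\colon G_i\to\mathbf G^K$ be the canonical homomorphisms to the graph product of the groups $G_i$. Then $\mathrm{gr}_\bullet\gamma^{[p]}(\mathbf G^K)$ and all $\mathrm{gr}_\bullet\gamma^{[p]}(G_i)$ are $p$-Lie algebras with $p$-power operations satisfying $\overline g^{[p]}=\overline{g^p}$ on homogeneous elements, where for $g\in\gamma^{[p]}_k$ the class of $g^p$ is taken in degree $pk$. Moreover, the functor $\mathrm{gr}_\bullet\gamma^{[p]}$ preserves this graph product, that is, $$\mathrm{gr}_\bullet\gamma^{[p]}\bigl((G_1,\dots,G_m)^K\bigr)\cong\bigl(\mathrm{gr}_\bullet\gamma^{[p]}(G_1),\dots,\mathrm{gr}_\bullet\gamma^{[p]}(G_m)\bigr)^K$$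 as $p$-Lie algebras. More precisely, the maps $$\prod_{i\in I}\mathrm{gr}_\bullet\gamma^{[p]}(G_i)\to\mathrm{gr}_\bullet\gamma^{[p]}(\mathbf G^K),\qquad (x_i)_{i\in I}\mapsto\sum_{i\in I}\mathrm{gr}(\iota_i)(x_i),\qquad I\in K,$$ are homomorphisms of $p$-Lie algebras and form a colimit cocone over the faces of $K$. -/

import Mathlib

/-! ## Restricted Lie algebras over the field with `p` elements -/

section RestrictedLie

/-- Coefficients of the iterated right bracket with `t • x + y`:
`jacobsonCoeff x y n k` is the coefficient of `t ^ k` in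
`[…[[x, t • x + y], t • x + y], …, t • x + y]` (`n` brackets). -/
def jacobsonCoeff {L : Type*} [LieRing L] (x y : L) : ℕ → ℕ → L
  | 0, 0 => x
  | 0, _ + 1 => 0
  | n + 1, 0 => ⁅jacobsonCoeff x y n 0, y⁆
  | n + 1, k + 1 => ⁅jacobsonCoeff x y n (k + 1), y⁆ + ⁅jacobsonCoeff x y n k, x⁆

/-- `bracketIter x y n = […[[x, y], y], …, y]` with `n` brackets. -/
def bracketIter {L : Type*} [LieRing L] (x y : L) : ℕ → L
  | 0 => x
  | n + 1 => ⁅bracketIter x y n, y⁆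

/-- The Jacobson element `s_i(x, y)`: the element such that `i • s_i(x, y)` is the coefficient of
`t ^ (i - 1)` in `[…[[x, t • x + y], t • x + y], …, t • x + y]` (`p - 1` brackets). It is used only
for `1 ≤ i ≤ p - 1`, where `i` is invertible modulo `p`. -/
def jacobsonS (p : ℕ) [Fact p.Prime] {L : Type*} [LieRing L] [LieAlgebra (ZMod p) L]
    (i : ℕ) (x y : L) : L :=
  ((i : ZMod p)⁻¹) • jacobsonCoeff x y (p - 1) (i - 1)

/-- A restricted Lie algebra (`p`-Lie algebra) over `ZMod p`: a Lie algebra with a `p`-power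
operation. -/
class RestrictedLieAlgebra (p : ℕ) [Fact p.Prime] (L : Type*) [LieRing L]
    [LieAlgebra (ZMod p) L] where
  /-- the operation `x ↦ x^{[p]}` -/
  pPow : L → L
  lie_pPow : ∀ x y : L, ⁅x, pPow y⁆ = bracketIter x y p
  smul_pPow : ∀ (a : ZMod p) (x : L), pPow (a • x) = a ^ p • pPow x
  add_pPow : ∀ x y : L,
    pPow (x + y) = pPow x + pPow y + ∑ i ∈ Finset.Icc 1 (p - 1), jacobsonS p i x y

/-- Homomorphisms of restricted Lie algebras. -/
structure RestrictedLieHom (p : ℕ) [Fact p.Prime] (L M : Type*)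
    [LieRing L] [LieAlgebra (ZMod p) L] [RestrictedLieAlgebra p L]
    [LieRing M] [LieAlgebra (ZMod p) M] [RestrictedLieAlgebra p M] where
  toLieHom : L →ₗ⁅ZMod p⁆ M
  map_pPow : ∀ x : L, toLieHom (RestrictedLieAlgebra.pPow p x) =
    RestrictedLieAlgebra.pPow p (toLieHom x)

/-- The defining expansion of the coefficients, which shows that `jacobsonCoeff` is what it is
said to be. -/
theorem sum_smul_jacobsonCoeff {R L : Type*} [CommRing R] [LieRing L] [LieAlgebra R L]
    (x y : L) (t : R) (n : ℕ) :
    ∑ k ∈ Finset.range (n + 1), t ^ k • jacobsonCoeff x y n k = bracketIter x (t • x + y) n := by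
  have hz : ∀ n k, n < k → jacobsonCoeff x y n k = 0 := by
    intro n
    induction n with
    | zero => intro k hk; cases k with
      | zero => omega
      | succ k => rfl
    | succ n ih => intro k hk; cases k with
      | zero => omega
      | succ k => simp [jacobsonCoeff, ih (k + 1) (by omega), ih k (by omega)]
  induction n with
  | zero => simp [jacobsonCoeff, bracketIter]
  | succ n ih =>
    rw [bracketIter, ← ih, Finset.sum_range_succ' _ (n + 1)]
    have h1 : ∑ k ∈ Finset.range (n + 1), t ^ k • jacobsonCoeff x y n k
        = ∑ k ∈ Finset.range (n + 1), t ^ (k + 1) • jacobsonCoeff x y n (k + 1)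
          + jacobsonCoeff x y n 0 := by
      have h2 := Finset.sum_range_succ (fun k => t ^ k • jacobsonCoeff x y n k) (n + 1)
      rw [Finset.sum_range_succ' _ (n + 1), hz n (n + 1) (by omega)] at h2
      simpa using h2.symm
    have e1 : ⁅∑ k ∈ Finset.range (n + 1), t ^ k • jacobsonCoeff x y n k, t • x⁆
        = ∑ k ∈ Finset.range (n + 1), t ^ (k + 1) • ⁅jacobsonCoeff x y n k, x⁆ := by
      simp only [sum_lie, smul_lie, lie_smul, smul_smul, Finset.smul_sum, pow_succ']
    have e2 : ⁅∑ k ∈ Finset.range (n + 1), t ^ k • jacobsonCoeff x y n k, y⁆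
        = ∑ k ∈ Finset.range (n + 1), t ^ (k + 1) • ⁅jacobsonCoeff x y n (k + 1), y⁆
          + ⁅jacobsonCoeff x y n 0, y⁆ := by
      rw [h1]
      simp only [add_lie, sum_lie, smul_lie]
    rw [lie_add, e1, e2]
    simp only [jacobsonCoeff, smul_add, Finset.sum_add_distrib, pow_zero, one_smul]
    abel

end RestrictedLie

/-! ## Products of restricted Lie algebras -/

section Products

variable {ι : Type*} (L : ι → Type*) [∀ i, LieRing (L i)]

/-- The product of Lie rings, with the componentwise bracket. -/
instance piProdLieRing : LieRing (∀ i, L i) where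
  bracket x y := fun i => ⁅x i, y i⁆
  add_lie x y z := by funext i; exact add_lie _ _ _
  lie_add x y z := by funext i; exact lie_add _ _ _
  lie_self x := by funext i; exact lie_self _
  leibniz_lie x y z := by funext i; exact leibniz_lie _ _ _

instance piProdLieAlgebra (R : Type*) [CommRing R] [∀ i, LieAlgebra R (L i)] :
    LieAlgebra R (∀ i, L i) where
  lie_smul a x y := by funext i; exact lie_smul _ _ _

variable {L}

theorem piProd_lie_apply (x y : ∀ i, L i) (i : ι) : ⁅x, y⁆ i = ⁅x i, y i⁆ := rfl

theorem piProd_bracketIter_apply (x y : ∀ i, L i) (n : ℕ) (i : ι) :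
    bracketIter x y n i = bracketIter (x i) (y i) n := by
  induction n with
  | zero => rfl
  | succ n ih => rw [bracketIter, bracketIter, piProd_lie_apply, ih]

theorem piProd_jacobsonCoeff_apply (x y : ∀ i, L i) (n k : ℕ) (i : ι) :
    jacobsonCoeff x y n k i = jacobsonCoeff (x i) (y i) n k := by
  induction n generalizing k with
  | zero => cases k <;> rfl
  | succ n ih =>
    cases k with
    | zero => rw [jacobsonCoeff, jacobsonCoeff, piProd_lie_apply, ih]
    | succ k =>
      rw [jacobsonCoeff, jacobsonCoeff, Pi.add_apply, piProd_lie_apply, piProd_lie_apply, ih, ih]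

/-- The product of restricted Lie algebras, with the componentwise `p`-power operation. -/
instance piProdRestricted (p : ℕ) [Fact p.Prime] [∀ i, LieAlgebra (ZMod p) (L i)]
    [∀ i, RestrictedLieAlgebra p (L i)] : RestrictedLieAlgebra p (∀ i, L i) where
  pPow x := fun i => RestrictedLieAlgebra.pPow p (x i)
  lie_pPow x y := by
    funext i
    rw [piProd_bracketIter_apply]
    exact RestrictedLieAlgebra.lie_pPow _ _
  smul_pPow a x := by funext i; exact RestrictedLieAlgebra.smul_pPow _ _
  add_pPow x y := by
    funext i
    simp only [Pi.add_apply, Finset.sum_apply, jacobsonS, Pi.smul_apply,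
      piProd_jacobsonCoeff_apply]
    exact RestrictedLieAlgebra.add_pPow _ _

end Products

/-! ## Polyhedral products -/

section Polyhedral

variable {m : ℕ}

/-- The faces of a simplicial complex on `m` vertices, with the empty face included. -/
def SFace (K : AbstractSimplicialComplex (Fin m)) : Type :=
  {I : Finset (Fin m) // I = ∅ ∨ I ∈ K.faces}

/-- The vertex `i` as a face. -/
def vertexFace (K : AbstractSimplicialComplex (Fin m)) (i : Fin m) : SFace K :=
  ⟨{i}, Or.inr (K.singleton_mem i)⟩

/-- The canonical map `G^I → G^J` for `I ⊆ J`: extension by `1`. -/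
def extendOne {G : Fin m → Type*} [∀ i, Group (G i)] (I J : Finset (Fin m))
    (x : ∀ i : I, G i) : ∀ j : J, G j :=
  fun j => if h : (j : Fin m) ∈ I then x ⟨j, h⟩ else 1

/-- The canonical map `L^I → L^J` for `I ⊆ J`: extension by `0`. -/
def extendZero {L : Fin m → Type*} [∀ i, Zero (L i)] (I J : Finset (Fin m))
    (x : ∀ i : I, L i) : ∀ j : J, L j :=
  fun j => if h : (j : Fin m) ∈ I then x ⟨j, h⟩ else 0

variable (K : AbstractSimplicialComplex (Fin m)) (G : Fin m → Type*) [∀ i, Group (G i)]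

/-- The relations of the colimit over the faces: the elements of `G^I` are identified with their
images in `G^J` for faces `I ⊆ J`. -/
def polyhedralRels : Set (Monoid.CoprodI fun I : SFace K => ∀ i : I.1, G i) :=
  {z | ∃ (I J : SFace K) (x : ∀ i : I.1, G i), I.1 ⊆ J.1 ∧
    z = Monoid.CoprodI.of (i := J) (extendOne I.1 J.1 x) * (Monoid.CoprodI.of (i := I) x)⁻¹}

/-- The graph product (polyhedral product) of groups: the colimit in the category of groups of
the products `G^I` over the faces `I` of `K`. -/
def GraphProd : Type _ :=
  (Monoid.CoprodI fun I : SFace K => ∀ i : I.1, G i) ⧸ Subgroup.normalClosure (polyhedralRels K G)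

instance : Group (GraphProd K G) :=
  inferInstanceAs (Group ((Monoid.CoprodI fun I : SFace K => ∀ i : I.1, G i) ⧸
    Subgroup.normalClosure (polyhedralRels K G)))

/-- The canonical homomorphism `G^I → G^K` for a face `I`. -/
def GraphProd.ofFace (I : SFace K) : (∀ i : I.1, G i) →* GraphProd K G :=
  (QuotientGroup.mk' (Subgroup.normalClosure (polyhedralRels K G))).comp
    (Monoid.CoprodI.of (M := fun I : SFace K => ∀ i : I.1, G i) (i := I))

/-- The canonical homomorphism `G_i → G^K` for a vertex `i`. -/
def GraphProd.ofVertex (i : Fin m) : G i →* GraphProd K G :=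
  (GraphProd.ofFace K G (vertexFace K i)).comp
    (MonoidHom.mulSingle (fun j : (vertexFace K i).1 => G j) ⟨i, Finset.mem_singleton_self i⟩)

/-- The family `φ` of homomorphisms `L^I → M` is compatible with the inclusions of faces, that is,
it is a cocone under the face diagram of `L`. -/
def IsFaceCocone (p : ℕ) [Fact p.Prime] {L : Fin m → Type*} [∀ i, LieRing (L i)]
    [∀ i, LieAlgebra (ZMod p) (L i)] [∀ i, RestrictedLieAlgebra p (L i)]
    {M : Type*} [LieRing M] [LieAlgebra (ZMod p) M] [RestrictedLieAlgebra p M]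
    (φ : ∀ I : SFace K, RestrictedLieHom p (∀ i : I.1, L i) M) : Prop :=
  ∀ (I J : SFace K), I.1 ⊆ J.1 → ∀ x : ∀ i : I.1, L i,
    (φ J).toLieHom (extendZero I.1 J.1 x) = (φ I).toLieHom x

/-- `M` with the homomorphisms `φ I : L^I → M` is the graph product (polyhedral product) of the
restricted Lie algebras `L i`: the colimit of the products `L^I` over the faces `I` of `K` in the
category of restricted Lie algebras. -/
def IsGraphProdLie.{u, v, w} (p : ℕ) [Fact p.Prime] (L : Fin m → Type u) [∀ i, LieRing (L i)]
    [∀ i, LieAlgebra (ZMod p) (L i)] [∀ i, RestrictedLieAlgebra p (L i)]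
    (M : Type v) [LieRing M] [LieAlgebra (ZMod p) M] [RestrictedLieAlgebra p M]
    (φ : ∀ I : SFace K, RestrictedLieHom p (∀ i : I.1, L i) M) : Prop :=
  IsFaceCocone K p φ ∧
    ∀ (N : Type w) [LieRing N] [LieAlgebra (ZMod p) N] [RestrictedLieAlgebra p N]
      (ψ : ∀ I : SFace K, RestrictedLieHom p (∀ i : I.1, L i) N), IsFaceCocone K p ψ →
      ∃! f : RestrictedLieHom p M N, ∀ (I : SFace K) (x : ∀ i : I.1, L i),
        f.toLieHom ((φ I).toLieHom x) = (ψ I).toLieHom x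

end Polyhedral

/-! ## `p`-central series and their associated graded Lie algebras -/

section CentralSeries

open scoped commutatorElement

/-- A `p`-central series on `G`, indexed by the positive integers. -/
structure PCentralSeries (p : ℕ) [Fact p.Prime] (G : Type*) [Group G] where
  toFun : ℕ+ → Subgroup G
  one_eq_top : toFun 1 = ⊤
  succ_le : ∀ k, toFun (k + 1) ≤ toFun k
  commutator_le : ∀ k l, ⁅toFun k, toFun l⁆ ≤ toFun (k + l)
  pow_mem : ∀ k, ∀ g ∈ toFun k, g ^ p ∈ toFun (⟨p, (Fact.out : p.Prime).pos⟩ * k)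

variable {p : ℕ} [Fact p.Prime] {G H : Type*} [Group G] [Group H]

variable (p G) in
/-- The lower `p`-central series: the smallest of all `p`-central series. Its term of index `k` is
the intersection of the terms of index `k` of all `p`-central series. -/
def lowerPCentralSeries : PCentralSeries p G where
  toFun k := ⨅ Γ : PCentralSeries p G, Γ.toFun k
  one_eq_top := by simp [PCentralSeries.one_eq_top]
  succ_le k := iInf_mono fun Γ => Γ.succ_le k
  commutator_le k l := le_iInf fun Γ =>
    (Subgroup.commutator_mono (iInf_le _ Γ) (iInf_le _ Γ)).trans (Γ.commutator_le k l)
  pow_mem k g hg := by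
    rw [Subgroup.mem_iInf] at hg ⊢
    exact fun Γ => Γ.pow_mem k g (hg Γ)

/-- The lower `p`-central series is contained in every `p`-central series. -/
theorem lowerPCentralSeries_le (Γ : PCentralSeries p G) (k : ℕ+) :
    (lowerPCentralSeries p G).toFun k ≤ Γ.toFun k := iInf_le _ Γ

namespace PCentralSeries

variable (Γ : PCentralSeries p G)

theorem comm_mem {k l : ℕ+} {g h : G} (hg : g ∈ Γ.toFun k) (hh : h ∈ Γ.toFun l) :
    ⁅g, h⁆ ∈ Γ.toFun (k + l) :=
  Γ.commutator_le k l (Subgroup.commutator_mem_commutator hg hh)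

theorem comm_mem_succ {k : ℕ+} {g : G} (h : G) (hg : g ∈ Γ.toFun k) :
    ⁅g, h⁆ ∈ Γ.toFun (k + 1) :=
  Γ.comm_mem hg (by rw [Γ.one_eq_top]; trivial)

theorem le_of_lt {k l : ℕ+} (h : k ≤ l) : Γ.toFun l ≤ Γ.toFun k := by
  induction l using PNat.recOn with
  | one => rw [show k = 1 from le_antisymm h (one_le (a := k))]
  | succ l ih =>
    rcases h.eq_or_lt with rfl | h
    · exact le_rfl
    · exact (Γ.succ_le l).trans (ih (PNat.lt_add_one_iff.mp h))

theorem conj_mem {k : ℕ+} {g : G} (h : G) (hg : g ∈ Γ.toFun k) : h * g * h⁻¹ ∈ Γ.toFun k := by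
  have h1 := (Γ.toFun k).mul_mem ((Γ.toFun k).inv_mem (Γ.succ_le k (Γ.comm_mem_succ h hg))) hg
  rwa [show ⁅g, h⁆⁻¹ * g = h * g * h⁻¹ by simp [commutatorElement_def, mul_assoc]] at h1

instance normal (k : ℕ+) : (Γ.toFun k).Normal := ⟨fun _ hg h => Γ.conj_mem h hg⟩

/-- The quotient `Γ_k / Γ_{k+1}`, written multiplicatively. -/
abbrev Quo (k : ℕ+) : Type _ := Γ.toFun k ⧸ (Γ.toFun (k + 1)).subgroupOf (Γ.toFun k)

/-- The class of `g ∈ Γ_k` in `Γ_k / Γ_{k+1}`. -/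
abbrev cls (k : ℕ+) (g : G) (hg : g ∈ Γ.toFun k) : Γ.Quo k := QuotientGroup.mk ⟨g, hg⟩

theorem cls_eq {k : ℕ+} {g h : G} (hg : g ∈ Γ.toFun k) (hh : h ∈ Γ.toFun k)
    (H : g⁻¹ * h ∈ Γ.toFun (k + 1)) : Γ.cls k g hg = Γ.cls k h hh :=
  QuotientGroup.eq.mpr H

theorem cls_conj {k : ℕ+} {g : G} (h : G) (hg : g ∈ Γ.toFun k) :
    Γ.cls k (h * g * h⁻¹) (Γ.conj_mem h hg) = Γ.cls k g hg := by
  apply Γ.cls_eq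
  have e : (h * g * h⁻¹)⁻¹ * g = g⁻¹ * (g * (h * g * h⁻¹)⁻¹) * g⁻¹⁻¹ := by group
  rw [e]
  apply Γ.conj_mem
  have := Γ.comm_mem_succ h hg
  rwa [show ⁅g, h⁆ = g * (h * g * h⁻¹)⁻¹ by simp [commutatorElement_def, mul_assoc]] at this

instance quoCommGroup (k : ℕ+) : CommGroup (Γ.Quo k) :=
  { (inferInstance : Group (Γ.Quo k)) with
    mul_comm := by
      rintro ⟨a, ha⟩ ⟨b, hb⟩
      have := Γ.cls_conj a⁻¹ ((Γ.toFun k).mul_mem ha hb)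
      refine Eq.trans this.symm ?_
      apply Γ.cls_eq
      rw [show (a⁻¹ * (a * b) * a⁻¹⁻¹)⁻¹ * (b * a) = 1 by group]
      exact Subgroup.one_mem _ }

/-- For `g ∈ Γ_k`, the homomorphism `h ↦ (g, h)` from `Γ_l / Γ_{l+1}` to `Γ_{k+l} / Γ_{k+l+1}`. -/
def commRight (k l : ℕ+) (g : Γ.toFun k) : Γ.Quo l →* Γ.Quo (k + l) :=
  QuotientGroup.lift _
    { toFun := fun h => Γ.cls (k + l) ⁅(g : G), (h : G)⁆ (Γ.comm_mem g.2 h.2)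
      map_one' := by
        refine Γ.cls_eq (h := 1) _ (Subgroup.one_mem _) ?_
        simp
      map_mul' := fun a b => by
        rw [← Γ.cls_conj (a : G) (Γ.comm_mem g.2 b.2)]
        refine Γ.cls_eq _ ((Γ.toFun (k + l)).mul_mem (Γ.comm_mem g.2 a.2)
          (Γ.conj_mem _ (Γ.comm_mem g.2 b.2))) ?_
        rw [Subgroup.coe_mul, commutatorElement_mul_right_eq_mul_conj]
        convert Subgroup.one_mem _
        group }
    (fun h hh => by
      refine Γ.cls_eq (h := 1) _ (Subgroup.one_mem _) ?_
      have h1 : (h : G) ∈ Γ.toFun (l + 1) := hh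
      have h2 := Γ.comm_mem g.2 h1
      rw [← add_assoc] at h2
      rw [mul_one]
      exact Subgroup.inv_mem _ h2)

/-- The commutator pairing `Γ_k / Γ_{k+1} × Γ_l / Γ_{l+1} → Γ_{k+l} / Γ_{k+l+1}`. -/
def commPairing (k l : ℕ+) : Γ.Quo k →* Γ.Quo l →* Γ.Quo (k + l) :=
  QuotientGroup.lift _
    { toFun := Γ.commRight k l
      map_one' := by
        ext ⟨h, hh⟩
        refine Γ.cls_eq (h := 1) _ (Subgroup.one_mem _) ?_
        simp
      map_mul' := fun a b => by
        ext ⟨h, hh⟩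
        rw [MonoidHom.comp_apply, MonoidHom.comp_apply, MonoidHom.mul_apply, mul_comm]
        have h1 := Γ.cls_conj (a : G) (Γ.comm_mem b.2 hh)
        refine Eq.trans ?_ (congrArg (· * Γ.cls (k + l) ⁅(a : G), h⁆ (Γ.comm_mem a.2 hh)) h1)
        refine Γ.cls_eq _ ((Γ.toFun (k + l)).mul_mem (Γ.conj_mem _ (Γ.comm_mem b.2 hh))
          (Γ.comm_mem a.2 hh)) ?_
        rw [Subgroup.coe_mul, commutatorElement_mul_left_eq_conj_mul]
        convert Subgroup.one_mem _
        group }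
    (fun g hg => by
      ext ⟨h, hh⟩
      refine Γ.cls_eq (h := 1) _ (Subgroup.one_mem _) ?_
      have h1 : (g : G) ∈ Γ.toFun (k + 1) := hg
      have h2 := Γ.comm_mem h1 hh
      rw [add_right_comm] at h2
      rw [mul_one]
      exact Subgroup.inv_mem _ h2)

theorem commPairing_cls {k l : ℕ+} {g h : G} (hg : g ∈ Γ.toFun k) (hh : h ∈ Γ.toFun l) :
    Γ.commPairing k l (Γ.cls k g hg) (Γ.cls l h hh) =
      Γ.cls (k + l) ⁅g, h⁆ (Γ.comm_mem hg hh) := rfl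

/-- The associated graded abelian group of a `p`-central series. -/
def Gr : Type _ := DirectSum ℕ+ fun k => Additive (Γ.Quo k)

noncomputable instance : AddCommGroup Γ.Gr :=
  inferInstanceAs (AddCommGroup (DirectSum ℕ+ fun k => Additive (Γ.Quo k)))

/-- The inclusion of the component of degree `k`. -/
noncomputable def ofDeg (k : ℕ+) : Additive (Γ.Quo k) →+ Γ.Gr :=
  DirectSum.of (fun k => Additive (Γ.Quo k)) k

/-- The class `ḡ` of `g ∈ Γ_k` in the associated graded group. -/
noncomputable def grMk (k : ℕ+) (g : G) (hg : g ∈ Γ.toFun k) : Γ.Gr :=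
  Γ.ofDeg k (Additive.ofMul (Γ.cls k g hg))

theorem gr_induction {P : Γ.Gr → Prop} (h0 : P 0) (h1 : ∀ k g hg, P (Γ.grMk k g hg))
    (h2 : ∀ x y, P x → P y → P (x + y)) (x : Γ.Gr) : P x := by
  refine DirectSum.induction_on (motive := P) x h0 ?_ h2
  rintro k ⟨g, hg⟩
  exact h1 k g hg

theorem grMk_mul {k : ℕ+} {g h : G} (hg : g ∈ Γ.toFun k) (hh : h ∈ Γ.toFun k) :
    Γ.grMk k (g * h) ((Γ.toFun k).mul_mem hg hh) = Γ.grMk k g hg + Γ.grMk k h hh :=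
  map_add (Γ.ofDeg k) (Additive.ofMul (Γ.cls k g hg)) (Additive.ofMul (Γ.cls k h hh))

theorem grMk_inv {k : ℕ+} {g : G} (hg : g ∈ Γ.toFun k) :
    Γ.grMk k g⁻¹ ((Γ.toFun k).inv_mem hg) = -Γ.grMk k g hg :=
  map_neg (Γ.ofDeg k) (Additive.ofMul (Γ.cls k g hg))

theorem grMk_eq_zero {k : ℕ+} {g : G} (hg : g ∈ Γ.toFun k) (h : g ∈ Γ.toFun (k + 1)) :
    Γ.grMk k g hg = 0 := by
  have : Γ.cls k g hg = 1 := Γ.cls_eq (h := 1) hg (Subgroup.one_mem _) (by simpa using h)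
  rw [grMk, this]
  exact map_zero (Γ.ofDeg k)

theorem grMk_conj {k : ℕ+} {g : G} (h : G) (hg : g ∈ Γ.toFun k) :
    Γ.grMk k (h * g * h⁻¹) (Γ.conj_mem h hg) = Γ.grMk k g hg := by
  rw [grMk, grMk, Γ.cls_conj]

theorem grMk_congr {k l : ℕ+} {g h : G} (hg : g ∈ Γ.toFun k) (e : k = l) (e' : g = h) :
    Γ.grMk k g hg = Γ.grMk l h (e ▸ e' ▸ hg) := by
  subst e e'
  rfl

theorem nsmul_gr (x : Γ.Gr) : p • x = 0 := by
  refine Γ.gr_induction (P := fun x => p • x = 0) (smul_zero _) ?_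
    (fun x y hx hy => by rw [smul_add, hx, hy, add_zero]) x
  intro k g hg
  have hn : ∀ n : ℕ, Γ.grMk k (g ^ n) ((Γ.toFun k).pow_mem hg n) = n • Γ.grMk k g hg := fun n =>
    map_nsmul (Γ.ofDeg k) n (Additive.ofMul (Γ.cls k g hg))
  rw [← hn]
  apply Γ.grMk_eq_zero
  refine Γ.le_of_lt ?_ (Γ.pow_mem k g hg)
  have h2 := (Fact.out : p.Prime).two_le
  have hk := k.pos
  rw [← PNat.coe_le_coe]
  push_cast
  change (k : ℕ) + 1 ≤ p * k
  nlinarith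

noncomputable instance : Module (ZMod p) Γ.Gr := AddCommGroup.zmodModule Γ.nsmul_gr

/-- The commutator pairing in additive notation, with values in the associated graded group. -/
noncomputable def addPairing (k l : ℕ+) : Additive (Γ.Quo k) →+ Additive (Γ.Quo l) →+ Γ.Gr :=
  AddMonoidHom.mk' (fun a => (Γ.ofDeg (k + l)).comp
      (MonoidHom.toAdditive (Γ.commPairing k l a.toMul)))
    (fun a b => by
      refine AddMonoidHom.ext fun x => ?_
      change Γ.ofDeg (k + l) (Additive.ofMul (Γ.commPairing k l (a.toMul * b.toMul) x.toMul)) = _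
      rw [map_mul]
      exact map_add (Γ.ofDeg (k + l)) _ _)

/-- The bracket of the associated graded group as a biadditive map: the biadditive extension of
`[ḡ, h̄] = class of (g, h)`. -/
noncomputable def grBracket : Γ.Gr →+ Γ.Gr →+ Γ.Gr :=
  DirectSum.toAddMonoid fun k => AddMonoidHom.flip
    (DirectSum.toAddMonoid fun l => AddMonoidHom.flip (Γ.addPairing k l))

theorem grBracket_grMk {k l : ℕ+} {g h : G} (hg : g ∈ Γ.toFun k) (hh : h ∈ Γ.toFun l) :
    Γ.grBracket (Γ.grMk k g hg) (Γ.grMk l h hh) = Γ.grMk (k + l) ⁅g, h⁆ (Γ.comm_mem hg hh) := by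
  unfold grBracket grMk ofDeg
  erw [DirectSum.toAddMonoid_of, AddMonoidHom.flip_apply, DirectSum.toAddMonoid_of]
  rfl

theorem grBracket_skew (x y : Γ.Gr) : Γ.grBracket x y = -Γ.grBracket y x := by
  refine Γ.gr_induction (P := fun x => Γ.grBracket x y = -Γ.grBracket y x) (by simp) ?_
    (fun a b ha hb => by simp only [map_add, AddMonoidHom.add_apply, ha, hb]; abel) x
  intro k g hg
  refine Γ.gr_induction (P := fun y => Γ.grBracket (Γ.grMk k g hg) y =
      -Γ.grBracket y (Γ.grMk k g hg)) (by simp) ?_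
    (fun a b ha hb => by simp only [map_add, AddMonoidHom.add_apply, ha, hb]; abel) y
  intro l h hh
  rw [Γ.grBracket_grMk, Γ.grBracket_grMk, ← Γ.grMk_inv]
  exact Γ.grMk_congr _ (add_comm _ _) (commutatorElement_inv _ _).symm

theorem grBracket_self (x : Γ.Gr) : Γ.grBracket x x = 0 := by
  refine Γ.gr_induction (P := fun x => Γ.grBracket x x = 0) (by simp) ?_ ?_ x
  · intro k g hg
    rw [Γ.grBracket_grMk]
    apply Γ.grMk_eq_zero
    simp
  · intro a b ha hb
    simp only [map_add, AddMonoidHom.add_apply, ha, hb, Γ.grBracket_skew a b]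
    abel

theorem grBracket_jacobi (x y z : Γ.Gr) :
    Γ.grBracket (Γ.grBracket x y) z + Γ.grBracket (Γ.grBracket y z) x
      + Γ.grBracket (Γ.grBracket z x) y = 0 := by
  have key : ∀ {k l n : ℕ+} {a b c : G} (ha : a ∈ Γ.toFun k) (hb : b ∈ Γ.toFun l)
      (hc : c ∈ Γ.toFun n),
      Γ.grBracket (Γ.grBracket (Γ.grMk k a ha) (Γ.grMk l b hb)) (Γ.grMk n c hc) =
        Γ.grMk (k + l + n) ⁅⁅a, b⁆, b * c * b⁻¹⁆
          (Γ.comm_mem (Γ.comm_mem ha hb) (Γ.conj_mem b hc)) := by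
    intro k l n a b c ha hb hc
    rw [← Γ.grMk_conj b hc, Γ.grBracket_grMk, Γ.grBracket_grMk]
  refine Γ.gr_induction (P := fun x => Γ.grBracket (Γ.grBracket x y) z +
    Γ.grBracket (Γ.grBracket y z) x + Γ.grBracket (Γ.grBracket z x) y = 0) (by simp) ?_
    (fun a b ha hb => ?_) x
  swap
  · rw [← add_zero (0 : Γ.Gr)]
    nth_rw 1 [← ha]
    rw [← hb]
    simp only [map_add, AddMonoidHom.add_apply]
    abel
  intro k a ha
  refine Γ.gr_induction (P := fun y => Γ.grBracket (Γ.grBracket (Γ.grMk k a ha) y) z +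
    Γ.grBracket (Γ.grBracket y z) (Γ.grMk k a ha) +
    Γ.grBracket (Γ.grBracket z (Γ.grMk k a ha)) y = 0) (by simp) ?_ (fun b c hb hc => ?_) y
  swap
  · rw [← add_zero (0 : Γ.Gr)]
    nth_rw 1 [← hb]
    rw [← hc]
    simp only [map_add, AddMonoidHom.add_apply]
    abel
  intro l b hb
  refine Γ.gr_induction (P := fun z =>
    Γ.grBracket (Γ.grBracket (Γ.grMk k a ha) (Γ.grMk l b hb)) z +
    Γ.grBracket (Γ.grBracket (Γ.grMk l b hb) z) (Γ.grMk k a ha) +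
    Γ.grBracket (Γ.grBracket z (Γ.grMk k a ha)) (Γ.grMk l b hb) = 0) (by simp) ?_
    (fun c d hc hd => ?_) z
  swap
  · rw [← add_zero (0 : Γ.Gr)]
    nth_rw 1 [← hc]
    rw [← hd]
    simp only [map_add, AddMonoidHom.add_apply]
    abel
  intro n c hc
  rw [key ha hb hc, key hb hc ha, key hc ha hb,
    Γ.grMk_congr (k := l + n + k) (l := k + l + n) _ (by rw [add_comm (l + n), add_assoc]) rfl,
    Γ.grMk_congr (k := n + k + l) (l := k + l + n) _ (by rw [add_assoc n, add_comm]) rfl,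
    ← Γ.grMk_mul, ← Γ.grMk_mul]
  apply Γ.grMk_eq_zero
  rw [commutatorElement_commutatorElement_conj_mul]
  exact Subgroup.one_mem _

/-- The associated graded Lie ring, with the bracket `[ḡ, h̄] = class of (g, h)`. -/
noncomputable instance : LieRing Γ.Gr where
  bracket x y := Γ.grBracket x y
  add_lie x y z := by
    change Γ.grBracket (x + y) z = Γ.grBracket x z + Γ.grBracket y z
    rw [map_add, AddMonoidHom.add_apply]
  lie_add x y z := map_add (Γ.grBracket x) y z
  lie_self x := Γ.grBracket_self x
  leibniz_lie x y z := by
    change Γ.grBracket x (Γ.grBracket y z) =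
      Γ.grBracket (Γ.grBracket x y) z + Γ.grBracket y (Γ.grBracket x z)
    have h := Γ.grBracket_jacobi x y z
    rw [Γ.grBracket_skew x (Γ.grBracket y z), Γ.grBracket_skew y (Γ.grBracket x z),
      Γ.grBracket_skew x z, map_neg, AddMonoidHom.neg_apply, neg_neg]
    rw [← sub_eq_zero]
    rw [← neg_eq_zero] at h
    rw [← h]
    abel

noncomputable instance : LieAlgebra (ZMod p) Γ.Gr where
  lie_smul a x y := ZMod.map_smul (Γ.grBracket x) a y

theorem grMk_lie {k l : ℕ+} {g h : G} (hg : g ∈ Γ.toFun k) (hh : h ∈ Γ.toFun l) :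
    ⁅Γ.grMk k g hg, Γ.grMk l h hh⁆ = Γ.grMk (k + l) ⁅g, h⁆ (Γ.comm_mem hg hh) :=
  Γ.grBracket_grMk hg hh

/-- The `p`-power operation `P` on the associated graded Lie algebra is the one given on
homogeneous elements by `ḡ^{[p]} = class of g ^ p`. A restricted Lie algebra structure is
determined by its `p`-power operation on homogeneous elements. -/
def IsGrPower (P : Γ.Gr → Γ.Gr) : Prop :=
  ∀ (k : ℕ+) (g : G) (hg : g ∈ Γ.toFun k),
    P (Γ.grMk k g hg) = Γ.grMk (⟨p, (Fact.out : p.Prime).pos⟩ * k) (g ^ p) (Γ.pow_mem k g hg)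

/-- There is at most one restricted Lie algebra structure on the associated graded Lie algebra
with the prescribed `p`-powers of homogeneous elements. -/
theorem isGrPower_unique (S T : RestrictedLieAlgebra p Γ.Gr) (hS : Γ.IsGrPower S.pPow)
    (hT : Γ.IsGrPower T.pPow) : S.pPow = T.pPow := by
  funext x
  refine Γ.gr_induction (P := fun x => S.pPow x = T.pPow x) ?_ ?_ ?_ x
  · have h1 := S.smul_pPow 0 0
    have h2 := T.smul_pPow 0 0
    rw [zero_pow (Fact.out : p.Prime).ne_zero, zero_smul, zero_smul] at h1 h2
    rw [h1, h2]
  · intro k g hg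
    rw [hS, hT]
  · intro x y hx hy
    rw [S.add_pPow, T.add_pPow, hx, hy]

end PCentralSeries

/-- The preimage of a `p`-central series under a homomorphism. -/
def PCentralSeries.comap (Γ : PCentralSeries p H) (f : G →* H) : PCentralSeries p G where
  toFun k := (Γ.toFun k).comap f
  one_eq_top := by rw [Γ.one_eq_top, Subgroup.comap_top]
  succ_le k := Subgroup.comap_mono (Γ.succ_le k)
  commutator_le k l := by
    rw [Subgroup.commutator_le]
    intro g hg h hh
    rw [Subgroup.mem_comap, map_commutatorElement]
    exact Γ.comm_mem hg hh
  pow_mem k g hg := by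
    rw [Subgroup.mem_comap, map_pow]
    exact Γ.pow_mem k _ hg

theorem lowerPCentralSeries_map_mem (f : G →* H) {k : ℕ+} {g : G}
    (hg : g ∈ (lowerPCentralSeries p G).toFun k) : f g ∈ (lowerPCentralSeries p H).toFun k :=
  lowerPCentralSeries_le ((lowerPCentralSeries p H).comap f) k hg

variable (p G) in
/-- The Lie algebra associated with the lower `p`-central series. -/
abbrev grLower : Type _ := (lowerPCentralSeries p G).Gr

variable (p) in
/-- The map of associated graded groups induced by a group homomorphism `f`; it sends the class of
`g` to the class of `f g`. -/
noncomputable def grLowerMap (f : G →* H) : grLower p G →+ grLower p H :=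
  DirectSum.toAddMonoid fun k => ((lowerPCentralSeries p H).ofDeg k).comp
    (MonoidHom.toAdditive (QuotientGroup.map _ _
      ((f.comp ((lowerPCentralSeries p G).toFun k).subtype).codRestrict
        ((lowerPCentralSeries p H).toFun k) fun g => lowerPCentralSeries_map_mem f g.2)
      fun _ hg => lowerPCentralSeries_map_mem f hg))

theorem grLowerMap_grMk (f : G →* H) {k : ℕ+} {g : G}
    (hg : g ∈ (lowerPCentralSeries p G).toFun k) :
    grLowerMap p f ((lowerPCentralSeries p G).grMk k g hg) =
      (lowerPCentralSeries p H).grMk k (f g) (lowerPCentralSeries_map_mem f hg) := by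
  unfold grLowerMap PCentralSeries.grMk PCentralSeries.ofDeg
  erw [DirectSum.toAddMonoid_of]
  rfl

end CentralSeries

universe u w

/-! ## Jacobson's formulas in associative algebras of characteristic `p` -/

section Maps

/-! Two facts carry the theorem: the graded object of a `p`-central series on a finitely generated
group is restricted, and a restricted Lie algebra embeds in an associative algebra in which
`x^{[p]}` becomes the `p`-th power. In an associative algebra of characteristic `p` the axioms of a
`p`-power operation are identities (`bracketIter_eq_lie_pow`, `add_pow_eq_add_sum_jacobsonS`).

Restricted structure. A `p`-central series filters the group algebra over `ZMod p`, with `g - 1` of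
weight `k` for `g ∈ Γ_k`. Symbols of `g - 1` define a Lie homomorphism from the graded Lie algebra
of the series to the graded algebra of the filtration, and since `(g - 1) ^ p = g ^ p - 1` its image
is closed under `p`-th powers. The point is injectivity (`mem_of_mem_augFiltration`): if `g ∈ Γ_k`
and `g - 1` has weight `k + 1`, then `g ∈ Γ_{k+1}`. Finite generation makes `G / Γ_{k+1}` a finite
`p`-group. There the counting argument of Jennings applies: ordered monomials in lifts of bases of
the layers, with exponents below `p`, span the group algebra compatibly with the filtration, and
their number is the order of the group, so they form a basis
(`eq_one_of_mem_augFiltration_of_finite`).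

Universal property. The layers of `gr (G_i)` beyond degree one vanish, so a cocone to `N` amounts to
elements of `N`, one for each basis element of each `G_i`, with zero `p`-power and commuting within
faces. Embed `N` in an associative algebra `U` (`exists_restricted_embedding`, a restricted
Poincaré–Birkhoff–Witt theorem proved with the diamond lemma). If `u ∈ U` is the image of such an
element, then `u ^ p = 0`, so `1 + uX` has `p`-th power one in `U[X]`, and these units define a
representation of the graph product. It carries the lower `p`-central series into the filtration by
powers of `X`, and the leading coefficients form a Lie homomorphism to `U` compatible with
`p`-powers (`GraphProd.exists_restrictedLieHom`). The lower series is the smallest one, so its Lie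
algebra is generated in degree one (`mem_of_grLower_degree_one`). Hence the homomorphism takes
values in `N`, and it is unique. -/

theorem map_bracketIter {R L M : Type*} [CommRing R] [LieRing L] [LieAlgebra R L] [LieRing M]
    [LieAlgebra R M] (f : L →ₗ⁅R⁆ M) (x y : L) (n : ℕ) :
    f (bracketIter x y n) = bracketIter (f x) (f y) n := by
  induction n with
  | zero => rfl
  | succ n ih => rw [bracketIter, bracketIter, LieHom.map_lie, ih]

theorem map_jacobsonCoeff {R L M : Type*} [CommRing R] [LieRing L] [LieAlgebra R L] [LieRing M]
    [LieAlgebra R M] (f : L →ₗ⁅R⁆ M) (x y : L) (n k : ℕ) :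
    f (jacobsonCoeff x y n k) = jacobsonCoeff (f x) (f y) n k := by
  induction n generalizing k with
  | zero => cases k <;> simp [jacobsonCoeff]
  | succ n ih => cases k <;> simp [jacobsonCoeff, ih]

theorem map_jacobsonS {p : ℕ} [Fact p.Prime] {L M : Type*} [LieRing L] [LieAlgebra (ZMod p) L]
    [LieRing M] [LieAlgebra (ZMod p) M] (f : L →ₗ⁅ZMod p⁆ M) (i : ℕ) (x y : L) :
    f (jacobsonS p i x y) = jacobsonS p i (f x) (f y) := by
  rw [jacobsonS, jacobsonS, map_smul, map_jacobsonCoeff]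

/-- Additivity of the `p`-power operation on commuting elements. -/
theorem pPow_add_of_lie_eq_zero {p : ℕ} [Fact p.Prime] {L : Type*} [LieRing L]
    [LieAlgebra (ZMod p) L] [RestrictedLieAlgebra p L] {x y : L} (h : ⁅x, y⁆ = 0) :
    RestrictedLieAlgebra.pPow p (x + y) =
      RestrictedLieAlgebra.pPow p x + RestrictedLieAlgebra.pPow p y := by
  have h1 : ∀ n k, jacobsonCoeff x y (n + 1) k = 0 := by
    intro n
    induction n with
    | zero =>
      intro k
      rcases k with _ | _ | k <;> simp [jacobsonCoeff, h]
    | succ n ih => intro k; cases k <;> rw [jacobsonCoeff] <;> simp [ih]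
  rw [RestrictedLieAlgebra.add_pPow, Finset.sum_eq_zero, add_zero]
  intro i hi
  obtain ⟨n, hn⟩ : ∃ n, p - 1 = n + 1 :=
    ⟨p - 2, by have := (Fact.out : p.Prime).two_le; omega⟩
  rw [jacobsonS, hn, h1, smul_zero]

theorem pPow_zero (p : ℕ) [Fact p.Prime] (L : Type*) [LieRing L]
    [LieAlgebra (ZMod p) L] [RestrictedLieAlgebra p L] :
    RestrictedLieAlgebra.pPow p (0 : L) = 0 := by
  have h := RestrictedLieAlgebra.smul_pPow (p := p) (0 : ZMod p) (0 : L)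
  rwa [zero_pow (Fact.out : p.Prime).ne_zero, zero_smul, zero_smul] at h

theorem pPow_sum_of_lie_eq_zero {p : ℕ} [Fact p.Prime] {L : Type*} [LieRing L]
    [LieAlgebra (ZMod p) L] [RestrictedLieAlgebra p L] {ι : Type*} (s : Finset ι) (x : ι → L)
    (h : ∀ i j, i ≠ j → ⁅x i, x j⁆ = 0) :
    RestrictedLieAlgebra.pPow p (∑ i ∈ s, x i) = ∑ i ∈ s, RestrictedLieAlgebra.pPow p (x i) := by
  classical
  induction s using Finset.induction_on with
  | empty => simp [pPow_zero]
  | insert a s ha ih =>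
    rw [Finset.sum_insert ha, Finset.sum_insert ha, pPow_add_of_lie_eq_zero, ih]
    rw [lie_sum]
    exact Finset.sum_eq_zero fun j hj => h a j fun e => ha (e ▸ hj)

end Maps

section Associative

attribute [local instance] LieRing.ofAssociativeRing

/-- Modulo `p` the sum of two neighbouring coefficients in row `p - 1` is an entry of row `p` and
vanishes, so the signs alternate, starting from one. -/
theorem choose_prime_sub_one_mul_neg_one_pow (p : ℕ) [Fact p.Prime] {i : ℕ} (hi : i < p) :
    ((p - 1).choose i : ZMod p) * (-1) ^ i = 1 := by
  induction i with
  | zero => simp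
  | succ i ih =>
    have hp := (Fact.out : p.Prime).pos
    have h1 := Nat.choose_succ_succ (p - 1) i
    have h2 : (p.choose (i + 1) : ZMod p) = 0 :=
      (ZMod.natCast_eq_zero_iff _ _).mpr ((Fact.out : p.Prime).dvd_choose_self (by omega) hi)
    rw [show (p - 1).succ = p by omega] at h1
    rw [h1] at h2
    push_cast at h2
    have h3 := ih (by omega)
    rw [pow_succ]
    linear_combination (-(-1) ^ i : ZMod p) * h2 + h3

variable {E : Type*} [Ring E]

theorem bracketIter_eq_sub_pow (R : Type*) [CommRing R] [Algebra R E] (x y : E) (n : ℕ) :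
    bracketIter x y n = ((LinearMap.mulRight R y - LinearMap.mulLeft R y) ^ n) x := by
  induction n with
  | zero => rfl
  | succ n ih =>
    rw [bracketIter, ih, pow_succ', Module.End.mul_apply, LinearMap.sub_apply,
      LinearMap.mulRight_apply, LinearMap.mulLeft_apply, Ring.lie_def]

/-- The operator `⁅·, y⁆` is right minus left multiplication by `y`. These commute, so in
characteristic `p` the `p`-th power of the difference is the difference of the `p`-th powers. -/
theorem bracketIter_eq_lie_pow (p : ℕ) [Fact p.Prime] [Algebra (ZMod p) E] (x y : E) :
    bracketIter x y p = ⁅x, y ^ p⁆ := by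
  rcases subsingleton_or_nontrivial E with h | h
  · exact Subsingleton.elim _ _
  · have : CharP (Module.End (ZMod p) E) p := by
      refine charP_of_injective_algebraMap (R := ZMod p) ?_ p
      exact FaithfulSMul.algebraMap_injective _ _
    rw [bracketIter_eq_sub_pow (ZMod p), sub_pow_char_of_commute _
      (LinearMap.commute_mulLeft_right _ _).symm, LinearMap.pow_mulRight, LinearMap.pow_mulLeft,
      Ring.lie_def]
    rfl

/-- In the binomial expansion of `(R_y - L_y) ^ (p - 1)` the coefficients cancel the signs modulo
`p`. The left side is the noncommutative derivative of `y ^ p` in the direction `x`, which is how it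
enters Jacobson's formula. -/
theorem sum_pow_mul_mul_pow (p : ℕ) [Fact p.Prime] [Algebra (ZMod p) E] (x y : E) :
    ∑ i ∈ Finset.range p, y ^ i * x * y ^ (p - 1 - i) = bracketIter x y (p - 1) := by
  have hp := (Fact.out : p.Prime).pos
  rw [bracketIter_eq_sub_pow (ZMod p), sub_eq_neg_add,
    Commute.add_pow (Commute.neg_left (LinearMap.commute_mulLeft_right _ _)),
    LinearMap.sum_apply, show p - 1 + 1 = p by omega]
  refine Finset.sum_congr rfl fun i hi => ?_
  have hi := Finset.mem_range.mp hi
  rw [neg_pow, LinearMap.pow_mulLeft, LinearMap.pow_mulRight, ← (Nat.cast_commute _ _).eq,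
    ← mul_assoc, ← mul_assoc]
  have h1 : (((p - 1).choose i : Module.End (ZMod p) E) * (-1) ^ i) = 1 := by
    have := congrArg (algebraMap (ZMod p) (Module.End (ZMod p) E))
      (choose_prime_sub_one_mul_neg_one_pow p hi)
    simpa using this
  rw [h1, one_mul]
  simp [mul_assoc]

open Polynomial in
theorem coeff_bracketIter_C (x y : E) (n k : ℕ) :
    (bracketIter (C x) (X * C x + C y) n : E[X]).coeff k = jacobsonCoeff x y n k := by
  induction n generalizing k with
  | zero =>
    cases k with
    | zero => simp [bracketIter, jacobsonCoeff]
    | succ k => simp [bracketIter, jacobsonCoeff]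
  | succ n ih =>
    have h : ∀ f : E[X], ⁅f, X * C x + C y⁆ = X * ⁅f, C x⁆ + ⁅f, C y⁆ := by
      intro f
      simp only [Ring.lie_def, mul_add, add_mul, ← mul_assoc, mul_sub]
      rw [← X_mul (p := f)]
      abel
    cases k with
    | zero =>
      rw [bracketIter, h, jacobsonCoeff, ← ih]
      simp [Ring.lie_def]
    | succ k =>
      rw [bracketIter, h, jacobsonCoeff, ← ih, ← ih]
      simp [Ring.lie_def, coeff_X_mul, add_comm]

open Polynomial in
-- Let `q = X x + y`. The derivative of `q ^ p` is the iterated bracket of `x` with `q`, so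
-- comparison of coefficients determines `i` times the coefficient of `X ^ i` in `q ^ p`, and `i` is
-- invertible for `0 < i < p`. The extreme coefficients are `y ^ p` and `x ^ p`; the formula is the
-- value at `X = 1`.
theorem add_pow_eq_add_sum_jacobsonS (p : ℕ) [Fact p.Prime] [Algebra (ZMod p) E] (x y : E) :
    (x + y) ^ p = x ^ p + y ^ p + ∑ i ∈ Finset.Icc 1 (p - 1), jacobsonS p i x y := by
  have hp := (Fact.out : p.Prime).pos
  set q : E[X] := X * C x + C y with hq
  have hdeg : ∀ n, (q ^ n).natDegree ≤ n := fun n => by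
    refine (natDegree_pow_le_of_le (m := 1) n ?_).trans_eq (mul_one n)
    refine natDegree_add_le_of_degree_le ?_ (by simp)
    rw [X_mul_C]
    exact (natDegree_C_mul_le _ _).trans natDegree_X_le
  have hder : derivative (q ^ p) = bracketIter (C x) q (p - 1) := by
    rw [← sum_pow_mul_mul_pow]
    have hq1 : derivative q = C x := by simp [hq, derivative_mul]
    have : ∀ n, derivative (q ^ n) = ∑ i ∈ Finset.range n, q ^ i * C x * q ^ (n - 1 - i) := by
      intro n
      induction n with
      | zero => simp
      | succ n ih =>
        rw [pow_succ, derivative_mul, ih, hq1, Finset.sum_range_succ, Finset.sum_mul]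
        congr 1
        · refine Finset.sum_congr rfl fun i hi => ?_
          have := Finset.mem_range.mp hi
          rw [mul_assoc, ← pow_succ]
          congr 2
          omega
        · simp
    exact this p
  have hmid : ∀ i ∈ Finset.Icc 1 (p - 1), (q ^ p).coeff i = jacobsonS p i x y := by
    intro i hi
    obtain ⟨h1, h2⟩ := Finset.mem_Icc.mp hi
    have h3 := congrArg (fun f => f.coeff (i - 1)) hder
    simp only [hq, coeff_bracketIter_C, coeff_derivative] at h3
    rw [jacobsonS, ← h3, ← hq]
    rw [show i - 1 + 1 = i by omega]
    have h4 : (((i - 1 : ℕ) : E) + 1) = algebraMap (ZMod p) E (i : ZMod p) := by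
      rw [map_natCast]
      exact_mod_cast congrArg (Nat.cast (R := E)) (show i - 1 + 1 = i by omega)
    rw [h4, ← Algebra.commutes, ← Algebra.smul_def, smul_smul, inv_mul_cancel₀, one_smul]
    rw [Ne, ZMod.natCast_eq_zero_iff]
    exact fun h => absurd (Nat.le_of_dvd (by omega) h) (by omega)
  have h0 : (q ^ p).coeff 0 = y ^ p := by
    rw [← constantCoeff_apply, map_pow]
    simp [hq]
  have htop : (q ^ p).coeff p = x ^ p := by
    have := coeff_pow_of_natDegree_le (m := p) (n := 1) (p := q) (by simpa using hdeg 1)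
    rw [mul_one] at this
    rw [this]
    simp [hq, coeff_C]
  let ev : E[X] →+* E := eval₂RingHom' (RingHom.id E) 1 (fun a => Commute.one_right a)
  have h5 : ev (q ^ p) = (x + y) ^ p := by
    rw [map_pow]
    congr 1
    simp [ev, hq]
  rw [← h5]
  have h6 : ev (q ^ p) = ∑ i ∈ Finset.range (p + 1), (q ^ p).coeff i := by
    change eval₂ (RingHom.id E) 1 (q ^ p) = _
    rw [eval₂_eq_sum_range' _ (Nat.lt_succ_of_le (hdeg p))]
    simp
  rw [h6, Finset.sum_range_succ, htop, Finset.range_eq_Ico, Finset.sum_eq_sum_Ico_succ_bot hp, h0,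
    ← Finset.sum_congr rfl hmid]
  rw [show Finset.Icc 1 (p - 1) = Finset.Ico (0 + 1) p by
    ext i; simp only [Finset.mem_Icc, Finset.mem_Ico]; omega]
  abel

/-- A Lie algebra embedded in an associative algebra so that the `p`-th powers of additive
generators stay in the image is restricted. -/
theorem exists_pow_of_addGenerators {p : ℕ} [Fact p.Prime] [Algebra (ZMod p) E] {L : Type*}
    [LieRing L] [LieAlgebra (ZMod p) L] (θ : L →ₗ⁅ZMod p⁆ E)
    {P : L → Prop} (hP : ∀ x, P x → ∃ y, θ y = θ x ^ p)
    (hind : ∀ Q : L → Prop, Q 0 → (∀ x, P x → Q x) → (∀ x y, Q x → Q y → Q (x + y)) → ∀ x, Q x)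
    (x : L) : ∃ y, θ y = θ x ^ p := by
  refine hind (fun x => ∃ y, θ y = θ x ^ p) ⟨0, ?_⟩ hP ?_ x
  · rw [map_zero, zero_pow (Fact.out : p.Prime).ne_zero]
  · rintro x y ⟨x', hx⟩ ⟨y', hy⟩
    refine ⟨x' + y' + ∑ i ∈ Finset.Icc 1 (p - 1), jacobsonS p i x y, ?_⟩
    rw [map_add θ x y, add_pow_eq_add_sum_jacobsonS, map_add, map_add, hx, hy, map_sum]
    simp only [map_jacobsonS]

/-- The restricted structure for which an embedding `θ` into an associative algebra satisfies
`θ (x^{[p]}) = θ x ^ p`. -/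
noncomputable abbrev restrictedOfInjective {p : ℕ} [Fact p.Prime] [Algebra (ZMod p) E] {L : Type*}
    [LieRing L] [LieAlgebra (ZMod p) L] (θ : L →ₗ⁅ZMod p⁆ E) (hθ : Function.Injective θ)
    (h : ∀ x, ∃ y, θ y = θ x ^ p) : RestrictedLieAlgebra p L where
  pPow x := (h x).choose
  lie_pPow x y := hθ <| by
    rw [LieHom.map_lie, (h y).choose_spec, map_bracketIter, bracketIter_eq_lie_pow]
  smul_pPow a x := hθ <| by
    rw [(h _).choose_spec, map_smul, map_smul, (h x).choose_spec, smul_pow]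
  add_pPow x y := hθ <| by
    rw [(h _).choose_spec, map_add θ x y, add_pow_eq_add_sum_jacobsonS, map_add, map_add,
      (h x).choose_spec, (h y).choose_spec, map_sum]
    simp only [map_jacobsonS]

theorem restrictedOfInjective_spec {p : ℕ} [Fact p.Prime] [Algebra (ZMod p) E] {L : Type*}
    [LieRing L] [LieAlgebra (ZMod p) L] (θ : L →ₗ⁅ZMod p⁆ E) (hθ : Function.Injective θ)
    (h : ∀ x, ∃ y, θ y = θ x ^ p) (x : L) :
    θ ((restrictedOfInjective θ hθ h).pPow x) = θ x ^ p :=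
  (h x).choose_spec

end Associative

/-! ## Filtered algebras and their symbols -/

section Filtered

open Polynomial
open scoped commutatorElement

/-- A decreasing multiplicative filtration of an algebra over `ZMod p`. -/
structure MulFiltration (p : ℕ) (Λ : Type*) [Ring Λ] [Algebra (ZMod p) Λ] where
  toFun : ℕ → Submodule (ZMod p) Λ
  zero_eq_top : toFun 0 = ⊤
  succ_le : ∀ k, toFun (k + 1) ≤ toFun k
  mul_mem' : ∀ {k l : ℕ} {a b : Λ}, a ∈ toFun k → b ∈ toFun l → a * b ∈ toFun (k + l)

namespace MulFiltration

variable {p : ℕ} {Λ : Type*} [Ring Λ] [Algebra (ZMod p) Λ] (J : MulFiltration p Λ)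

theorem antitone : Antitone J.toFun := antitone_nat_of_succ_le J.succ_le

theorem mem_zero (a : Λ) : a ∈ J.toFun 0 := by
  rw [J.zero_eq_top]
  trivial

theorem mul_mem_left {k : ℕ} (a : Λ) {b : Λ} (hb : b ∈ J.toFun k) : a * b ∈ J.toFun k := by
  simpa using J.mul_mem' (J.mem_zero a) hb

theorem mul_mem_right {k : ℕ} {a : Λ} (b : Λ) (ha : a ∈ J.toFun k) : a * b ∈ J.toFun k :=
  J.mul_mem' ha (J.mem_zero b)

theorem pow_mem {k : ℕ} {a : Λ} (ha : a ∈ J.toFun k) (n : ℕ) : a ^ n ∈ J.toFun (n * k) := by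
  induction n with
  | zero => simpa using J.mem_zero _
  | succ n ih =>
    rw [pow_succ, add_mul, one_mul]
    exact J.mul_mem' ih ha

/-- The Rees algebra of a filtration. -/
def rees : Subalgebra (ZMod p) Λ[X] where
  carrier := {f | ∀ n, f.coeff n ∈ J.toFun n}
  mul_mem' := by
    intro f g hf hg n
    rw [coeff_mul]
    refine Submodule.sum_mem _ fun x hx => ?_
    rw [← Finset.HasAntidiagonal.mem_antidiagonal.mp hx]
    exact J.mul_mem' (hf _) (hg _)
  add_mem' := by
    intro f g hf hg n
    rw [coeff_add]
    exact Submodule.add_mem _ (hf n) (hg n)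
  algebraMap_mem' := by
    intro r n
    rw [Polynomial.algebraMap_apply, coeff_C]
    split_ifs with h
    · rw [h]
      exact J.mem_zero _
    · exact Submodule.zero_mem _

/-- The congruence on the Rees algebra whose quotient is the associated graded algebra. -/
def reesCon : RingCon J.rees where
  r f g := ∀ n, (f.1 - g.1).coeff n ∈ J.toFun (n + 1)
  iseqv :=
    { refl := fun f n => by simp
      symm := fun {f g} h n => by
        rw [← neg_sub, coeff_neg]
        exact Submodule.neg_mem _ (h n)
      trans := fun {f g k} h h' n => by
        rw [← sub_add_sub_cancel f.1 g.1 k.1, coeff_add]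
        exact Submodule.add_mem _ (h n) (h' n) }
  add' := fun {f g k l} h h' n => by
    have : (f + k).1 - (g + l).1 = (f.1 - g.1) + (k.1 - l.1) := by
      simp only [Subalgebra.coe_add]
      abel
    rw [this, coeff_add]
    exact Submodule.add_mem _ (h n) (h' n)
  mul' := fun {f g k l} h h' n => by
    have : (f * k).1 - (g * l).1 = (f.1 - g.1) * k.1 + g.1 * (k.1 - l.1) := by
      simp only [Subalgebra.coe_mul]
      noncomm_ring
    rw [this, coeff_add, coeff_mul, coeff_mul]
    refine Submodule.add_mem _ (Submodule.sum_mem _ fun x hx => ?_)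
      (Submodule.sum_mem _ fun x hx => ?_)
    · rw [← Finset.HasAntidiagonal.mem_antidiagonal.mp hx, add_right_comm]
      exact J.mul_mem' (h _) (k.2 _)
    · rw [← Finset.HasAntidiagonal.mem_antidiagonal.mp hx, add_assoc]
      exact J.mul_mem' (g.2 _) (h' _)

/-- The associated graded algebra of a filtration. -/
abbrev GrAlg : Type _ := J.reesCon.Quotient

theorem monomial_mem_rees {k : ℕ} {a : Λ} (ha : a ∈ J.toFun k) : monomial k a ∈ J.rees := by
  intro n
  rw [coeff_monomial]
  split_ifs with h
  · exact h ▸ ha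
  · exact Submodule.zero_mem _

end MulFiltration

/-- A symbol map from a filtered algebra to an algebra: additive and multiplicative on the terms
of the filtration, and zero on the next term. -/
structure SymbolMap {p : ℕ} {Λ : Type*} [Ring Λ] [Algebra (ZMod p) Λ] (J : MulFiltration p Λ)
    (E : Type*) [Ring E] where
  toFun : ℕ → Λ → E
  map_add' : ∀ {k a b}, a ∈ J.toFun k → b ∈ J.toFun k → toFun k (a + b) = toFun k a + toFun k b
  map_mul' : ∀ {k l a b}, a ∈ J.toFun k → b ∈ J.toFun l →
    toFun (k + l) (a * b) = toFun k a * toFun l b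
  map_eq_zero : ∀ {k a}, a ∈ J.toFun (k + 1) → toFun k a = 0

namespace MulFiltration

variable {p : ℕ} {Λ : Type*} [Ring Λ] [Algebra (ZMod p) Λ] (J : MulFiltration p Λ)

open Classical in
/-- The symbol map to the associated graded algebra. -/
noncomputable def symbol : SymbolMap J J.GrAlg where
  toFun k a := if h : a ∈ J.toFun k then
    ((⟨monomial k a, J.monomial_mem_rees h⟩ : J.rees) : J.reesCon.Quotient) else 0
  map_add' {k a b} ha hb := by
    rw [dif_pos ha, dif_pos hb, dif_pos (Submodule.add_mem _ ha hb), ← RingCon.coe_add]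
    congr 1
    exact Subtype.ext (map_add _ _ _)
  map_mul' {k l a b} ha hb := by
    rw [dif_pos ha, dif_pos hb, dif_pos (J.mul_mem' ha hb), ← RingCon.coe_mul]
    congr 1
    exact Subtype.ext (monomial_mul_monomial _ _ _ _).symm
  map_eq_zero {k a} ha := by
    rw [dif_pos (J.succ_le _ ha), ← RingCon.coe_zero, RingCon.eq]
    intro n
    rw [ZeroMemClass.coe_zero, sub_zero, coeff_monomial]
    split_ifs with h
    · exact h ▸ ha
    · exact Submodule.zero_mem _

/-- Symbols of different degrees come from different coefficients in the Rees algebra, so a relation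
among them holds in each degree separately. -/
theorem symbol_sum_eq_zero {J : MulFiltration p Λ} {ι : Type*} {d : ι → ℕ}
    (hd : Function.Injective d) {s : Finset ι} {a : ι → Λ}
    (ha : ∀ k, a k ∈ J.toFun (d k)) (h : ∑ k ∈ s, J.symbol.toFun (d k) (a k) = 0) {k : ι}
    (hk : k ∈ s) : a k ∈ J.toFun (d k + 1) := by
  have h1 : ∑ k ∈ s, J.symbol.toFun (d k) (a k) =
      ((∑ k ∈ s, ⟨monomial (d k) (a k), J.monomial_mem_rees (ha k)⟩ : J.rees) :
        J.reesCon.Quotient) := by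
    refine Eq.trans ?_ (map_sum J.reesCon.mk' _ _).symm
    refine Finset.sum_congr rfl fun k _ => ?_
    exact dif_pos (ha k)
  rw [h1, ← RingCon.coe_zero, RingCon.eq] at h
  have h2 := h (d k)
  rw [ZeroMemClass.coe_zero, sub_zero, AddSubmonoidClass.coe_finsetSum, finsetSum_coeff,
    Finset.sum_eq_single k (fun j _ hj => by rw [coeff_monomial, if_neg fun e => hj (hd e)])
      (fun h => absurd hk h), coeff_monomial, if_pos rfl] at h2
  exact h2

theorem mem_of_symbol_eq_zero {J : MulFiltration p Λ} {k : ℕ} {a : Λ} (ha : a ∈ J.toFun k)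
    (h : J.symbol.toFun k a = 0) : a ∈ J.toFun (k + 1) :=
  symbol_sum_eq_zero (ι := Unit) (d := fun _ => k) (fun _ _ _ => rfl) (s := {()}) (a := fun _ => a)
    (fun _ => ha) (by simpa using h) (k := ()) (by simp)

end MulFiltration

namespace SymbolMap

variable {p : ℕ} {Λ E : Type*} [Ring Λ] [Algebra (ZMod p) Λ]
  {J : MulFiltration p Λ} [Ring E] (σ : SymbolMap J E)

theorem map_pow {k n : ℕ} {a : Λ} (ha : a ∈ J.toFun k) (hn : 0 < n) :
    σ.toFun (n * k) (a ^ n) = σ.toFun k a ^ n := by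
  induction n, hn using Nat.le_induction with
  | base => simp
  | succ n _ ih =>
    rw [pow_succ, pow_succ, add_mul, one_mul, σ.map_mul' (J.pow_mem ha n) ha, ih]

theorem map_zero (k : ℕ) : σ.toFun k 0 = 0 := σ.map_eq_zero (Submodule.zero_mem _)

theorem map_neg {k : ℕ} {a : Λ} (ha : a ∈ J.toFun k) : σ.toFun k (-a) = -σ.toFun k a := by
  rw [eq_neg_iff_add_eq_zero, ← σ.map_add' (Submodule.neg_mem _ ha) ha, neg_add_cancel, σ.map_zero]

theorem map_sub {k : ℕ} {a b : Λ} (ha : a ∈ J.toFun k) (hb : b ∈ J.toFun k) :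
    σ.toFun k (a - b) = σ.toFun k a - σ.toFun k b := by
  rw [sub_eq_add_neg, σ.map_add' ha (Submodule.neg_mem _ hb), σ.map_neg hb, ← sub_eq_add_neg]

theorem map_congr {k : ℕ} {a b : Λ} (hb : b ∈ J.toFun k) (h : a - b ∈ J.toFun (k + 1)) :
    σ.toFun k a = σ.toFun k b := by
  rw [← sub_add_cancel a b, σ.map_add' (J.succ_le _ h) hb, σ.map_eq_zero h, zero_add]

theorem map_sum_smul [Algebra (ZMod p) E] (k : ℕ) {ι : Type*} [Fintype ι] (c : ι → ZMod p)
    (y : ι → Λ) (hy : ∀ i, y i ∈ J.toFun k) :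
    σ.toFun k (∑ i, c i • y i) = ∑ i, c i • σ.toFun k (y i) := by
  let f : J.toFun k →+ E :=
    { toFun := fun a => σ.toFun k a
      map_zero' := σ.map_zero k
      map_add' := fun a b => σ.map_add' a.2 b.2 }
  have h := map_sum f (fun i => c i • (⟨y i, hy i⟩ : J.toFun k)) Finset.univ
  refine Eq.trans ?_ (h.trans (Finset.sum_congr rfl fun i _ => ZMod.map_smul f (c i) ⟨y i, hy i⟩))
  change _ = σ.toFun k ((∑ i, c i • (⟨y i, hy i⟩ : J.toFun k) : J.toFun k) : Λ)
  rw [AddSubmonoidClass.coe_finsetSum]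
  rfl

/-! ### Lie homomorphisms from the graded Lie algebra of a series, given by symbols. -/

section Gr

attribute [local instance] LieRing.ofAssociativeRing

variable [Fact p.Prime] {G : Type*} [Group G] (Γ : PCentralSeries p G) (ρ : G →* Λ)
  (hρ : ∀ (k : ℕ+), ∀ g ∈ Γ.toFun k, ρ g - 1 ∈ J.toFun k)

/-- The symbol of `ρ g - 1` on the component of degree `k`. -/
def quoHom (k : ℕ+) : Γ.Quo k →* Multiplicative E :=
  QuotientGroup.lift _
    { toFun := fun g => Multiplicative.ofAdd (σ.toFun k (ρ g - 1))
      map_one' := by simp [σ.map_zero]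
      map_mul' := fun g h => by
        rw [← ofAdd_add, ← σ.map_add' (hρ k g g.2) (hρ k h h.2)]
        congr 1
        refine σ.map_congr (Submodule.add_mem _ (hρ k g g.2) (hρ k h h.2)) ?_
        -- The defect of additivity is a product of two elements of degree `k`; its degree `2k` is
        -- at least `k + 1`.
        have e : ρ ((g * h : Γ.toFun k) : G) - 1 - (ρ g - 1 + (ρ h - 1)) =
            (ρ g - 1) * (ρ h - 1) := by
          rw [Subgroup.coe_mul, map_mul]
          noncomm_ring
        rw [e]
        exact J.antitone (Nat.add_le_add_left k.pos _) (J.mul_mem' (hρ k g g.2) (hρ k h h.2)) }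
    (fun g hg => by
      have h1 := hρ (k + 1) g hg
      exact congrArg Multiplicative.ofAdd (σ.map_eq_zero h1))

/-- The map from the associated graded group given by the symbols of `ρ g - 1`. -/
noncomputable def grAddHom : Γ.Gr →+ E :=
  DirectSum.toAddMonoid fun k => MonoidHom.toAdditiveLeft (σ.quoHom Γ ρ hρ k)

theorem grAddHom_grMk {k : ℕ+} {g : G} (hg : g ∈ Γ.toFun k) :
    σ.grAddHom Γ ρ hρ (Γ.grMk k g hg) = σ.toFun k (ρ g - 1) := by
  unfold grAddHom PCentralSeries.grMk PCentralSeries.ofDeg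
  erw [DirectSum.toAddMonoid_of]
  rfl

/-- With `a = ρ g - 1` and `b = ρ h - 1`, one has `ρ ⁅g, h⁆ - 1 = (ab - ba) ρ((hg)⁻¹)`. The last
factor is `1` modulo degree one, so both sides have the same symbol in degree `k + l`. -/
theorem grAddHom_lie (x y : Γ.Gr) :
    σ.grAddHom Γ ρ hρ ⁅x, y⁆ = ⁅σ.grAddHom Γ ρ hρ x, σ.grAddHom Γ ρ hρ y⁆ := by
  refine Γ.gr_induction (P := fun x => σ.grAddHom Γ ρ hρ ⁅x, y⁆ =
    ⁅σ.grAddHom Γ ρ hρ x, σ.grAddHom Γ ρ hρ y⁆) (by simp) ?_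
    (fun a b ha hb => by rw [add_lie, map_add, map_add, add_lie, ha, hb]) x
  intro k g hg
  refine Γ.gr_induction (P := fun y => σ.grAddHom Γ ρ hρ ⁅Γ.grMk k g hg, y⁆ =
    ⁅σ.grAddHom Γ ρ hρ (Γ.grMk k g hg), σ.grAddHom Γ ρ hρ y⁆) (by simp) ?_
    (fun a b ha hb => by rw [lie_add, map_add, map_add, lie_add, ha, hb]) y
  intro l h hh
  have h1 := hρ k g hg
  have h2 := hρ l h hh
  rw [Γ.grMk_lie, grAddHom_grMk, grAddHom_grMk, grAddHom_grMk, Ring.lie_def, ← σ.map_mul' h1 h2,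
    ← σ.map_mul' h2 h1, add_comm (l : ℕ) k, PNat.add_coe,
    ← σ.map_sub (J.mul_mem' h1 h2) (by rw [add_comm]; exact J.mul_mem' h2 h1)]
  have h3 : (ρ g - 1) * (ρ h - 1) - (ρ h - 1) * (ρ g - 1) ∈ J.toFun (k + l) :=
    Submodule.sub_mem _ (J.mul_mem' h1 h2) (by rw [add_comm]; exact J.mul_mem' h2 h1)
  refine σ.map_congr h3 ?_
  have h4 : ρ ((h * g)⁻¹) - 1 ∈ J.toFun (1 : ℕ+) := hρ 1 _ (by rw [Γ.one_eq_top]; trivial)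
  have h5 : ρ (h * g) * ρ (h * g)⁻¹ = 1 := by rw [← map_mul, mul_inv_cancel, map_one]
  have e : ρ ⁅g, h⁆ - 1 - ((ρ g - 1) * (ρ h - 1) - (ρ h - 1) * (ρ g - 1)) =
      ((ρ g - 1) * (ρ h - 1) - (ρ h - 1) * (ρ g - 1)) * (ρ ((h * g)⁻¹) - 1) := by
    have e1 : ρ ⁅g, h⁆ = ρ g * ρ h * ρ (h * g)⁻¹ := by
      rw [← map_mul, ← map_mul, commutatorElement_def]
      congr 1
      group
    have e2 : (ρ g - 1) * (ρ h - 1) - (ρ h - 1) * (ρ g - 1) = ρ g * ρ h - ρ (h * g) := by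
      rw [map_mul]
      noncomm_ring
    rw [e1, e2, mul_sub, sub_mul _ _ (ρ _), h5, mul_one]
  rw [e]
  exact J.mul_mem' h3 h4

variable [Algebra (ZMod p) E]

/-- The Lie homomorphism from the associated graded Lie algebra of a `p`-central series given by
the symbols of `ρ g - 1`. -/
noncomputable def grHom : Γ.Gr →ₗ⁅ZMod p⁆ E where
  toFun := σ.grAddHom Γ ρ hρ
  map_add' := map_add _
  map_smul' a x := ZMod.map_smul (σ.grAddHom Γ ρ hρ) a x
  map_lie' := σ.grAddHom_lie Γ ρ hρ _ _

theorem grHom_grMk {k : ℕ+} {g : G} (hg : g ∈ Γ.toFun k) :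
    σ.grHom Γ ρ hρ (Γ.grMk k g hg) = σ.toFun k (ρ g - 1) :=
  σ.grAddHom_grMk Γ ρ hρ hg

theorem grHom_grMk_pow {k : ℕ+} {g : G} (hg : g ∈ Γ.toFun k) :
    σ.grHom Γ ρ hρ (Γ.grMk (⟨p, (Fact.out : p.Prime).pos⟩ * k) (g ^ p) (Γ.pow_mem k g hg)) =
      σ.grHom Γ ρ hρ (Γ.grMk k g hg) ^ p := by
  rw [grHom_grMk, grHom_grMk, ← σ.map_pow (hρ k g hg) (Fact.out : p.Prime).pos]
  have e : ρ (g ^ p) - 1 = (ρ g - 1) ^ p := by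
    rcases subsingleton_or_nontrivial Λ with h | h
    · exact Subsingleton.elim _ _
    · have : CharP Λ p := charP_of_injective_algebraMap (algebraMap (ZMod p) Λ).injective p
      rw [sub_pow_char_of_commute _ (Commute.one_right _), one_pow, _root_.map_pow]
  rw [e]
  rfl

theorem exists_grMk_sum (x : Γ.Gr) : ∃ (s : Finset ℕ+) (g : ∀ k, Γ.toFun k),
    x = ∑ k ∈ s, Γ.grMk k (g k) (g k).2 := by
  classical
  let x' : DirectSum ℕ+ fun k => Additive (Γ.Quo k) := x
  have h : ∀ k, ∃ g : Γ.toFun k, (QuotientGroup.mk g : Γ.Quo k) = Additive.toMul (x' k) :=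
    fun k => QuotientGroup.mk_surjective _
  choose g hg using h
  refine ⟨DFinsupp.support x', g, ?_⟩
  refine (DirectSum.sum_support_of x').symm.trans (Finset.sum_congr rfl fun k _ => ?_)
  exact congrArg (Γ.ofDeg k) (congrArg Additive.ofMul (hg k)).symm

/-- Independence of symbols of distinct degrees reduces injectivity to one degree at a time, where
it is the assumption `h`. -/
theorem grHom_symbol_injective (Γ : PCentralSeries p G) (ρ : G →* Λ)
    (hρ : ∀ (k : ℕ+), ∀ g ∈ Γ.toFun k, ρ g - 1 ∈ J.toFun k)
    (h : ∀ (k : ℕ+), ∀ g ∈ Γ.toFun k, ρ g - 1 ∈ J.toFun (k + 1) → g ∈ Γ.toFun (k + 1)) :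
    Function.Injective (J.symbol.grHom Γ ρ hρ) := by
  rw [injective_iff_map_eq_zero]
  intro x hx
  obtain ⟨s, g, rfl⟩ := exists_grMk_sum Γ x
  rw [map_sum] at hx
  simp only [grHom_grMk] at hx
  refine Finset.sum_eq_zero fun k hk => Γ.grMk_eq_zero _ (h k _ (g k).2 ?_)
  exact MulFiltration.symbol_sum_eq_zero PNat.coe_injective
    (a := fun k : ℕ+ => ρ (g k) - 1) (fun k => hρ k _ (g k).2) hx hk

end Gr

end SymbolMap

end Filtered

/-! ## Spanning by truncated ordered monomials -/

section Spanning

namespace MulFiltration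

variable {p : ℕ} {Λ : Type*} [Ring Λ] [Algebra (ZMod p) Λ] (J : MulFiltration p Λ)
  {ι : Type*} (y : ι → Λ) (w : ι → ℕ)

/-- The span of the words of weight `n` with fewer than `r` letters, modulo the term of index
`n + 1` of the filtration. -/
def wordSpan (r n : ℕ) : Submodule (ZMod p) Λ :=
  Submodule.span (ZMod p)
    {a | ∃ l : List ι, l.length < r ∧ (l.map w).sum = n ∧ (l.map y).prod = a} ⊔ J.toFun (n + 1)

/-- The span of the letters of weight `n`, modulo the term of index `n + 1` of the filtration. -/
def letterSpan (n : ℕ) : Submodule (ZMod p) Λ :=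
  Submodule.span (ZMod p) {a | ∃ i, w i = n ∧ y i = a} ⊔ J.toFun (n + 1)

variable {y w}

theorem mul_mem_wordSpan (hy : ∀ i, y i ∈ J.toFun (w i)) {r n : ℕ} (i : ι) {a : Λ}
    (ha : a ∈ J.wordSpan y w r n) : y i * a ∈ J.wordSpan y w (r + 1) (w i + n) := by
  suffices h : J.wordSpan y w r n ≤
      (J.wordSpan y w (r + 1) (w i + n)).comap (LinearMap.mulLeft (ZMod p) (y i)) from h ha
  refine sup_le (Submodule.span_le.mpr ?_) ?_
  · rintro _ ⟨l, hl, hw, rfl⟩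
    exact Submodule.mem_sup_left (Submodule.subset_span
      ⟨i :: l, by simpa using hl, by simp [hw], by simp⟩)
  · intro b hb
    refine Submodule.mem_sup_right ?_
    rw [add_assoc]
    exact J.mul_mem' (hy i) hb

theorem word_mem (hy : ∀ i, y i ∈ J.toFun (w i)) (l : List ι) :
    (l.map y).prod ∈ J.toFun (l.map w).sum := by
  induction l with
  | nil => exact J.mem_zero _
  | cons i l ih =>
    simp only [List.map_cons, List.prod_cons, List.sum_cons]
    exact J.mul_mem' (hy i) ih

theorem letterSpan_mul_word_mem (hy : ∀ i, y i ∈ J.toFun (w i)) {n : ℕ} {a : Λ}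
    (ha : a ∈ J.letterSpan y w n) (l : List ι) :
    a * (l.map y).prod ∈ J.wordSpan y w (l.length + 2) (n + (l.map w).sum) := by
  suffices h : J.letterSpan y w n ≤ (J.wordSpan y w (l.length + 2) (n + (l.map w).sum)).comap
      (LinearMap.mulRight (ZMod p) (l.map y).prod) from h ha
  refine sup_le (Submodule.span_le.mpr ?_) ?_
  · rintro _ ⟨i, rfl, rfl⟩
    exact Submodule.mem_sup_left (Submodule.subset_span ⟨i :: l, by simp, by simp, by simp⟩)
  · intro b hb
    refine Submodule.mem_sup_right ?_
    rw [add_right_comm]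
    exact J.mul_mem' hb (J.word_mem hy l)

theorem wordSpan_le (hy : ∀ i, y i ∈ J.toFun (w i)) (r n : ℕ) :
    J.wordSpan y w r n ≤ J.toFun n := by
  refine sup_le (Submodule.span_le.mpr ?_) (J.succ_le n)
  rintro _ ⟨l, -, rfl, rfl⟩
  exact J.word_mem hy l

theorem wordSpan_mono {r s : ℕ} (h : r ≤ s) (n : ℕ) :
    J.wordSpan y w r n ≤ J.wordSpan y w s n :=
  sup_le_sup_right (Submodule.span_mono (by
    rintro _ ⟨l, hl, h'⟩
    exact ⟨l, hl.trans_le h, h'⟩)) _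

theorem letterSpan_mul_mem_wordSpan (hy : ∀ i, y i ∈ J.toFun (w i)) {r k n : ℕ} {a b : Λ}
    (ha : a ∈ J.letterSpan y w k) (hb : b ∈ J.wordSpan y w r n) :
    a * b ∈ J.wordSpan y w (r + 1) (k + n) := by
  suffices h : J.letterSpan y w k ≤ (J.wordSpan y w (r + 1) (k + n)).comap
      (LinearMap.mulRight (ZMod p) b) from h ha
  refine sup_le (Submodule.span_le.mpr ?_) ?_
  · rintro _ ⟨i, rfl, rfl⟩
    exact J.mul_mem_wordSpan hy i hb
  · intro c hc
    refine Submodule.mem_sup_right ?_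
    rw [add_right_comm]
    exact J.mul_mem' hc (J.wordSpan_le hy r n hb)

/-- An adjacent transposition changes a word by a commutator of two letters. Modulo the next term of
the filtration this is a combination of single letters of the same total weight, so the error
consists of shorter words. -/
theorem word_perm (hy : ∀ i, y i ∈ J.toFun (w i))
    (hcomm : ∀ i j, y i * y j - y j * y i ∈ J.letterSpan y w (w i + w j))
    {l l' : List ι} (h : l.Perm l') :
    (l.map y).prod - (l'.map y).prod ∈ J.wordSpan y w l.length (l.map w).sum := by
  induction h with
  | nil => simp
  | cons i h ih =>
    simp only [List.map_cons, List.prod_cons, List.sum_cons, List.length_cons, ← mul_sub]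
    exact J.mul_mem_wordSpan hy i ih
  | swap i j l =>
    simp only [List.map_cons, List.prod_cons, List.sum_cons, List.length_cons, ← mul_assoc,
      ← sub_mul, ← add_assoc]
    exact J.letterSpan_mul_word_mem hy (hcomm j i) l
  | trans h h' ih ih' =>
    rw [← sub_add_sub_cancel]
    refine Submodule.add_mem _ ih ?_
    rwa [h.length_eq, (h.map w).sum_eq]

variable [Fintype ι]

/-- The list in which the letter `i` occurs `e i` times, in a fixed order. -/
noncomputable def monoList (e : ι → ℕ) : List ι :=
  Finset.univ.toList.flatMap fun i => List.replicate (e i) i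

theorem count_monoList [DecidableEq ι] (e : ι → ℕ) (i : ι) : (monoList e).count i = e i := by
  rw [monoList, List.count_flatMap]
  simp only [Function.comp_def, List.count_replicate]
  rw [Finset.sum_map_toList]
  simp

theorem monoList_ite [DecidableEq ι] (i : ι) :
    monoList (fun j => if j = i then 1 else 0) = [i] := by
  rw [← List.perm_singleton, List.perm_iff_count]
  intro j
  rw [count_monoList, List.count_singleton]
  by_cases h : j = i
  · simp [h]
  · simp [h, Ne.symm h]

/-- The span of the truncated monomials of weight at least `n`. -/
def monoSpan (y : ι → Λ) (w : ι → ℕ) (n : ℕ) : Submodule (ZMod p) Λ :=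
  Submodule.span (ZMod p) ((fun e : ι → Fin p => ((monoList fun i => (e i : ℕ)).map y).prod) ''
    {e | n ≤ ((monoList fun i => (e i : ℕ)).map w).sum})

theorem monoSpan_anti (y : ι → Λ) (w : ι → ℕ) {n m : ℕ} (h : n ≤ m) :
    (monoSpan y w m : Submodule (ZMod p) Λ) ≤ monoSpan y w n :=
  Submodule.span_mono (Set.image_mono fun _ he => h.trans he)

/-- By induction on length: sorting a word, or removing `p` equal letters from it, costs only
shorter words of the same weight, modulo the next term of the filtration. -/
theorem word_mem_monoSpan (hp : 2 ≤ p) (hy : ∀ i, y i ∈ J.toFun (w i))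
    (hcomm : ∀ i j, y i * y j - y j * y i ∈ J.letterSpan y w (w i + w j))
    (hpow : ∀ i, y i ^ p ∈ J.letterSpan y w (p * w i)) (l : List ι) :
    (l.map y).prod ∈ monoSpan y w (l.map w).sum ⊔ J.toFun ((l.map w).sum + 1) := by
  classical
  induction hr : l.length using Nat.strong_induction_on generalizing l with
  | _ r ih =>
    subst hr
    have hle : ∀ r n, r ≤ l.length →
        J.wordSpan y w r n ≤ monoSpan y w n ⊔ J.toFun (n + 1) := by
      intro r n hr
      refine sup_le (Submodule.span_le.mpr ?_) le_sup_right
      rintro _ ⟨l', hl', rfl, rfl⟩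
      exact ih l'.length (hl'.trans_le hr) l' rfl
    by_cases h : ∀ i, l.count i < p
    · have hl : l.Perm (monoList fun i => ((⟨l.count i, h i⟩ : Fin p) : ℕ)) := by
        rw [List.perm_iff_count]
        intro i
        rw [count_monoList]
      rw [← sub_add_cancel (l.map y).prod]
      refine Submodule.add_mem _ (hle _ _ le_rfl (J.word_perm hy hcomm hl)) ?_
      refine Submodule.mem_sup_left (Submodule.subset_span ⟨_, ?_, rfl⟩)
      exact (hl.map w).sum_eq.le
    -- Some letter occurs at least `p` times. Bring `p` copies to the front and replace their
    -- product by single letters; the result is shorter because `p ≥ 2`.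
    · push Not at h
      obtain ⟨i, hi⟩ := h
      obtain ⟨l', hl'⟩ := (List.replicate_sublist_iff.mpr hi).exists_perm_append
      rw [← sub_add_cancel (l.map y).prod]
      refine Submodule.add_mem _ (hle _ _ le_rfl (J.word_perm hy hcomm hl')) ?_
      have h1 := J.letterSpan_mul_word_mem hy (hpow i) l'
      have h2 : (l.map w).sum = p * w i + (l'.map w).sum := by
        rw [(hl'.map w).sum_eq]
        simp
      have h3 : l.length = p + l'.length := by
        rw [hl'.length_eq]
        simp
      rw [List.map_append, List.prod_append, List.map_replicate, List.prod_replicate, h2]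
      exact hle _ _ (by omega) h1

/-- A filtration that reaches zero and whose terms are generated by words is spanned by truncated
monomials. -/
theorem le_monoSpan (hp : 2 ≤ p) (hy : ∀ i, y i ∈ J.toFun (w i))
    (hcomm : ∀ i j, y i * y j - y j * y i ∈ J.letterSpan y w (w i + w j))
    (hpow : ∀ i, y i ^ p ∈ J.letterSpan y w (p * w i))
    (hgen : ∀ n, ∀ a ∈ J.toFun n, ∃ r, a ∈ J.wordSpan y w r n) {N : ℕ} (hN : J.toFun N = ⊥)
    (n : ℕ) : J.toFun n ≤ monoSpan y w n := by
  -- Descending induction on `n`, starting where the filtration vanishes; `m` bounds the distance to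
  -- `N`.
  have h1 : ∀ m n, N ≤ m + n → J.toFun n ≤ monoSpan y w n := by
    intro m
    induction m with
    | zero =>
      intro n hn
      refine (J.antitone (show N ≤ n by omega)).trans ?_
      rw [hN]
      exact bot_le
    | succ m ih =>
      intro n hn
      have h2 := (ih (n + 1) (by omega)).trans (monoSpan_anti y w n.le_succ)
      intro a ha
      obtain ⟨r, hr⟩ := hgen n a ha
      refine (sup_le (Submodule.span_le.mpr ?_) h2 : J.wordSpan y w r n ≤ _) hr
      rintro _ ⟨l, -, rfl, rfl⟩
      exact sup_le le_rfl h2 (J.word_mem_monoSpan hp hy hcomm hpow l)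
  exact h1 N n (by omega)

end MulFiltration

end Spanning

/-! ## The dimension filtration of a `p`-central series -/

section Dimension

open MonoidAlgebra

namespace PCentralSeries

variable {p : ℕ} [Fact p.Prime] {G H : Type*} [Group G] [Group H] (Γ : PCentralSeries p G)

/-- Products of elements `g - 1` of the group algebra, with the weight at which `g` is known to
lie in the series. -/
inductive IsWeightedProd : ℕ → MonoidAlgebra (ZMod p) G → Prop
  | one : IsWeightedProd 0 1
  | mul {k : ℕ+} {n : ℕ} {g : G} {a : MonoidAlgebra (ZMod p) G} (hg : g ∈ Γ.toFun k)
      (ha : IsWeightedProd n a) : IsWeightedProd (k + n) ((of (ZMod p) G g - 1) * a)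

variable {Γ} in
theorem IsWeightedProd.mul' {n m : ℕ} {a b : MonoidAlgebra (ZMod p) G}
    (ha : Γ.IsWeightedProd n a) (hb : Γ.IsWeightedProd m b) : Γ.IsWeightedProd (n + m) (a * b) := by
  induction ha with
  | one => simpa using hb
  | mul hg _ ih =>
    rw [mul_assoc, add_assoc]
    exact .mul hg ih

/-- The filtration of the group algebra defined by a `p`-central series. -/
noncomputable def augFiltration : MulFiltration p (MonoidAlgebra (ZMod p) G) where
  toFun n := Submodule.span (ZMod p) {a | ∃ m, n ≤ m ∧ Γ.IsWeightedProd m a}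
  zero_eq_top := by
    rw [eq_top_iff]
    intro a _
    induction a using MonoidAlgebra.induction_on with
    | of g =>
      have e : of (ZMod p) G g = (of (ZMod p) G g - 1) * 1 + 1 := by simp
      rw [e]
      refine Submodule.add_mem _ (Submodule.subset_span ⟨_, zero_le, .mul (k := 1) ?_ .one⟩)
        (Submodule.subset_span ⟨0, le_rfl, .one⟩)
      rw [Γ.one_eq_top]
      trivial
    | add a b ha hb => exact Submodule.add_mem _ (ha trivial) (hb trivial)
    | smul r a ha => exact Submodule.smul_mem _ _ (ha trivial)
  succ_le k := Submodule.span_mono fun a ⟨m, hm, h⟩ => ⟨m, by omega, h⟩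
  mul_mem' {k l a b} ha hb := by
    have h := Submodule.mul_mem_mul ha hb
    rw [Submodule.span_mul_span] at h
    refine Submodule.span_mono ?_ h
    rintro _ ⟨a, ⟨m, hm, ha⟩, b, ⟨n, hn, hb⟩, rfl⟩
    exact ⟨m + n, by omega, ha.mul' hb⟩

theorem of_sub_one_mem {k : ℕ+} {g : G} (hg : g ∈ Γ.toFun k) :
    of (ZMod p) G g - 1 ∈ Γ.augFiltration.toFun k :=
  Submodule.subset_span ⟨k, le_rfl, by simpa using IsWeightedProd.mul hg .one⟩

theorem map_mem_augFiltration {Δ : PCentralSeries p H} (f : G →* H)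
    (hf : ∀ k, ∀ g ∈ Γ.toFun k, f g ∈ Δ.toFun k) {n : ℕ} {a : MonoidAlgebra (ZMod p) G}
    (ha : a ∈ Γ.augFiltration.toFun n) :
    mapDomainAlgHom (ZMod p) (ZMod p) f a ∈ Δ.augFiltration.toFun n := by
  suffices h : Γ.augFiltration.toFun n ≤ (Δ.augFiltration.toFun n).comap
    (mapDomainAlgHom (ZMod p) (ZMod p) f).toLinearMap from h ha
  refine Submodule.span_le.mpr ?_
  rintro a ⟨m, hm, ha⟩
  refine Submodule.subset_span ⟨m, hm, ?_⟩
  clear hm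
  induction ha with
  | one => simpa using IsWeightedProd.one
  | mul hg _ ih =>
    simp only [AlgHom.toLinearMap_apply, map_mul, map_sub, map_one] at ih ⊢
    convert IsWeightedProd.mul (hf _ _ hg) ih using 3
    simp

/-- The image of a `p`-central series in a quotient by one of its terms. -/
def quotient (n : ℕ+) : PCentralSeries p (G ⧸ Γ.toFun n) where
  toFun k := (Γ.toFun k).map (QuotientGroup.mk' _)
  one_eq_top := by
    rw [Γ.one_eq_top]
    exact Subgroup.map_top_of_surjective _ (QuotientGroup.mk'_surjective _)
  succ_le k := Subgroup.map_mono (Γ.succ_le k)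
  commutator_le k l := by
    rw [← Subgroup.map_commutator]
    exact Subgroup.map_mono (Γ.commutator_le k l)
  pow_mem k := by
    rintro _ ⟨g, hg, rfl⟩
    exact ⟨g ^ p, Γ.pow_mem k g hg, map_pow _ _ _⟩

theorem pow_mem_succ {k : ℕ+} {g : G} (hg : g ∈ Γ.toFun k) : g ^ p ∈ Γ.toFun (k + 1) := by
  refine Γ.le_of_lt ?_ (Γ.pow_mem k g hg)
  have h2 := (Fact.out : p.Prime).two_le
  have hk := k.pos
  rw [← PNat.coe_le_coe]
  push_cast
  change (k : ℕ) + 1 ≤ p * k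
  nlinarith

theorem nsmul_quo {k : ℕ+} (x : Additive (Γ.Quo k)) : p • x = 0 := by
  obtain ⟨⟨g, hg⟩, rfl⟩ := QuotientGroup.mk_surjective (Additive.toMul x)
  refine (QuotientGroup.eq_one_iff (N := (Γ.toFun (k + 1)).subgroupOf (Γ.toFun k))
    (⟨g, hg⟩ ^ p)).mpr ?_
  rw [Subgroup.mem_subgroupOf]
  exact Γ.pow_mem_succ hg

noncomputable instance quoModule (k : ℕ+) : Module (ZMod p) (Additive (Γ.Quo k)) :=
  AddCommGroup.zmodModule Γ.nsmul_quo

theorem card_eq_card_quo_mul (k : ℕ+) :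
    Nat.card (Γ.toFun k) = Nat.card (Γ.Quo k) * Nat.card (Γ.toFun (k + 1)) := by
  rw [Subgroup.card_eq_card_quotient_mul_card_subgroup ((Γ.toFun (k + 1)).subgroupOf (Γ.toFun k)),
    Nat.card_congr (Subgroup.subgroupOfEquivOfLe (Γ.succ_le k)).toEquiv]

/-- The first `n` layers are vector spaces over `ZMod p`, and the orders multiply. The index
`Nat.succPNat j` is the degree `j + 1`. -/
theorem card_eq_prod [Finite G] (n : ℕ) : Nat.card G =
    p ^ (∑ j : Fin n, Module.finrank (ZMod p) (Additive (Γ.Quo (Nat.succPNat j)))) *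
      Nat.card (Γ.toFun (Nat.succPNat n)) := by
  induction n with
  | zero =>
    have : Γ.toFun (Nat.succPNat 0) = ⊤ := Γ.one_eq_top
    rw [this]
    simp
  | succ n ih =>
    rw [ih, card_eq_card_quo_mul, Fin.sum_univ_castSucc, pow_add, mul_assoc]
    congr 2
    have := Module.natCard_eq_pow_finrank (K := ZMod p) (V := Additive (Γ.Quo (Nat.succPNat n)))
    rw [Nat.card_zmod] at this
    exact this

/-- A subgroup of finite index in a finitely generated group is finitely generated, so the next
layer is a finitely generated abelian group killed by `p`, hence finite. -/
theorem finiteIndex [Group.FG G] (k : ℕ+) : (Γ.toFun k).FiniteIndex := by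
  induction k using PNat.recOn with
  | one =>
    rw [Γ.one_eq_top]
    infer_instance
  | succ k ih =>
    have h1 : Group.FG (Γ.toFun k) := inferInstance
    have h2 : Group.FG (Γ.Quo k) := inferInstance
    have h3 : Finite (Γ.Quo k) := by
      have h4 : Module.Finite ℤ (Additive (Γ.Quo k)) :=
        Module.Finite.iff_addGroup_fg.mpr inferInstance
      refine (AddCommGroup.finite_of_fg_isAddTorsion (Additive (Γ.Quo k)) fun x => ?_ :
        Finite (Additive (Γ.Quo k)))
      exact isOfFinAddOrder_iff_nsmul_eq_zero.mpr ⟨p, (Fact.out : p.Prime).pos, Γ.nsmul_quo x⟩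
    have h5 : ((Γ.toFun (k + 1)).subgroupOf (Γ.toFun k)).FiniteIndex :=
      Subgroup.finiteIndex_of_finite_quotient
    refine ⟨?_⟩
    rw [← Subgroup.relIndex_mul_index (Γ.succ_le k)]
    exact mul_ne_zero h5.index_ne_zero ih.index_ne_zero

variable {Γ} in
-- In a finite-dimensional algebra the filtration stabilizes, at `W` say, and then `W` is spanned by
-- the products `(g - 1) b` with `b ∈ W`. If `W ≠ 0`, the `p`-group `G` fixes a nonzero functional
-- on `W`; it vanishes on all these products, a contradiction.
theorem exists_augFiltration_eq_bot [Finite G] (hG : IsPGroup p G) {N : ℕ+}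
    (hN : Γ.toFun N = ⊥) : ∃ n, Γ.augFiltration.toFun n = ⊥ := by
  obtain ⟨n, hn⟩ := IsArtinian.monotone_stabilizes (R := ZMod p) (M := MonoidAlgebra (ZMod p) G)
    ⟨Γ.augFiltration.toFun, fun _ _ h => Γ.augFiltration.antitone h⟩
  refine ⟨n, ?_⟩
  change ∀ m, n ≤ m → Γ.augFiltration.toFun n = Γ.augFiltration.toFun m at hn
  set W := Γ.augFiltration.toFun n with hW
  have hgen : W ≤ Submodule.span (ZMod p)
      {a | ∃ g : G, ∃ b ∈ W, a = (of (ZMod p) G g - 1) * b} := by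
    -- Weight at least `n + N` leaves two cases for the first factor `g - 1`: if its weight is at
    -- least `N`, then `g = 1`; otherwise the remaining product still has weight at least `n`.
    refine (hn (n + N) (by omega)).le.trans ?_
    refine Submodule.span_le.mpr ?_
    rintro a ⟨m, hm, ha⟩
    cases ha with
    | one => exact absurd hm (by have := N.pos; omega)
    | @mul k m g b hg hb =>
      by_cases hk : N ≤ k
      · have := Γ.le_of_lt hk hg
        rw [hN, Subgroup.mem_bot] at this
        rw [this, map_one, sub_self, zero_mul]
        exact Submodule.zero_mem _
      · refine Submodule.subset_span ⟨g, b, ?_, rfl⟩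
        refine Submodule.subset_span ⟨m, ?_, hb⟩
        have : (k : ℕ) < N := not_le.mp hk
        omega
  by_contra hne
  let L : G →* Module.End (ZMod p) W :=
    { toFun := fun g => (LinearMap.mulLeft (ZMod p) (of (ZMod p) G g)).restrict
        (p := W) (q := W) fun a ha => Γ.augFiltration.mul_mem_left _ ha
      map_one' := by ext; simp
      map_mul' := fun g h => by ext; simp [mul_assoc] }
  let act : MulAction G (Module.Dual (ZMod p) W) :=
    { smul := fun g f => f.comp (L g⁻¹)
      one_smul := fun f => by
        change f.comp (L 1⁻¹) = f
        rw [inv_one, map_one]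
        rfl
      mul_smul := fun g h f => by
        change f.comp (L (g * h)⁻¹) = (f.comp (L h⁻¹)).comp (L g⁻¹)
        rw [mul_inv_rev, map_mul]
        rfl }
  have hfin : Finite (Module.Dual (ZMod p) W) := Module.finite_of_finite (ZMod p)
  -- The number of functionals is a positive power of `p`. The number of fixed ones is then
  -- divisible by `p` too, so zero is not the only one.
  have hdvd : p ∣ Nat.card (Module.Dual (ZMod p) W) := by
    rw [Module.natCard_eq_pow_finrank (K := ZMod p), Nat.card_zmod]
    refine dvd_pow_self _ ?_
    rw [Subspace.dual_finrank_eq]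
    exact fun h => hne (Submodule.finrank_eq_zero.mp h)
  obtain ⟨f, hf, hf0⟩ := hG.exists_fixed_point_of_prime_dvd_card_of_fixed_point
    (Module.Dual (ZMod p) W) hdvd (a := 0) (fun g => LinearMap.zero_comp _)
  refine hf0 (LinearMap.ext fun a => ?_)
  have key : W ≤ (LinearMap.ker f).map W.subtype := by
    refine hgen.trans (Submodule.span_le.mpr ?_)
    rintro _ ⟨g, b, hb, rfl⟩
    refine ⟨L g ⟨b, hb⟩ - ⟨b, hb⟩, ?_, ?_⟩
    · have h1 : f.comp (L g⁻¹⁻¹) = f := hf g⁻¹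
      rw [inv_inv] at h1
      rw [SetLike.mem_coe, LinearMap.mem_ker, map_sub, sub_eq_zero]
      exact LinearMap.congr_fun h1 _
    · simp [L, sub_mul]
  obtain ⟨b, hb, hba⟩ := key a.2
  rw [← Subtype.ext hba]
  exact hb.symm ▸ rfl

/-- Lifts of a basis of a quotient of the series, as letters modulo the next term of the
filtration. -/
theorem exists_lifts [Finite G] (j : ℕ+) :
    ∃ x : Fin (Module.finrank (ZMod p) (Additive (Γ.Quo j))) → Γ.toFun j, ∀ g ∈ Γ.toFun j,
      ∃ c : Fin (Module.finrank (ZMod p) (Additive (Γ.Quo j))) → ZMod p,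
        of (ZMod p) G g - 1 - ∑ i, c i • (of (ZMod p) G (x i) - 1) ∈ Γ.augFiltration.toFun (j + 1) ∧
        (c = 0 → g ∈ Γ.toFun (j + 1)) := by
  let b := Module.finBasis (ZMod p) (Additive (Γ.Quo j))
  have hx : ∀ i, ∃ x : Γ.toFun j, (QuotientGroup.mk x : Γ.Quo j) = (b i).toMul :=
    fun i => QuotientGroup.mk_surjective _
  choose x hx using hx
  refine ⟨x, fun g hg => ?_⟩
  let v : Additive (Γ.Quo j) := Additive.ofMul (Γ.cls j g hg)
  have hv := b.sum_repr v
  refine ⟨fun i => b.repr v i, ?_, ?_⟩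
  · let θ := Γ.augFiltration.symbol.grAddHom Γ (of (ZMod p) G) fun _ _ hg => Γ.of_sub_one_mem hg
    have hy : ∀ i, of (ZMod p) G (x i) - 1 ∈ Γ.augFiltration.toFun j :=
      fun i => Γ.of_sub_one_mem (x i).2
    have hsum : ∑ i, b.repr v i • (of (ZMod p) G (x i) - 1) ∈ Γ.augFiltration.toFun j :=
      Submodule.sum_mem _ fun i _ => Submodule.smul_mem _ _ (hy i)
    -- The symbol is additive on the layer, so the coordinates of the class of `g` also expand `g -
    -- 1` modulo the next term.
    refine MulFiltration.mem_of_symbol_eq_zero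
      (Submodule.sub_mem _ (Γ.of_sub_one_mem hg) hsum) ?_
    rw [SymbolMap.map_sub _ (Γ.of_sub_one_mem hg) hsum, sub_eq_zero]
    have h1 := congrArg (fun z => θ (Γ.ofDeg j z)) hv
    have h2 : θ (Γ.ofDeg j v) = Γ.augFiltration.symbol.toFun j (of (ZMod p) G g - 1) :=
      SymbolMap.grAddHom_grMk _ Γ _ _ hg
    have h3 : ∀ i, θ (Γ.ofDeg j (b i)) =
        Γ.augFiltration.symbol.toFun j (of (ZMod p) G (x i) - 1) := by
      intro i
      rw [← SymbolMap.grAddHom_grMk _ Γ _ (fun _ _ hg => Γ.of_sub_one_mem hg) (x i).2]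
      exact congrArg (fun z => θ (Γ.ofDeg j (Additive.ofMul z))) (hx i).symm
    rw [← h2, ← h1, SymbolMap.map_sum_smul _ _ _ _ hy]
    simp only [map_sum, ZMod.map_smul, h3]
  · intro hc
    have h1 : v = 0 := by
      rw [← hv]
      refine Finset.sum_eq_zero fun i _ => ?_
      rw [show b.repr v i = 0 from congrFun hc i, zero_smul]
    exact (QuotientGroup.eq_one_iff (N := (Γ.toFun (j + 1)).subgroupOf (Γ.toFun j)) ⟨g, hg⟩).mp h1

/-- Expanding every factor of a weighted product into letters gives words of the same weight;
products of larger weight are absorbed by the next term. The bound `r` depends on the element. -/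
theorem exists_mem_wordSpan {ι : Type*} {y : ι → MonoidAlgebra (ZMod p) G} {w : ι → ℕ}
    (hy : ∀ i, y i ∈ Γ.augFiltration.toFun (w i))
    (hletter : ∀ (k : ℕ+), ∀ g ∈ Γ.toFun k,
      of (ZMod p) G g - 1 ∈ Γ.augFiltration.letterSpan y w k)
    (n : ℕ) (a : MonoidAlgebra (ZMod p) G) (ha : a ∈ Γ.augFiltration.toFun n) :
    ∃ r, a ∈ Γ.augFiltration.wordSpan y w r n := by
  refine Submodule.span_induction ?_ ⟨0, Submodule.zero_mem _⟩ ?_ ?_ ha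
  · rintro a ⟨m, hm, ha⟩
    rcases hm.eq_or_lt with rfl | hm
    · clear * - ha hy hletter
      induction ha with
      | one =>
        exact ⟨1, Submodule.mem_sup_left (Submodule.subset_span ⟨[], by simp, by simp, by simp⟩)⟩
      | mul hg _ ih =>
        obtain ⟨r, hr⟩ := ih
        exact ⟨r + 1, MulFiltration.letterSpan_mul_mem_wordSpan _ hy (hletter _ _ hg) hr⟩
    · exact ⟨0, Submodule.mem_sup_right (Submodule.subset_span ⟨m, hm, ha⟩)⟩
  · rintro a b - - ⟨r, hr⟩ ⟨s, hs⟩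
    exact ⟨max r s, Submodule.add_mem _
      (MulFiltration.wordSpan_mono _ (le_max_left _ _) _ hr)
      (MulFiltration.wordSpan_mono _ (le_max_right _ _) _ hs)⟩
  · rintro c a - ⟨r, hr⟩
    exact ⟨r, Submodule.smul_mem _ _ hr⟩

open scoped commutatorElement in
-- In the group algebra, the commutator of `g - 1` and `h - 1` is `(⁅g, h⁆ - 1) hg = (⁅g, h⁆ - 1) +
-- (⁅g, h⁆ - 1)(hg - 1)`, and the last product has weight `k + l + 1`.
theorem commutator_mem_letterSpan {ι : Type*} {y : ι → MonoidAlgebra (ZMod p) G} {w : ι → ℕ}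
    (hletter : ∀ (k : ℕ+), ∀ g ∈ Γ.toFun k,
      of (ZMod p) G g - 1 ∈ Γ.augFiltration.letterSpan y w k)
    {k l : ℕ+} {g h : G} (hg : g ∈ Γ.toFun k) (hh : h ∈ Γ.toFun l) :
    (of (ZMod p) G g - 1) * (of (ZMod p) G h - 1) - (of (ZMod p) G h - 1) * (of (ZMod p) G g - 1) ∈
      Γ.augFiltration.letterSpan y w (k + l) := by
  have h1 := Γ.comm_mem hg hh
  have h2 : h * g ∈ Γ.toFun 1 := by
    rw [Γ.one_eq_top]
    trivial
  have e : (of (ZMod p) G g - 1) * (of (ZMod p) G h - 1) -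
      (of (ZMod p) G h - 1) * (of (ZMod p) G g - 1) =
      (of (ZMod p) G ⁅g, h⁆ - 1) +
        (of (ZMod p) G ⁅g, h⁆ - 1) * (of (ZMod p) G (h * g) - 1) := by
    have e1 : of (ZMod p) G g * of (ZMod p) G h =
        of (ZMod p) G ⁅g, h⁆ * of (ZMod p) G (h * g) := by
      rw [← map_mul, ← map_mul, commutatorElement_def]
      congr 1
      group
    have e2 : of (ZMod p) G h * of (ZMod p) G g = of (ZMod p) G (h * g) := (map_mul _ _ _).symm
    generalize of (ZMod p) G g = a at *
    generalize of (ZMod p) G h = b at *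
    generalize of (ZMod p) G (h * g) = c at *
    generalize of (ZMod p) G ⁅g, h⁆ = d at *
    have e3 : (a - 1) * (b - 1) - (b - 1) * (a - 1) = a * b - b * a := by noncomm_ring
    rw [e3, e1, e2]
    noncomm_ring
  have h3 := hletter _ _ h1
  have h4 := Γ.augFiltration.mul_mem' (Γ.of_sub_one_mem h1) (Γ.of_sub_one_mem h2)
  rw [PNat.add_coe] at h3 h4
  rw [PNat.one_coe] at h4
  rw [e]
  exact Submodule.add_mem _ h3 (Submodule.mem_sup_right h4)

theorem of_pow_sub_one (g : G) : (of (ZMod p) G g - 1) ^ p = of (ZMod p) G (g ^ p) - 1 := by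
  have : CharP (MonoidAlgebra (ZMod p) G) p :=
    charP_of_injective_algebraMap (algebraMap (ZMod p) _).injective p
  rw [sub_pow_char_of_commute _ (Commute.one_right _), one_pow, map_pow]

theorem pow_mem_letterSpan {ι : Type*} {y : ι → MonoidAlgebra (ZMod p) G} {w : ι → ℕ}
    (hletter : ∀ (k : ℕ+), ∀ g ∈ Γ.toFun k,
      of (ZMod p) G g - 1 ∈ Γ.augFiltration.letterSpan y w k)
    {k : ℕ+} {g : G} (hg : g ∈ Γ.toFun k) :
    (of (ZMod p) G g - 1) ^ p ∈ Γ.augFiltration.letterSpan y w (p * k) := by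
  have h := hletter _ _ (Γ.pow_mem k g hg)
  rw [← of_pow_sub_one] at h
  exact (congrArg (fun j => (of (ZMod p) G g - 1) ^ p ∈ Γ.augFiltration.letterSpan y w j)
    (PNat.mul_coe ⟨p, (Fact.out : p.Prime).pos⟩ k)).mp h

open MulFiltration in
-- The counting argument of Jennings, with `Γ_{n+1}` the last term that may be nontrivial. The
-- truncated monomials are a spanning set of the right size, hence a basis, and the terms of the
-- filtration lie in the spans of the monomials of large weight. A combination of letters of weight
-- `n + 1` that lies in the term of index `n + 2` therefore has zero coefficients.
theorem eq_one_of_mem_augFiltration_of_finite [Finite G] {n : ℕ}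
    (hn : Γ.toFun (Nat.succPNat n + 1) = ⊥) {g : G} (hg : g ∈ Γ.toFun (Nat.succPNat n))
    (h : of (ZMod p) G g - 1 ∈ Γ.augFiltration.toFun (n + 1 + 1)) : g = 1 := by
  classical
  have hp := (Fact.out : p.Prime)
  have hcard := Γ.card_eq_prod (n + 1)
  rw [show Γ.toFun (Nat.succPNat (n + 1)) = ⊥ from hn, Subgroup.card_bot, mul_one] at hcard
  obtain ⟨N, hN⟩ := exists_augFiltration_eq_bot (IsPGroup.of_card hcard) hn
  choose x hx using Γ.exists_lifts
  -- The letters are the lifted basis elements of all the layers, of degrees `1` to `n + 1`, each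
  -- weighted by its degree.
  let ι := Σ j : Fin (n + 1), Fin (Module.finrank (ZMod p) (Additive (Γ.Quo (Nat.succPNat j))))
  let y : ι → MonoidAlgebra (ZMod p) G := fun i => of (ZMod p) G (x _ i.2) - 1
  let w : ι → ℕ := fun i => (Nat.succPNat i.1 : ℕ+)
  have hy : ∀ i, y i ∈ Γ.augFiltration.toFun (w i) := fun i => Γ.of_sub_one_mem (x _ i.2).2
  have hletter : ∀ (k : ℕ+), ∀ g ∈ Γ.toFun k,
      of (ZMod p) G g - 1 ∈ Γ.augFiltration.letterSpan y w k := by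
    intro k g hg
    by_cases hk : k < Nat.succPNat (n + 1)
    · obtain ⟨j, rfl⟩ : ∃ j, k = Nat.succPNat j := ⟨k.natPred, (PNat.succPNat_natPred k).symm⟩
      obtain ⟨c, hc, -⟩ := hx _ g hg
      rw [← sub_add_cancel (of (ZMod p) G g - 1)]
      refine Submodule.add_mem _ (Submodule.mem_sup_right hc) (Submodule.mem_sup_left ?_)
      refine Submodule.sum_mem _ fun i _ => Submodule.smul_mem _ _ (Submodule.subset_span ?_)
      exact ⟨⟨⟨j, Nat.succPNat_lt_succPNat.mp hk⟩, i⟩, rfl, rfl⟩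
    · have h1 := Γ.le_of_lt (not_lt.mp hk) hg
      rw [show Γ.toFun (Nat.succPNat (n + 1)) = ⊥ from hn, Subgroup.mem_bot] at h1
      rw [h1, map_one, sub_self]
      exact Submodule.zero_mem _
  have hspan := Γ.augFiltration.le_monoSpan hp.two_le hy
    (fun i j => Γ.commutator_mem_letterSpan hletter (x _ i.2).2 (x _ j.2).2)
    (fun i => Γ.pow_mem_letterSpan hletter (x _ i.2).2)
    (Γ.exists_mem_wordSpan hy hletter) hN
  let mono : (ι → Fin p) → MonoidAlgebra (ZMod p) G :=
    fun e => ((monoList fun i => (e i : ℕ)).map y).prod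
  have hind : LinearIndependent (ZMod p) mono := by
    have : Fintype G := Fintype.ofFinite G
    refine linearIndependent_of_top_le_span_of_card_eq_finrank ?_ ?_
    · rw [← Γ.augFiltration.zero_eq_top]
      exact (hspan 0).trans (Submodule.span_mono (Set.image_subset_range _ _))
    -- There are `p ^ |ι|` exponent vectors, and `|ι|` is the sum of the dimensions of the layers,
    -- so the count equals the order of `G`.
    · rw [Module.finrank_eq_card_basis (MonoidAlgebra.basis G (ZMod p)),
        ← Nat.card_eq_fintype_card (α := G), hcard]
      simp [ι]
  obtain ⟨c, hc, hc0⟩ := hx _ g hg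
  refine (Subgroup.mem_bot (G := G)).mp (hn ▸ hc0 ?_)
  -- The exponent vector whose monomial is the single letter `i`.
  let e : ι → ι → Fin p := fun i j => if j = i then ⟨1, hp.one_lt⟩ else ⟨0, hp.pos⟩
  have he : ∀ i, (monoList fun j => (e i j : ℕ)) = [i] := by
    intro i
    rw [← monoList_ite i]
    congr 1
    funext j
    simp only [e]
    split_ifs <;> rfl
  have hmono : ∀ i, mono (e i) = y i := fun i => by simp only [mono, he]; simp
  let k : Fin (Module.finrank (ZMod p) (Additive (Γ.Quo (Nat.succPNat n)))) → ι :=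
    fun i => ⟨Fin.last n, i⟩
  have hk : Function.Injective k := fun i j h => eq_of_heq (Sigma.mk.inj h).2
  have he' : Function.Injective (e ∘ k) := by
    intro i j h
    refine hk ?_
    have h1 := he (k i)
    rw [show e (k i) = e (k j) from h, he (k j)] at h1
    simpa using h1.symm
  have h1 : ∑ i, c i • mono (e (k i)) ∈ Submodule.span (ZMod p) (mono '' Set.range (e ∘ k)) :=
    Submodule.sum_mem _ fun i _ =>
      Submodule.smul_mem _ _ (Submodule.subset_span ⟨_, ⟨i, rfl⟩, rfl⟩)
  have h2 : ∑ i, c i • mono (e (k i)) ∈ Submodule.span (ZMod p)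
      (mono '' {e | n + 1 + 1 ≤ ((monoList fun i => (e i : ℕ)).map w).sum}) := by
    refine hspan (n + 1 + 1) ?_
    have h3 := Submodule.sub_mem _ h hc
    rw [sub_sub_cancel] at h3
    simp only [hmono]
    exact h3
  -- The leading part of `g - 1` is spanned both by monomials of weight `n + 1` and by monomials of
  -- weight at least `n + 2`; these are disjoint parts of a basis.
  have h3 := Submodule.disjoint_def.mp (hind.disjoint_span_image (Set.disjoint_left.mpr ?_)) _ h1 h2
  · exact funext (Fintype.linearIndependent_iff.mp (hind.comp _ he') c h3)
  · rintro _ ⟨i, rfl⟩ h4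
    simp only [Set.mem_ofPred_eq, Function.comp_apply, he] at h4
    simp [w, k] at h4

/-- Modulo `Γ_{k+1}` the group is finite and `Γ_k` becomes the last term that may be nontrivial, and
the filtration is functorial, so the finite case applies. -/
theorem mem_of_mem_augFiltration [Group.FG G] (k : ℕ+) (g : G) (hg : g ∈ Γ.toFun k)
    (h : of (ZMod p) G g - 1 ∈ Γ.augFiltration.toFun (k + 1)) : g ∈ Γ.toFun (k + 1) := by
  have h1 := Γ.finiteIndex (k + 1)
  have h2 : Finite (G ⧸ Γ.toFun (k + 1)) := Subgroup.finite_quotient_of_finiteIndex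
  obtain ⟨n, rfl⟩ : ∃ n, k = Nat.succPNat n := ⟨k.natPred, (PNat.succPNat_natPred k).symm⟩
  rw [← QuotientGroup.eq_one_iff]
  refine (Γ.quotient (Nat.succPNat n + 1)).eq_one_of_mem_augFiltration_of_finite (n := n) ?_
    ⟨g, hg, rfl⟩ ?_
  · exact QuotientGroup.map_mk'_self _
  · have h3 := Γ.map_mem_augFiltration (Δ := Γ.quotient (Nat.succPNat n + 1))
      (QuotientGroup.mk' _) (fun k g hg => ⟨g, hg, rfl⟩) h
    rw [map_sub, map_one] at h3
    convert h3 using 2 <;> simp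

/-- The associated graded Lie algebra of a `p`-central series on a finitely generated group is
restricted. -/
theorem exists_restricted [Group.FG G] :
    ∃ S : RestrictedLieAlgebra p Γ.Gr, Γ.IsGrPower S.pPow := by
  let θ := Γ.augFiltration.symbol.grHom Γ (of (ZMod p) G) fun _ _ hg => Γ.of_sub_one_mem hg
  have hθ : Function.Injective θ :=
    SymbolMap.grHom_symbol_injective Γ _ _ Γ.mem_of_mem_augFiltration
  have hpow := exists_pow_of_addGenerators θ
    (P := fun x => ∃ k g hg, x = Γ.grMk k g hg)
    (by
      rintro x ⟨k, g, hg, rfl⟩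
      exact ⟨_, SymbolMap.grHom_grMk_pow _ Γ _ _ hg⟩)
    (fun Q h0 h1 h2 => Γ.gr_induction h0 (fun k g hg => h1 _ ⟨k, g, hg, rfl⟩) h2)
  refine ⟨restrictedOfInjective θ hθ hpow, fun k g hg => hθ ?_⟩
  rw [restrictedOfInjective_spec]
  exact (SymbolMap.grHom_grMk_pow _ Γ _ _ hg).symm

end PCentralSeries

end Dimension

/-! ## Rewriting and the diamond lemma -/

section Diamond

variable {k V W : Type*} [Field k] [AddCommGroup V] [Module k V]

/-- A rewriting system on the basis `B` with a well-founded order which is locally confluent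
relative to the order has a linear normal form map. -/
theorem exists_normalForm (B : Module.Basis W k V) {lt : W → W → Prop} (hlt : WellFounded lt)
    (R : W → V → Prop)
    (hR : ∀ w f, R w f → f ∈ Submodule.span k (B '' {u | lt u w}))
    (hconf : ∀ w f g, R w f → R w g →
      f - g ∈ Submodule.span k {x | ∃ u h, R u h ∧ lt u w ∧ x = B u - h}) :
    ∃ Φ : V →ₗ[k] V, (∀ w f, R w f → Φ (B w) = Φ f) ∧
      ∀ w, (∀ f, ¬ R w f) → Φ (B w) = B w := by
  classical
  -- Well-founded recursion: apply one chosen rule and reduce the result. By `hR` all basis vectors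
  -- that occur are below `w`, so the default value `0` is never reached.
  let F : ∀ w, (∀ u, lt u w → V) → V := fun w rec =>
    if h : ∃ f, R w f then (B.repr h.choose).sum fun u c =>
      c • if hu : lt u w then rec u hu else 0
    else B w
  let φ : W → V := hlt.fix F
  have hφ : ∀ w, φ w = F w fun u _ => φ u := fun w => hlt.fix_eq F w
  refine ⟨B.constr k φ, ?_, ?_⟩
  · intro w
    induction w using hlt.induction with
    | _ w ih =>
      -- By induction the map kills every relation with leading term below `w`, so confluence makes
      -- the chosen rule irrelevant.
      have hD : ∀ x ∈ Submodule.span k {x | ∃ u h, R u h ∧ lt u w ∧ x = B u - h},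
          B.constr k φ x = 0 := by
        intro x hx
        refine (Submodule.span_le (p := LinearMap.ker (B.constr k φ))).mpr ?_ hx
        rintro _ ⟨u, h, hu, hl, rfl⟩
        rw [SetLike.mem_coe, LinearMap.mem_ker, map_sub, ih u hl h hu, sub_self]
      intro f hf
      have hex : ∃ f, R w f := ⟨f, hf⟩
      have h1 : B.constr k φ (B w) = B.constr k φ hex.choose := by
        rw [B.constr_basis, hφ, B.constr_apply]
        simp only [F, dif_pos hex]
        refine Finsupp.sum_congr fun u hu => ?_
        have hu' : lt u w := B.mem_span_image.mp (hR w _ hex.choose_spec) hu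
        rw [dif_pos hu']
      rw [h1, ← sub_eq_zero, ← map_sub]
      exact hD _ (hconf w _ _ hex.choose_spec hf)
  · intro w hw
    rw [B.constr_basis, hφ]
    exact dif_neg fun ⟨f, hf⟩ => hw f hf

end Diamond

/-! ## Inversions -/

section Inversions

variable {I : Type*} [LinearOrder I]

/-- The number of pairs `(a, b)` with `a ∈ l`, `b ∈ l'` and `b < a`. -/
def crossInv (l l' : List I) : ℕ := (l.map fun a => l'.countP (· < a)).sum

/-- The number of inversions of a word. -/
def numInv : List I → ℕ
  | [] => 0
  | a :: l => l.countP (· < a) + numInv l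

theorem crossInv_append_right (l u v : List I) :
    crossInv l (u ++ v) = crossInv l u + crossInv l v := by
  simp [crossInv, List.sum_map_add]

theorem crossInv_append_left (u v l : List I) :
    crossInv (u ++ v) l = crossInv u l + crossInv v l := by
  simp [crossInv]

theorem numInv_append (u v : List I) :
    numInv (u ++ v) = numInv u + numInv v + crossInv u v := by
  induction u with
  | nil => simp [numInv, crossInv]
  | cons a u ih =>
    rw [List.cons_append, numInv, numInv, ih, List.countP_append]
    simp only [crossInv, List.map_cons, List.sum_cons]
    omega

theorem crossInv_congr {u u' v v' : List I} (hu : u.Perm u') (hv : v.Perm v') :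
    crossInv u v = crossInv u' v' := by
  unfold crossInv
  rw [(hu.map _).sum_eq]
  congr 2
  funext a
  exact hv.countP_eq _

/-- The order on words: shorter words are smaller, and so are permutations with fewer
inversions. -/
def WordLT (u v : List I) : Prop := u.length < v.length ∨ (u.Perm v ∧ numInv u < numInv v)

theorem wordLT_wf : WellFounded (WordLT (I := I)) := by
  refine Subrelation.wf (r := InvImage (Prod.Lex (· < ·) (· < ·))
    (fun u : List I => (u.length, numInv u))) ?_ (InvImage.wf _ (WellFounded.prod_lex
      wellFounded_lt wellFounded_lt))
  rintro u v (h | ⟨h, h'⟩)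
  · exact Prod.Lex.left _ _ h
  · change Prod.Lex _ _ (u.length, numInv u) (v.length, numInv v)
    rw [h.length_eq]
    exact Prod.Lex.right _ h'

/-- Inversions between a word and its surroundings depend only on the word up to permutation. This
is why the second clause of `WordLT` demands a permutation. -/
theorem WordLT.append {u v : List I} (h : WordLT u v) (s t : List I) :
    WordLT (s ++ u ++ t) (s ++ v ++ t) := by
  rcases h with h | ⟨h, h'⟩
  · left
    simpa using h
  · right
    refine ⟨(h.append_left s).append_right t, ?_⟩
    simp only [numInv_append, crossInv_append_left, crossInv_congr h (List.Perm.refl t),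
      crossInv_congr (List.Perm.refl s) h]
    omega

theorem wordLT_swap {i j : I} (h : i < j) : WordLT [i, j] [j, i] :=
  Or.inr ⟨List.Perm.swap _ _ _, by simp [numInv, h, h.not_gt]⟩

end Inversions

/-! ## The rewriting system of a restricted Lie algebra -/

section RestrictedPBW

theorem basis_induction {k I N : Type*} [Field k] [AddCommGroup N] [Module k N]
    (b : Module.Basis I k N) {Q : N → Prop} (zero : Q 0) (add : ∀ x y, Q x → Q y → Q (x + y))
    (smul : ∀ (c : k) x, Q x → Q (c • x)) (basis : ∀ i, Q (b i)) (x : N) : Q x := by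
  refine Submodule.span_induction (p := fun x _ => Q x) ?_ zero (fun x y _ _ => add x y)
    (fun c x _ => smul c x) (b.mem_span x)
  rintro _ ⟨i, rfl⟩
  exact basis i

variable {p : ℕ} {I : Type*} {N : Type*} [LieRing N] [Fact p.Prime]
  [LieAlgebra (ZMod p) N] (b : Module.Basis I (ZMod p) N)
  {V : Type*} [Ring V] [Algebra (ZMod p) V] (a : I → V)

/-- The value of a word. -/
def wordVal (l : List I) : V := (l.map a).prod

theorem wordVal_append (l l' : List I) : wordVal a (l ++ l') = wordVal a l * wordVal a l' := by
  simp [wordVal]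

theorem wordVal_nil : wordVal a [] = 1 := rfl

theorem wordVal_singleton (i : I) : wordVal a [i] = a i := by simp [wordVal]

theorem wordVal_replicate (n : ℕ) (i : I) : wordVal a (List.replicate n i) = a i ^ n := by
  simp [wordVal]

/-- The linear map that sends the basis to the letters. -/
noncomputable def letterMap : N →ₗ[ZMod p] V := b.constr (ZMod p) a

theorem letterMap_basis (i : I) : letterMap b a (b i) = a i := b.constr_basis _ _ _

variable [LinearOrder I] [RestrictedLieAlgebra p N]

/-- The rewriting rules: letters in the wrong order are exchanged, and `p`-th powers of letters
are replaced by the values of the `p`-power operation. -/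
inductive IsRule : List I → V → Prop
  | swap {i j : I} (h : i < j) : IsRule [j, i] (a i * a j + letterMap b a ⁅b j, b i⁆)
  | pow (i : I) :
    IsRule (List.replicate p i) (letterMap b a (RestrictedLieAlgebra.pPow p (b i)))

/-- The span of the relations with leading words in `S`. -/
def relSpan (S : Set (List I)) : Submodule (ZMod p) V :=
  Submodule.span (ZMod p) {x | ∃ s t l f, IsRule b a l f ∧ s ++ l ++ t ∈ S ∧
    x = wordVal a s * (wordVal a l - f) * wordVal a t}

theorem relSpan_mono {S T : Set (List I)} (h : S ⊆ T) : relSpan b a S ≤ relSpan b a T := by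
  refine Submodule.span_mono ?_
  rintro _ ⟨s, t, l, f, hr, hS, rfl⟩
  exact ⟨s, t, l, f, hr, h hS, rfl⟩

theorem mul_relSpan_mul {S T : Set (List I)} (s t : List I) (h : ∀ u ∈ S, s ++ u ++ t ∈ T) {x : V}
    (hx : x ∈ relSpan b a S) : wordVal a s * x * wordVal a t ∈ relSpan b a T := by
  suffices h : relSpan b a S ≤ (relSpan b a T).comap
    ((LinearMap.mulRight (ZMod p) (wordVal a t)).comp
      (LinearMap.mulLeft (ZMod p) (wordVal a s))) from h hx
  refine Submodule.span_le.mpr ?_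
  rintro _ ⟨s', t', l, f, hr, hS, rfl⟩
  refine Submodule.subset_span ⟨s ++ s', t' ++ t, l, f, hr, ?_, ?_⟩
  · simpa using h _ hS
  · simp [wordVal_append, mul_assoc]

/-- The relations of length less than `n`. -/
def shortWords (n : ℕ) : Set (List I) := {u | u.length < n}

theorem swap_mem_relSpan (s t : List I) {i j : I} (h : i < j) {S : Set (List I)}
    (hS : s ++ [j, i] ++ t ∈ S) :
    wordVal a s * (a j * a i - (a i * a j + letterMap b a ⁅b j, b i⁆)) * wordVal a t ∈
      relSpan b a S :=
  Submodule.subset_span ⟨s, t, _, _, .swap h, hS, by simp [wordVal]⟩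

theorem pow_mem_relSpan (s t : List I) (i : I) {S : Set (List I)}
    (hS : s ++ List.replicate p i ++ t ∈ S) :
    wordVal a s * (a i ^ p - letterMap b a (RestrictedLieAlgebra.pPow p (b i))) * wordVal a t ∈
      relSpan b a S :=
  Submodule.subset_span ⟨s, t, _, _, .pow i, hS, by simp [wordVal_replicate]⟩

/-- Modulo the relations of length two, letters satisfy the commutation relations. -/
theorem lie_mem_relSpan (x y : N) :
    letterMap b a x * letterMap b a y - letterMap b a y * letterMap b a x - letterMap b a ⁅x, y⁆ ∈
      relSpan b a (shortWords 3) := by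
  induction x using basis_induction b with
  | zero => simp
  | add x z hx hz =>
    convert Submodule.add_mem _ hx hz using 1
    simp only [add_lie, map_add, add_mul, mul_add]
    abel
  | smul c x hx =>
    convert Submodule.smul_mem _ c hx using 1
    simp only [smul_lie, map_smul, smul_mul_assoc, mul_smul_comm, smul_sub]
  | basis i =>
    induction y using basis_induction b with
    | zero => simp
    | add x z hx hz =>
      convert Submodule.add_mem _ hx hz using 1
      simp only [lie_add, map_add, add_mul, mul_add]
      abel
    | smul c x hx =>
      convert Submodule.smul_mem _ c hx using 1
      simp only [lie_smul, map_smul, smul_mul_assoc, mul_smul_comm, smul_sub]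
    | basis j =>
      rw [letterMap_basis, letterMap_basis]
      rcases lt_trichotomy i j with h | rfl | h
      · have := swap_mem_relSpan b a [] [] h (S := shortWords 3) (by simp [shortWords])
        rw [← neg_mem_iff]
        convert this using 1
        rw [← lie_skew (b i) (b j), map_neg]
        simp [wordVal]
        abel
      · simp
      · have := swap_mem_relSpan b a [] [] h (S := shortWords 3) (by simp [shortWords])
        convert this using 1
        simp [wordVal]
        abel

end RestrictedPBW

/-! ### Resolution of the overlaps between rules. -/

section RestrictedPBW

variable {p : ℕ} {I : Type*} {N : Type*} [LieRing N] [Fact p.Prime]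
  [LieAlgebra (ZMod p) N] (b : Module.Basis I (ZMod p) N)
  {V : Type*} [Ring V] [Algebra (ZMod p) V] (a : I → V)
  [LinearOrder I] [RestrictedLieAlgebra p N]

attribute [local instance] LieRing.ofAssociativeRing

/-- Each further bracket with a letter lengthens the relations by one. The words stay short enough
to lie below the overlaps that involve `p`-th powers. -/
theorem bracketIter_mem_relSpan (d : N) (i : I) (n : ℕ) :
    bracketIter (letterMap b a d) (a i) n - letterMap b a (bracketIter d (b i) n) ∈
      relSpan b a (shortWords (n + 2)) := by
  induction n with
  | zero => simp [bracketIter]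
  | succ n ih =>
    rw [bracketIter, bracketIter]
    set x := bracketIter (letterMap b a d) (a i) n
    set y := bracketIter d (b i) n
    have h1 := mul_relSpan_mul b a (T := shortWords (n + 1 + 2)) [] [i]
      (fun u hu => by simpa [shortWords] using hu) ih
    have h2 := mul_relSpan_mul b a (T := shortWords (n + 1 + 2)) [i] []
      (fun u hu => by simpa [shortWords] using hu) ih
    have h3 := relSpan_mono b a (T := shortWords (n + 1 + 2))
      (fun u hu => by simp only [shortWords, Set.mem_ofPred_eq] at hu ⊢; omega)
      (lie_mem_relSpan b a y (b i))
    convert Submodule.add_mem _ (Submodule.sub_mem _ h1 h2) h3 using 1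
    simp only [letterMap_basis, wordVal, List.map_nil, List.prod_nil, List.map_cons,
      List.prod_cons, Ring.lie_def]
    noncomm_ring

theorem numInv_replicate (n : ℕ) (i : I) : numInv (List.replicate n i) = 0 := by
  induction n with
  | zero => rfl
  | succ n ih => simp [List.replicate_succ, numInv, ih]

theorem crossInv_replicate (m n : ℕ) (i j : I) :
    crossInv (List.replicate m i) (List.replicate n j) = if j < i then m * n else 0 := by
  simp [crossInv, List.countP_replicate]

theorem wordLT_replicate_left {i k : I} (h : i < k) (m s : ℕ) :
    WordLT (List.replicate (m + 1) i ++ [k, i] ++ List.replicate s i)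
      (k :: List.replicate (m + 1 + (s + 1)) i) := by
  refine Or.inr ⟨?_, ?_⟩
  · rw [List.perm_iff_count]
    intro j
    simp only [List.count_append, List.count_cons, List.count_nil, List.count_replicate]
    split_ifs <;> omega
  · rw [show [k, i] = List.replicate 1 k ++ List.replicate 1 i from rfl,
      show k :: List.replicate (m + 1 + (s + 1)) i =
        List.replicate 1 k ++ List.replicate (m + 1 + (s + 1)) i from rfl]
    simp only [numInv_append, crossInv_append_left, crossInv_append_right, numInv_replicate,
      crossInv_replicate, h, h.not_gt, lt_irrefl, if_true, if_false]
    omega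

theorem wordLT_replicate_right {i k : I} (h : i < k) (m s : ℕ) :
    WordLT (List.replicate s k ++ [k, i] ++ List.replicate (m + 1) k)
      (List.replicate (m + 1 + (s + 1)) k ++ [i]) := by
  refine Or.inr ⟨?_, ?_⟩
  · rw [List.perm_iff_count]
    intro j
    simp only [List.count_append, List.count_cons, List.count_nil, List.count_replicate]
    split_ifs <;> omega
  · rw [show [k, i] = List.replicate 1 k ++ List.replicate 1 i from rfl,
      show [i] = List.replicate 1 i from rfl]
    simp only [numInv_append, crossInv_append_left, crossInv_append_right, numInv_replicate,
      crossInv_replicate, h, h.not_gt, lt_irrefl, if_true, if_false]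
    omega

/-- The copies of `i` to the right of `k` are moved past it one by one, and each exchange leaves a
bracket in a different position. At least one copy of `i` already stands in front of `k`, which
keeps every word used strictly below the overlap word. -/
theorem move_left_mem_relSpan {i k : I} (h : i < k) (s m : ℕ) :
    a i ^ (m + 1) * a k * a i ^ s - a i ^ (m + 1 + s) * a k -
      ∑ r ∈ Finset.range s, a i ^ (m + 1 + r) * letterMap b a ⁅b k, b i⁆ * a i ^ (s - 1 - r) ∈
        relSpan b a {u | WordLT u (k :: List.replicate (m + 1 + s) i)} := by
  induction s generalizing m with
  | zero => simp
  | succ s ih =>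
    have h1 := ih (m + 1)
    rw [show m + 1 + 1 + s = m + 1 + (s + 1) by omega] at h1
    have h2 := swap_mem_relSpan b a (List.replicate (m + 1) i) (List.replicate s i) h
      (S := {u | WordLT u (k :: List.replicate (m + 1 + (s + 1)) i)})
      (wordLT_replicate_left h m s)
    rw [wordVal_replicate, wordVal_replicate] at h2
    convert Submodule.add_mem _ h2 h1 using 1
    rw [Finset.sum_range_succ']
    have h3 : ∑ r ∈ Finset.range s, a i ^ (m + 1 + (r + 1)) * letterMap b a ⁅b k, b i⁆ *
        a i ^ (s + 1 - 1 - (r + 1)) = ∑ r ∈ Finset.range s, a i ^ (m + 1 + 1 + r) *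
        letterMap b a ⁅b k, b i⁆ * a i ^ (s - 1 - r) := by
      refine Finset.sum_congr rfl fun r _ => ?_
      rw [show m + 1 + (r + 1) = m + 1 + 1 + r by omega,
        show s + 1 - 1 - (r + 1) = s - 1 - r by omega]
    rw [h3, pow_succ' (a i) s, pow_succ (a i) (m + 1)]
    simp only [Nat.add_sub_cancel, Nat.sub_zero, add_zero]
    noncomm_ring

/-- The mirror image: `i` moves left through the copies of `k`, one copy of `k` already standing
behind it. -/
theorem move_right_mem_relSpan {i k : I} (h : i < k) (s m : ℕ) :
    a k ^ s * a i * a k ^ (m + 1) - a i * a k ^ (m + 1 + s) -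
      ∑ r ∈ Finset.range s, a k ^ r * letterMap b a ⁅b k, b i⁆ * a k ^ (m + s - r) ∈
        relSpan b a {u | WordLT u (List.replicate (m + 1 + s) k ++ [i])} := by
  induction s generalizing m with
  | zero => simp
  | succ s ih =>
    have h1 := ih (m + 1)
    rw [show m + 1 + 1 + s = m + 1 + (s + 1) by omega] at h1
    have h2 := swap_mem_relSpan b a (List.replicate s k) (List.replicate (m + 1) k) h
      (S := {u | WordLT u (List.replicate (m + 1 + (s + 1)) k ++ [i])})
      (wordLT_replicate_right h m s)
    rw [wordVal_replicate, wordVal_replicate] at h2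
    convert Submodule.add_mem _ h2 h1 using 1
    rw [Finset.sum_range_succ, show m + (s + 1) - s = m + 1 by omega,
      show m + 1 + s = m + (s + 1) by omega, pow_succ (a k) s, pow_succ' (a k) (m + 1)]
    noncomm_ring

/-- The overlap `k j i`. Both reductions continue to `i j k`, and the brackets collected on the way
cancel by the Jacobi identity. -/
theorem swap_swap_mem_relSpan {i j k : I} (hij : i < j) (hjk : j < k) :
    (a j * a k + letterMap b a ⁅b k, b j⁆) * a i - a k * (a i * a j + letterMap b a ⁅b j, b i⁆) ∈
      relSpan b a {u | WordLT u [k, j, i]} := by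
  have hik := hij.trans hjk
  set S : Set (List I) := {u | WordLT u [k, j, i]}
  have hS : ∀ u, u.Perm [k, j, i] → numInv u < 3 → u ∈ S := fun u h h' =>
    Or.inr ⟨h, h'.trans_eq (by simp [numInv, hij, hjk, hik])⟩
  have h1 := swap_mem_relSpan b a [j] [] hik (S := S) (hS _
    ((List.Perm.swap _ _ _)) (by simp [numInv, hij, hjk.not_gt, hik]))
  have h2 := swap_mem_relSpan b a [] [k] hij (S := S) (hS _
    (((List.Perm.swap _ _ _).cons _).trans (List.Perm.swap _ _ _)) (by
      simp [numInv, hij, hjk.not_gt, hik.not_gt]))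
  have h3 := swap_mem_relSpan b a [] [j] hik (S := S) (hS _
    ((List.Perm.swap _ _ _).cons _) (by simp [numInv, hjk, hik, hij.not_gt]))
  have h4 := swap_mem_relSpan b a [i] [] hjk (S := S) (hS _
    ((List.Perm.swap _ _ _).trans ((List.Perm.swap _ _ _).cons _)) (by
      simp [numInv, hjk, hik.not_gt, hij.not_gt]))
  have hL : ∀ x y : N, letterMap b a x * letterMap b a y - letterMap b a y * letterMap b a x -
      letterMap b a ⁅x, y⁆ ∈ relSpan b a S := fun x y =>
    relSpan_mono b a (fun u hu => Or.inl hu) (lie_mem_relSpan b a x y)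
  have h5 := hL ⁅b j, b i⁆ (b k)
  have h6 := hL (b j) ⁅b k, b i⁆
  have h7 := hL ⁅b k, b j⁆ (b i)
  have hJ : letterMap b a ⁅⁅b j, b i⁆, b k⁆ + letterMap b a ⁅b j, ⁅b k, b i⁆⁆ +
      letterMap b a ⁅⁅b k, b j⁆, b i⁆ = 0 := by
    rw [← map_add, ← map_add, ← map_zero (letterMap b a)]
    congr 1
    rw [← lie_skew ⁅b j, b i⁆ (b k), leibniz_lie (b k) (b j) (b i)]
    abel
  convert Submodule.add_mem _ (Submodule.sub_mem _ (Submodule.add_mem _ h1 h2)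
    (Submodule.add_mem _ h3 h4)) (Submodule.add_mem _ (Submodule.add_mem _ h5 h6) h7) using 1
  rw [← sub_eq_zero]
  simp only [letterMap_basis, wordVal, List.map_nil, List.prod_nil, List.map_cons,
    List.prod_cons] at hJ ⊢
  rw [← hJ]
  noncomm_ring

/-- The overlap `k i ^ p`. Moving `k` through all copies of `i` collects the sum of
`sum_pow_mul_mul_pow`, whose term `r = 0` is left by the first exchange. That sum is an iterated
bracket, and the axiom `lie_pPow` turns it into the bracket of `b k` with the `p`-power of `b i`. -/
theorem swap_pow_mem_relSpan {i k : I} (h : i < k) :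
    (a i * a k + letterMap b a ⁅b k, b i⁆) * a i ^ (p - 1) -
      a k * letterMap b a (RestrictedLieAlgebra.pPow p (b i)) ∈
      relSpan b a {u | WordLT u (k :: List.replicate p i)} := by
  obtain ⟨q, rfl⟩ : ∃ q, p = q + 1 := ⟨p - 1, by have := (Fact.out : p.Prime).pos; omega⟩
  have hq : 1 ≤ q := by have := (Fact.out : (q + 1).Prime).two_le; omega
  set S : Set (List I) := {u | WordLT u (k :: List.replicate (q + 1) i)}
  have hshort : shortWords (q + 2) ⊆ S := fun u hu => Or.inl (by
    simp only [shortWords, Set.mem_ofPred_eq] at hu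
    simp; omega)
  have h1 := move_left_mem_relSpan b a h q 0
  rw [show 0 + 1 + q = q + 1 by omega] at h1
  have h2 := pow_mem_relSpan b a [] [k] i (S := S) (by
    refine Or.inr ⟨?_, ?_⟩
    · simp
    · rw [show k :: List.replicate (q + 1) i = List.replicate 1 k ++ List.replicate (q + 1) i
        from rfl, show [k] = List.replicate 1 k from rfl]
      simp only [numInv_append, numInv_replicate, crossInv_replicate, h, h.not_gt, if_true,
        if_false, List.nil_append]
      omega)
  have h3 := relSpan_mono b a (T := S) (fun u hu => hshort (by
    simp only [shortWords, Set.mem_ofPred_eq] at hu ⊢; omega))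
    (lie_mem_relSpan b a (RestrictedLieAlgebra.pPow (q + 1) (b i)) (b k))
  have h4 := relSpan_mono b a (T := S) (fun u hu => hshort (by
    simp only [shortWords, Set.mem_ofPred_eq] at hu ⊢; omega))
    (bracketIter_mem_relSpan b a ⁅b k, b i⁆ i q)
  have h5 := sum_pow_mul_mul_pow (q + 1) (letterMap b a ⁅b k, b i⁆) (a i)
  rw [Finset.sum_range_succ', Nat.add_sub_cancel] at h5
  have h6 : ∀ n, bracketIter ⁅b k, b i⁆ (b i) n = bracketIter (b k) (b i) (n + 1) := by
    intro n
    induction n with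
    | zero => rfl
    | succ n ih => rw [bracketIter, ih]; rfl
  rw [← h5, h6, ← RestrictedLieAlgebra.lie_pPow (p := q + 1)] at h4
  have h7 : ∑ r ∈ Finset.range q, a i ^ (r + 1) * letterMap b a ⁅b k, b i⁆ * a i ^ (q - (r + 1)) =
      ∑ r ∈ Finset.range q, a i ^ (0 + 1 + r) * letterMap b a ⁅b k, b i⁆ * a i ^ (q - 1 - r) := by
    refine Finset.sum_congr rfl fun r _ => ?_
    rw [show 0 + 1 + r = r + 1 by omega, show q - 1 - r = q - (r + 1) by omega]
  rw [h7] at h4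
  have h8 := lie_skew (RestrictedLieAlgebra.pPow (q + 1) (b i)) (b k)
  rw [← h8] at h3
  convert Submodule.add_mem _ (Submodule.add_mem _ h1 h2) (Submodule.add_mem _ h3 h4) using 1
  simp only [letterMap_basis, wordVal, List.map_nil, List.prod_nil, List.map_cons,
    List.prod_cons, Nat.add_sub_cancel, map_neg, pow_zero, Nat.sub_zero, zero_add, pow_one]
  noncomm_ring

/-- The overlap `k ^ p i`, resolved like `k i ^ p`, with `b i` bracketed repeatedly by `b k`; skew
symmetry accounts for the signs. -/
theorem pow_swap_mem_relSpan {i k : I} (h : i < k) :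
    letterMap b a (RestrictedLieAlgebra.pPow p (b k)) * a i -
      a k ^ (p - 1) * (a i * a k + letterMap b a ⁅b k, b i⁆) ∈
      relSpan b a {u | WordLT u (List.replicate p k ++ [i])} := by
  obtain ⟨q, rfl⟩ : ∃ q, p = q + 1 := ⟨p - 1, by have := (Fact.out : p.Prime).pos; omega⟩
  have hq : 1 ≤ q := by have := (Fact.out : (q + 1).Prime).two_le; omega
  set S : Set (List I) := {u | WordLT u (List.replicate (q + 1) k ++ [i])}
  have hshort : shortWords (q + 2) ⊆ S := fun u hu => Or.inl (by
    simp only [shortWords, Set.mem_ofPred_eq] at hu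
    simp; omega)
  have h1 := move_right_mem_relSpan b a h q 0
  rw [show 0 + 1 + q = q + 1 by omega] at h1
  have h2 := pow_mem_relSpan b a [i] [] k (S := S) (by
    refine Or.inr ⟨?_, ?_⟩
    · simpa using (List.perm_append_singleton i _).symm
    · rw [show [i] = List.replicate 1 i from rfl]
      simp only [numInv_append, numInv_replicate, crossInv_replicate, h, h.not_gt, if_true,
        if_false, List.append_nil]
      omega)
  have h3 := relSpan_mono b a (T := S) (fun u hu => hshort (by
    simp only [shortWords, Set.mem_ofPred_eq] at hu ⊢; omega))
    (lie_mem_relSpan b a (RestrictedLieAlgebra.pPow (q + 1) (b k)) (b i))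
  have h4 := relSpan_mono b a (T := S) (fun u hu => hshort (by
    simp only [shortWords, Set.mem_ofPred_eq] at hu ⊢; omega))
    (bracketIter_mem_relSpan b a ⁅b i, b k⁆ k q)
  have h5 := sum_pow_mul_mul_pow (q + 1) (letterMap b a ⁅b i, b k⁆) (a k)
  rw [Finset.sum_range_succ, Nat.add_sub_cancel] at h5
  have h6 : ∀ n, bracketIter ⁅b i, b k⁆ (b k) n = bracketIter (b i) (b k) (n + 1) := by
    intro n
    induction n with
    | zero => rfl
    | succ n ih => rw [bracketIter, ih]; rfl
  rw [← h5, h6, ← RestrictedLieAlgebra.lie_pPow (p := q + 1)] at h4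
  rw [← lie_skew (b k) (b i)] at h1 ⊢
  rw [← lie_skew _ (b i)] at h3
  convert Submodule.sub_mem _ (Submodule.sub_mem _ (Submodule.add_mem _ h3 h4) h1) h2 using 1
  simp only [letterMap_basis, wordVal, List.map_nil, List.prod_nil, List.map_cons,
    List.prod_cons, Nat.add_sub_cancel, map_neg, pow_zero, Nat.sub_self, zero_add, pow_one,
    mul_neg, neg_mul, Finset.sum_neg_distrib]
  noncomm_ring

theorem bracketIter_self (x : N) {n : ℕ} (hn : 0 < n) : bracketIter x x n = 0 := by
  induction n, hn using Nat.le_induction with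
  | base => simp [bracketIter]
  | succ n _ ih => rw [bracketIter, ih, zero_lie]

/-- The overlaps of `i ^ p` with itself. The `p`-power of `b i` commutes with `b i`, because by
`lie_pPow` their bracket is, up to sign, an iterated bracket of `b i` with itself. -/
theorem pow_pow_mem_relSpan (i : I) (n c : ℕ) (hn : 2 ≤ n) :
    letterMap b a (RestrictedLieAlgebra.pPow p (b i)) * a i ^ c -
      a i ^ c * letterMap b a (RestrictedLieAlgebra.pPow p (b i)) ∈
      relSpan b a (shortWords (n + c)) := by
  induction c with
  | zero => simp
  | succ c ih =>
    have h0 : ⁅RestrictedLieAlgebra.pPow p (b i), b i⁆ = 0 := by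
      rw [← lie_skew, RestrictedLieAlgebra.lie_pPow, neg_eq_zero]
      exact bracketIter_self _ (Fact.out : p.Prime).pos
    have h1 := lie_mem_relSpan b a (RestrictedLieAlgebra.pPow p (b i)) (b i)
    rw [h0, map_zero, sub_zero, letterMap_basis] at h1
    have h2 := mul_relSpan_mul b a (T := shortWords (n + (c + 1))) [] [i]
      (fun u hu => by simp [shortWords] at hu ⊢; omega) ih
    have h3 := mul_relSpan_mul b a (T := shortWords (n + (c + 1))) (List.replicate c i) []
      (fun u hu => by simp [shortWords] at hu ⊢; omega) h1
    rw [wordVal_replicate] at h3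
    convert Submodule.add_mem _ h2 h3 using 1
    simp only [wordVal, List.map_nil, List.prod_nil, List.map_cons,
      List.prod_cons, pow_succ]
    noncomm_ring

end RestrictedPBW

/-! ### Local confluence and the embedding. -/

section RestrictedPBW

variable {p : ℕ} {I : Type*} {N : Type*} [LieRing N] [Fact p.Prime]
  [LieAlgebra (ZMod p) N] (b : Module.Basis I (ZMod p) N)
  {V : Type*} [Ring V] [Algebra (ZMod p) V] (a : I → V)
  [LinearOrder I] [RestrictedLieAlgebra p N]

variable {b a}

/-- Two rules can overlap properly only in `k j i`, `k i ^ p`, `k ^ p i` or a power of one letter.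
Every other case is a coincidence of the rules or contradicts the order of the letters. -/
theorem overlap_mem_relSpan {l l' C Q S : List I} {f f' : V} (h : IsRule b a l f)
    (h' : IsRule b a l' f') (e : l = C ++ Q) (e' : l' = Q ++ S) (hQ : Q ≠ []) :
    f * wordVal a S - wordVal a C * f' ∈ relSpan b a {u | WordLT u (C ++ Q ++ S)} := by
  have hp := (Fact.out : p.Prime).two_le
  cases h with
  | @swap i j hij =>
    rcases C with _ | ⟨x, _ | ⟨y, C⟩⟩
    · obtain rfl : [j, i] = Q := by simpa using e
      cases h' with
      | @swap i' j' hij' =>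
        obtain ⟨rfl, rfl, rfl⟩ : j' = j ∧ i' = i ∧ S = [] := by simpa using e'
        simp [wordVal]
      | pow i' =>
        have := List.eq_of_mem_replicate (show i ∈ List.replicate p i' by rw [e']; simp)
        have := List.eq_of_mem_replicate (show j ∈ List.replicate p i' by rw [e']; simp)
        exact absurd hij (by simp [*])
    · obtain ⟨rfl, rfl⟩ : j = x ∧ [i] = Q := by simpa using e
      cases h' with
      | @swap i' j' hij' =>
        obtain ⟨rfl, rfl⟩ : j' = i ∧ [i'] = S := by simpa using e'
        simpa [wordVal] using swap_swap_mem_relSpan b a hij' hij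
      | pow i' =>
        obtain rfl := List.eq_of_mem_replicate (show i ∈ List.replicate p i' by rw [e']; simp)
        have hS : S = List.replicate (p - 1) i := by
          have h1 : List.replicate p i = i :: List.replicate (p - 1) i := by
            rw [← List.replicate_succ, Nat.sub_add_cancel (by omega)]
          rw [h1] at e'
          simpa using e'.symm
        have h2 := swap_pow_mem_relSpan b a hij
        rw [List.append_assoc, ← e', hS, wordVal_replicate, wordVal_singleton]
        exact h2
    · simp at e
      exact absurd e.2.2 (by simp [hQ])
  | pow i =>
    obtain ⟨hlen, hC, hQ'⟩ := List.append_eq_replicate_iff.mp e.symm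
    have hQi : ∀ x ∈ Q, x = i := fun x hx => List.eq_of_mem_replicate (hQ' ▸ hx)
    cases h' with
    | @swap i' j' hij' =>
      rcases Q with _ | ⟨x, _ | ⟨y, Q⟩⟩
      · exact absurd rfl hQ
      · obtain rfl := hQi x (by simp)
        obtain ⟨rfl, rfl⟩ : j' = x ∧ [i'] = S := by simpa using e'
        have h2 := pow_swap_mem_relSpan b a hij'
        rw [← e, wordVal_singleton, hC, wordVal_replicate]
        rw [show C.length = p - 1 by simp at hlen; omega]
        exact h2
      · have h1 := hQi x (by simp)
        have h2 := hQi y (by simp)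
        simp at e'
        exact absurd hij' (by simp [e'.1, e'.2.1, h1, h2])
    | pow i' =>
      obtain ⟨hlen', hQ'', hS⟩ := List.append_eq_replicate_iff.mp e'.symm
      obtain rfl : i' = i := by
        rcases Q with _ | ⟨x, Q⟩
        · exact absurd rfl hQ
        · rw [← hQi x (by simp)]
          exact (List.eq_of_mem_replicate (hQ'' ▸ (by simp : x ∈ x :: Q))).symm
      have hCS : C.length = S.length := by omega
      rw [hS, hC, wordVal_replicate, wordVal_replicate, hCS]
      refine relSpan_mono b a ?_ (pow_pow_mem_relSpan b a i' p S.length hp)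
      intro u hu
      left
      simp only [shortWords, Set.mem_ofPred_eq, List.length_append, List.length_replicate] at hu ⊢
      omega

/-- One kind of leading word has two distinct letters, the other repeats a single letter exactly `p`
times, so none properly contains another. Hence there are no inclusion ambiguities. -/
theorem IsRule.eq_of_infix {l l' C A : List I} {f f' : V} (h : IsRule b a l f)
    (h' : IsRule b a l' f') (e : l = C ++ l' ++ A) : C = [] ∧ A = [] ∧ f = f' := by
  have hp := (Fact.out : p.Prime).two_le
  have hlen := congrArg List.length e
  cases h with
  | @swap i j hij =>
    cases h' with
    | @swap i' j' hij' =>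
      simp only [List.length_append, List.length_cons, List.length_nil] at hlen
      obtain rfl := List.length_eq_zero_iff.mp (show C.length = 0 by omega)
      obtain rfl := List.length_eq_zero_iff.mp (show A.length = 0 by omega)
      obtain ⟨rfl, rfl⟩ : j = j' ∧ i = i' := by simpa using e
      exact ⟨rfl, rfl, rfl⟩
    | pow i' =>
      simp only [List.length_append, List.length_cons, List.length_nil,
        List.length_replicate] at hlen
      obtain rfl := List.length_eq_zero_iff.mp (show C.length = 0 by omega)
      obtain rfl := List.length_eq_zero_iff.mp (show A.length = 0 by omega)
      simp only [List.nil_append, List.append_nil] at e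
      have := List.eq_of_mem_replicate (show i ∈ List.replicate p i' by rw [← e]; simp)
      have := List.eq_of_mem_replicate (show j ∈ List.replicate p i' by rw [← e]; simp)
      exact absurd hij (by simp [*])
  | pow i =>
    cases h' with
    | @swap i' j' hij' =>
      have h1 := List.eq_of_mem_replicate (show i' ∈ List.replicate p i by rw [e]; simp)
      have h2 := List.eq_of_mem_replicate (show j' ∈ List.replicate p i by rw [e]; simp)
      exact absurd hij' (by simp [h1, h2])
    | pow i' =>
      simp only [List.length_append, List.length_replicate] at hlen
      obtain rfl := List.length_eq_zero_iff.mp (show C.length = 0 by omega)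
      obtain rfl := List.length_eq_zero_iff.mp (show A.length = 0 by omega)
      simp only [List.nil_append, List.append_nil] at e
      have h1 := List.eq_of_mem_replicate
        (show i ∈ List.replicate p i' by rw [← e]; simp; omega)
      subst h1
      exact ⟨rfl, rfl, rfl⟩

variable (p a) in
/-- The span of the words smaller than `v`. -/
def lowerSpan (v : List I) : Submodule (ZMod p) V :=
  Submodule.span (ZMod p) (wordVal a '' {u | WordLT u v})

theorem mul_lowerSpan_mul (s t : List I) {v : List I} {x : V} (hx : x ∈ lowerSpan p a v) :
    wordVal a s * x * wordVal a t ∈ lowerSpan p a (s ++ v ++ t) := by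
  suffices h : lowerSpan p a v ≤ (lowerSpan p a (s ++ v ++ t)).comap
    ((LinearMap.mulRight (ZMod p) (wordVal a t)).comp
      (LinearMap.mulLeft (ZMod p) (wordVal a s))) from h hx
  refine Submodule.span_le.mpr ?_
  rintro _ ⟨u, hu, rfl⟩
  exact Submodule.subset_span ⟨_, hu.append s t, by simp [wordVal_append, mul_assoc]⟩

omit [RestrictedLieAlgebra p N] in
theorem letterMap_mem_lowerSpan (x : N) {v : List I} (hv : 2 ≤ v.length) :
    letterMap b a x ∈ lowerSpan p a v := by
  induction x using basis_induction b with
  | zero => simp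
  | add x y hx hy => rw [map_add]; exact Submodule.add_mem _ hx hy
  | smul c x hx => rw [map_smul]; exact Submodule.smul_mem _ _ hx
  | basis i =>
    rw [letterMap_basis, ← wordVal_singleton a]
    exact Submodule.subset_span ⟨[i], Or.inl hv, rfl⟩

theorem IsRule.mem_lowerSpan {l : List I} {f : V} (h : IsRule b a l f) : f ∈ lowerSpan p a l := by
  cases h with
  | @swap i j h =>
    refine Submodule.add_mem _ (Submodule.subset_span ⟨[i, j], wordLT_swap h, by simp [wordVal]⟩)
      (letterMap_mem_lowerSpan _ (by simp))
  | pow i => exact letterMap_mem_lowerSpan _ (by simpa using (Fact.out : p.Prime).two_le)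

theorem lowerSpan_mul_mem_relSpan {l v E t : List I} {f x : V} (h : IsRule b a l f)
    (hx : x ∈ lowerSpan p a v) :
    x * wordVal a E * (wordVal a l - f) * wordVal a t ∈
      relSpan b a {u | WordLT u (v ++ E ++ l ++ t)} := by
  suffices h : lowerSpan p a v ≤ (relSpan b a {u | WordLT u (v ++ E ++ l ++ t)}).comap
    (LinearMap.mulRight (ZMod p) (wordVal a E * (wordVal a l - f) * wordVal a t)) by
    simpa [mul_assoc] using h hx
  refine Submodule.span_le.mpr ?_
  rintro _ ⟨u, hu, rfl⟩
  refine Submodule.subset_span ⟨u ++ E, t, l, f, h, ?_, by simp [wordVal_append, mul_assoc]⟩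
  simpa using hu.append [] (E ++ l ++ t)

theorem mul_lowerSpan_mem_relSpan {l v E t : List I} {f x : V} (h : IsRule b a l f)
    (hx : x ∈ lowerSpan p a v) :
    (wordVal a l - f) * wordVal a E * x * wordVal a t ∈
      relSpan b a {u | WordLT u (l ++ E ++ v ++ t)} := by
  suffices h : lowerSpan p a v ≤ (relSpan b a {u | WordLT u (l ++ E ++ v ++ t)}).comap
    ((LinearMap.mulRight (ZMod p) (wordVal a t)).comp
      (LinearMap.mulLeft (ZMod p) ((wordVal a l - f) * wordVal a E))) by
    simpa [mul_assoc] using h hx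
  refine Submodule.span_le.mpr ?_
  rintro _ ⟨u, hu, rfl⟩
  refine Submodule.subset_span ⟨[], E ++ u ++ t, l, f, h, ?_, ?_⟩
  · simpa using hu.append (l ++ E) t
  · simp [wordVal_append, wordVal_nil, mul_assoc]

/-- Both results can be reduced further to the one where both rules are applied. The relations used
have leading words in which one of the two subwords is already replaced by smaller words. -/
theorem disjoint_mem_relSpan {l l' E t : List I} {f f' : V} (h : IsRule b a l f)
    (h' : IsRule b a l' f') :
    f * wordVal a (E ++ l' ++ t) - wordVal a (l ++ E) * f' * wordVal a t ∈
      relSpan b a {u | WordLT u (l ++ E ++ l' ++ t)} := by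
  have h1 := lowerSpan_mul_mem_relSpan (E := E) (t := t) h' h.mem_lowerSpan
  have h2 := mul_lowerSpan_mem_relSpan (E := E) (t := t) h h'.mem_lowerSpan
  convert Submodule.sub_mem _ h1 h2 using 1
  simp only [wordVal_append]
  noncomm_ring

theorem confluent_of_prefix {l l' C t t' : List I} {f f' : V} (h : IsRule b a l f)
    (h' : IsRule b a l' f') (e : l ++ t = C ++ (l' ++ t')) :
    f * wordVal a t - wordVal a C * f' * wordVal a t' ∈ relSpan b a {u | WordLT u (l ++ t)} := by
  rcases List.append_eq_append_iff.mp e with ⟨E, rfl, rfl⟩ | ⟨Q, rfl, h1⟩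
  · have := disjoint_mem_relSpan (E := E) (t := t') h h'
    simpa using this
  · rcases List.append_eq_append_iff.mp h1 with ⟨A, rfl, rfl⟩ | ⟨S, rfl, rfl⟩
    · obtain ⟨rfl, rfl, rfl⟩ := h.eq_of_infix h' (C := C) (A := A) (by simp)
      simp [wordVal]
    · by_cases hQ : Q = []
      · subst hQ
        have := disjoint_mem_relSpan (E := []) (t := t') h h'
        simpa [wordVal] using this
      · have h2 := overlap_mem_relSpan h h' rfl rfl hQ
        have h3 := mul_relSpan_mul b a (T := {u | WordLT u (C ++ Q ++ (S ++ t'))}) [] t'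
          (fun u hu => by simpa using WordLT.append hu [] t') h2
        convert h3 using 1
        simp [wordVal_append, wordVal_nil, sub_mul, mul_assoc]

/-- Cancelling the common prefix leaves two occurrences that are disjoint, nested or overlapping;
symmetry allows the first to start further left. -/
theorem confluent {s s' l l' t t' : List I} {f f' : V} (h : IsRule b a l f)
    (h' : IsRule b a l' f') (e : s ++ l ++ t = s' ++ l' ++ t') :
    wordVal a s * f * wordVal a t - wordVal a s' * f' * wordVal a t' ∈
      relSpan b a {u | WordLT u (s ++ l ++ t)} := by
  have key : ∀ {s s' l l' t t' : List I} {f f' : V} (_ : IsRule b a l f)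
      (_ : IsRule b a l' f') (_ : s ++ l ++ t = s' ++ l' ++ t') (C : List I) (_ : s' = s ++ C),
      wordVal a s * f * wordVal a t - wordVal a s' * f' * wordVal a t' ∈
        relSpan b a {u | WordLT u (s ++ l ++ t)} := by
    rintro s _ l l' t t' f f' h h' e C rfl
    have e1 : l ++ t = C ++ (l' ++ t') := by simpa using e
    have h1 := mul_relSpan_mul b a (T := {u | WordLT u (s ++ l ++ t)}) s []
      (fun u hu => by simpa using WordLT.append hu s []) (confluent_of_prefix h h' e1)
    convert h1 using 1
    simp only [wordVal_append, wordVal_nil]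
    noncomm_ring
  rw [List.append_assoc, List.append_assoc] at e
  rcases List.append_eq_append_iff.mp e with ⟨C, hC, -⟩ | ⟨C, hC, -⟩
  · exact key h h' (by simpa using e) C hC
  · rw [← neg_sub, neg_mem_iff, List.append_assoc, e, ← List.append_assoc]
    exact key h' h (by simpa using e.symm) C hC

attribute [local instance] LieRing.ofAssociativeRing

/-- Every restricted Lie algebra embeds in an associative algebra. -/
theorem exists_restricted_embedding.{v} (p : ℕ) [Fact p.Prime] (N : Type v) [LieRing N]
    [LieAlgebra (ZMod p) N] [RestrictedLieAlgebra p N] :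
    ∃ (U : Type v) (_ : Ring U) (_ : Algebra (ZMod p) U) (ι : N →ₗ⁅ZMod p⁆ U),
      Function.Injective ι ∧ ∀ x, ι (RestrictedLieAlgebra.pPow p x) = ι x ^ p := by
  classical
  let b := Module.Basis.ofVectorSpace (ZMod p) N
  let I := Module.Basis.ofVectorSpaceIndex (ZMod p) N
  -- Any linear order on the basis would do: the order on words compares lengths and inversion
  -- counts, so it is well-founded regardless.
  let _ : LinearOrder I := linearOrderOfSTO WellOrderingRel
  let V := MonoidAlgebra (ZMod p) (FreeMonoid I)
  let a : I → V := fun i => MonoidAlgebra.of (ZMod p) _ (FreeMonoid.of i)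
  let B : Module.Basis (List I) (ZMod p) V :=
    (MonoidAlgebra.basis (FreeMonoid I) (ZMod p)).reindex FreeMonoid.toList
  have hB : ∀ l, B l = wordVal a l := by
    intro l
    rw [Module.Basis.reindex_apply]
    induction l with
    | nil => rfl
    | cons i l ih =>
      rw [wordVal, List.map_cons, List.prod_cons, ← wordVal, ← ih]
      exact map_mul (MonoidAlgebra.of (ZMod p) (FreeMonoid I)) (FreeMonoid.of i) (FreeMonoid.ofList l)
  obtain ⟨Φ, hΦ, hirr⟩ := exists_normalForm B wordLT_wf
    (fun w x => ∃ s t l f, IsRule b a l f ∧ w = s ++ l ++ t ∧ x = wordVal a s * f * wordVal a t)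
    (by
      rintro _ _ ⟨s, t, l, f, h, rfl, rfl⟩
      have := mul_lowerSpan_mul s t h.mem_lowerSpan
      rw [show (⇑B) = wordVal a from funext hB]
      exact this)
    (by
      rintro _ _ _ ⟨s, t, l, f, h, rfl, rfl⟩ ⟨s', t', l', f', h', e, rfl⟩
      refine Submodule.span_mono ?_ (confluent h h' e)
      rintro _ ⟨s, t, l, f, h, hlt, rfl⟩
      refine ⟨_, _, ⟨s, t, l, f, h, rfl, rfl⟩, hlt, ?_⟩
      rw [hB, wordVal_append, wordVal_append, mul_sub, sub_mul])
  -- Dividing by the largest two-sided ideal contained in the kernel of `Φ` makes the quotient a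
  -- ring in which the rules hold.
  let c : RingCon V :=
    { r := fun x y => ∀ s t, Φ (s * x * t) = Φ (s * y * t)
      iseqv := ⟨fun _ _ _ => rfl, fun h s t => (h s t).symm, fun h h' s t => (h s t).trans (h' s t)⟩
      add' := fun {x y z w} h h' s t => by
        rw [mul_add, mul_add, add_mul, add_mul, map_add, map_add, h, h']
      mul' := fun {x y z w} h h' s t => by
        have h1 := h s (z * t)
        have h2 := h' (s * y) t
        simp only [mul_assoc] at h1 h2 ⊢
        rw [h1, h2] }
  let π : V →ₐ[ZMod p] c.Quotient := c.mkₐ (ZMod p)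
  have hπ : ∀ x y, π x = π y ↔ c x y := fun x y => RingCon.eq c
  have hrule : ∀ l f, IsRule b a l f → π (wordVal a l) = π f := by
    intro l f h
    rw [hπ]
    intro s t
    induction s using basis_induction B with
    | zero => simp
    | add x y hx hy => rw [add_mul, add_mul, add_mul, add_mul, map_add, map_add, hx, hy]
    | smul r x hx =>
      rw [smul_mul_assoc, smul_mul_assoc, smul_mul_assoc, smul_mul_assoc, map_smul, map_smul, hx]
    | basis s =>
      induction t using basis_induction B with
      | zero => simp
      | add x y hx hy => rw [mul_add, mul_add, map_add, map_add, hx, hy]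
      | smul r x hx => rw [mul_smul_comm, mul_smul_comm, map_smul, map_smul, hx]
      | basis t =>
        have := hΦ _ _ ⟨s, t, l, f, h, rfl, rfl⟩
        rwa [hB, wordVal_append, wordVal_append, ← hB s, ← hB t] at this
  have hrel : ∀ S x, x ∈ relSpan b a S → π x = 0 := by
    intro S x hx
    refine (Submodule.span_le (p := LinearMap.ker π.toLinearMap)).mpr ?_ hx
    rintro _ ⟨s, t, l, f, h, -, rfl⟩
    simp [hrule l f h]
  let ι : N →ₗ⁅ZMod p⁆ c.Quotient :=
    { toLinearMap := π.toLinearMap.comp (letterMap b a)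
      map_lie' := fun {x y} => by
        have := hrel _ _ (lie_mem_relSpan b a x y)
        rw [map_sub, map_sub, map_mul, map_mul, sub_eq_zero] at this
        exact this.symm }
  have hι : ∀ x, ι x = π (letterMap b a x) := fun _ => rfl
  refine ⟨c.Quotient, inferInstance, inferInstance, ι, ?_, ?_⟩
  · rw [injective_iff_map_eq_zero]
    intro x hx
    rw [hι, ← map_zero π, hπ] at hx
    have h1 := hx 1 1
    -- Every leading word has length at least two, so single letters are irreducible and are fixed
    -- by `Φ`.
    have h2 : ∀ x, Φ (letterMap b a x) = letterMap b a x := by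
      intro x
      induction x using basis_induction b with
      | zero => simp
      | add x y hx hy => simp only [map_add, hx, hy]
      | smul r x hx => simp only [map_smul, hx]
      | basis i =>
        rw [letterMap_basis, ← wordVal_singleton a, ← hB]
        refine hirr _ ?_
        rintro _ ⟨s, t, l, f, h, e, -⟩
        have h3 := congrArg List.length e
        have h4 : 2 ≤ l.length := by
          cases h with
          | swap h => simp
          | pow i => simpa using (Fact.out : p.Prime).two_le
        simp only [List.length_append, List.length_cons, List.length_nil] at h3
        omega
    simp only [one_mul, mul_one, map_zero, h2] at h1
    -- Reading off the coefficients of the one-letter words gives a left inverse of `letterMap`.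
    let ψ : V →ₗ[ZMod p] N := B.constr (ZMod p) fun l => match l with
      | [i] => b i
      | _ => 0
    have h5 : ∀ x, ψ (letterMap b a x) = x := by
      intro x
      induction x using basis_induction b with
      | zero => simp
      | add x y hx hy => simp only [map_add, hx, hy]
      | smul r x hx => simp only [map_smul, hx]
      | basis i => rw [letterMap_basis, ← wordVal_singleton a, ← hB, B.constr_basis]
    rw [← h5 x, h1, map_zero]
  -- On basis elements the claim is a rule; Jacobson's formula, valid on both sides, extends it to
  -- sums.
  · intro x
    induction x using basis_induction b with
    | zero => rw [pPow_zero, map_zero, zero_pow (Fact.out : p.Prime).ne_zero]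
    | add x y hx hy =>
      rw [RestrictedLieAlgebra.add_pPow, map_add ι x y, add_pow_eq_add_sum_jacobsonS, map_add,
        map_add, hx, hy, map_sum]
      simp only [map_jacobsonS]
    | smul r x hx => rw [RestrictedLieAlgebra.smul_pPow, map_smul, map_smul, hx, smul_pow]
    | basis i =>
      have := hrel _ _ (pow_mem_relSpan b a [] [] i (S := Set.univ) trivial)
      rw [wordVal_nil, one_mul, mul_one, map_sub, map_pow, sub_eq_zero] at this
      rw [hι, hι, letterMap_basis]
      exact this.symm

end RestrictedPBW

/-! ## Generation of the associated graded Lie algebra in degree one -/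

section Generation

variable {p : ℕ} [Fact p.Prime] {G : Type*} [Group G]

/-- The terms of the `p`-central series whose classes lie in a subgroup closed under brackets and
`p`-powers of homogeneous elements. -/
def PCentralSeries.restrictTo (Γ : PCentralSeries p G) (C : AddSubgroup Γ.Gr)
    (hlie : ∀ x ∈ C, ∀ y ∈ C, ⁅x, y⁆ ∈ C)
    (hpow : ∀ (k : ℕ+) (g : G) (hg : g ∈ Γ.toFun k), Γ.grMk k g hg ∈ C →
      Γ.grMk (⟨p, (Fact.out : p.Prime).pos⟩ * k) (g ^ p) (Γ.pow_mem k g hg) ∈ C)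
    (hone : ∀ (g : G) (hg : g ∈ Γ.toFun 1), Γ.grMk 1 g hg ∈ C) : PCentralSeries p G where
  toFun k :=
    { carrier := {g | ∃ hg : g ∈ Γ.toFun k, Γ.grMk k g hg ∈ C}
      mul_mem' := by
        rintro a b ⟨ha, ha'⟩ ⟨hb, hb'⟩
        exact ⟨(Γ.toFun k).mul_mem ha hb, by rw [Γ.grMk_mul ha hb]; exact C.add_mem ha' hb'⟩
      one_mem' := ⟨(Γ.toFun k).one_mem, by
        rw [Γ.grMk_eq_zero _ (Γ.toFun (k + 1)).one_mem]
        exact C.zero_mem⟩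
      inv_mem' := by
        rintro a ⟨ha, ha'⟩
        exact ⟨(Γ.toFun k).inv_mem ha, by rw [Γ.grMk_inv ha]; exact C.neg_mem ha'⟩ }
  one_eq_top := by
    rw [eq_top_iff]
    intro g _
    have hg : g ∈ Γ.toFun 1 := by rw [Γ.one_eq_top]; trivial
    exact ⟨hg, hone g hg⟩
  succ_le k := by
    rintro g ⟨hg, _⟩
    exact ⟨Γ.succ_le k hg, by rw [Γ.grMk_eq_zero _ hg]; exact C.zero_mem⟩
  commutator_le k l := by
    rw [Subgroup.commutator_le]
    rintro g ⟨hg, hg'⟩ h ⟨hh, hh'⟩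
    exact ⟨Γ.comm_mem hg hh, by rw [← Γ.grMk_lie hg hh]; exact hlie _ hg' _ hh'⟩
  pow_mem := by
    rintro k g ⟨hg, hg'⟩
    exact ⟨Γ.pow_mem k g hg, hpow k g hg hg'⟩

/-- The Lie algebra of the lower `p`-central series is generated by its elements of degree one,
under brackets and `p`-powers of homogeneous elements. -/
theorem mem_of_grLower_degree_one (C : AddSubgroup (grLower p G))
    (hlie : ∀ x ∈ C, ∀ y ∈ C, ⁅x, y⁆ ∈ C)
    (hpow : ∀ (k : ℕ+) (g : G) (hg : g ∈ (lowerPCentralSeries p G).toFun k),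
      (lowerPCentralSeries p G).grMk k g hg ∈ C →
      (lowerPCentralSeries p G).grMk (⟨p, (Fact.out : p.Prime).pos⟩ * k) (g ^ p)
        ((lowerPCentralSeries p G).pow_mem k g hg) ∈ C)
    (hone : ∀ (g : G) (hg : g ∈ (lowerPCentralSeries p G).toFun 1),
      (lowerPCentralSeries p G).grMk 1 g hg ∈ C) (x : grLower p G) : x ∈ C := by
  refine (lowerPCentralSeries p G).gr_induction (P := (· ∈ C)) C.zero_mem ?_
    (fun _ _ => C.add_mem) x
  intro k g hg
  -- The elements with class in `C` form a `p`-central series, and minimality puts the lower series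
  -- inside it.
  exact (lowerPCentralSeries_le
    ((lowerPCentralSeries p G).restrictTo C hlie hpow hone) k hg).2

/-- The map of associated graded Lie algebras induced by a group homomorphism. -/
noncomputable def grLowerLieHom {H : Type*} [Group H] (f : G →* H) :
    grLower p G →ₗ⁅ZMod p⁆ grLower p H where
  toFun := grLowerMap p f
  map_add' := map_add _
  map_smul' a x := ZMod.map_smul (grLowerMap p f) a x
  map_lie' {x y} := by
    refine (lowerPCentralSeries p G).gr_induction (P := fun x => grLowerMap p f ⁅x, y⁆ =
      ⁅grLowerMap p f x, grLowerMap p f y⁆) (by simp) ?_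
      (fun a b ha hb => by rw [add_lie, map_add, map_add, add_lie, ha, hb]) x
    intro k g hg
    refine (lowerPCentralSeries p G).gr_induction (P := fun y =>
      grLowerMap p f ⁅(lowerPCentralSeries p G).grMk k g hg, y⁆ =
      ⁅grLowerMap p f ((lowerPCentralSeries p G).grMk k g hg), grLowerMap p f y⁆) (by simp) ?_
      (fun a b ha hb => by rw [lie_add, map_add, map_add, lie_add, ha, hb]) y
    intro l h hh
    rw [PCentralSeries.grMk_lie, grLowerMap_grMk, grLowerMap_grMk, grLowerMap_grMk,
      PCentralSeries.grMk_lie]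
    exact PCentralSeries.grMk_congr _ _ rfl (map_commutatorElement f g h)

theorem grLowerLieHom_apply {H : Type*} [Group H] (f : G →* H) (x : grLower p G) :
    grLowerLieHom f x = grLowerMap p f x := rfl

/-- A Lie homomorphism which is compatible with the `p`-powers of homogeneous elements is
restricted. -/
theorem PCentralSeries.map_pPow_of_grMk {Γ : PCentralSeries p G} [S : RestrictedLieAlgebra p Γ.Gr]
    {M : Type*} [LieRing M] [LieAlgebra (ZMod p) M] [RestrictedLieAlgebra p M]
    (f : Γ.Gr →ₗ⁅ZMod p⁆ M)
    (hf : ∀ (k : ℕ+) (g : G) (hg : g ∈ Γ.toFun k), f (S.pPow (Γ.grMk k g hg)) =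
      RestrictedLieAlgebra.pPow p (f (Γ.grMk k g hg))) (x : Γ.Gr) :
    f (S.pPow x) = RestrictedLieAlgebra.pPow p (f x) := by
  refine Γ.gr_induction (P := fun x => f (S.pPow x) = RestrictedLieAlgebra.pPow p (f x)) ?_ hf ?_ x
  · rw [pPow_zero, map_zero, pPow_zero]
  · intro x y hx hy
    rw [RestrictedLieAlgebra.add_pPow, map_add, map_add, hx, hy, map_add, map_sum,
      RestrictedLieAlgebra.add_pPow]
    simp only [map_jacobsonS]

theorem grLowerLieHom_pPow {H : Type*} [Group H] [S : RestrictedLieAlgebra p (grLower p G)]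
    [T : RestrictedLieAlgebra p (grLower p H)] (hS : (lowerPCentralSeries p G).IsGrPower S.pPow)
    (hT : (lowerPCentralSeries p H).IsGrPower T.pPow) (f : G →* H) (x : grLower p G) :
    grLowerLieHom f (S.pPow x) = T.pPow (grLowerLieHom f x) := by
  refine PCentralSeries.map_pPow_of_grMk _ (fun k g hg => ?_) x
  rw [hS, grLowerLieHom_apply, grLowerLieHom_apply, grLowerMap_grMk, grLowerMap_grMk, hT]
  exact PCentralSeries.grMk_congr _ _ rfl (map_pow f g p)

/-- Restricted Lie homomorphisms from the Lie algebra of the lower `p`-central series are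
determined by their values in degree one. -/
theorem grLower_hom_ext {M : Type*} [LieRing M] [LieAlgebra (ZMod p) M] [RestrictedLieAlgebra p M]
    [S : RestrictedLieAlgebra p (grLower p G)] (hS : (lowerPCentralSeries p G).IsGrPower S.pPow)
    (f f' : RestrictedLieHom p (grLower p G) M)
    (h : ∀ (g : G) (hg : g ∈ (lowerPCentralSeries p G).toFun 1),
      f.toLieHom ((lowerPCentralSeries p G).grMk 1 g hg) =
        f'.toLieHom ((lowerPCentralSeries p G).grMk 1 g hg)) : f = f' := by
  have key : ∀ x, x ∈ (AddMonoidHom.eqLocus (f.toLieHom : grLower p G →+ M)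
      (f'.toLieHom : grLower p G →+ M)) := by
    refine mem_of_grLower_degree_one _ ?_ ?_ h
    · intro x hx y hy
      change f.toLieHom _ = f'.toLieHom _
      rw [LieHom.map_lie, LieHom.map_lie]
      exact congrArg₂ _ hx hy
    · intro k g hg hx
      change f.toLieHom _ = f'.toLieHom _
      rw [← hS k g hg, f.map_pPow, f'.map_pPow]
      exact congrArg _ hx
  cases f
  cases f'
  congr 1
  exact LieHom.ext key

end Generation

/-! ## Graph products of groups -/

section GraphProducts

namespace GraphProd

variable {m : ℕ} (K : AbstractSimplicialComplex (Fin m)) (G : Fin m → Type*) [∀ i, Group (G i)]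

theorem ofFace_extendOne {I J : SFace K} (h : I.1 ⊆ J.1) (x : ∀ i : I.1, G i) :
    ofFace K G J (extendOne I.1 J.1 x) = ofFace K G I x := by
  refine (QuotientGroup.eq.mpr ?_).symm
  rw [← (Subgroup.normalClosure (polyhedralRels K G)).inv_mem_iff, mul_inv_rev, inv_inv]
  have h1 : Monoid.CoprodI.of (i := J) (extendOne I.1 J.1 x) * (Monoid.CoprodI.of (i := I) x)⁻¹ ∈
      Subgroup.normalClosure (polyhedralRels K G) :=
    Subgroup.subset_normalClosure ⟨I, J, x, h, rfl⟩
  have h2 := Subgroup.normalClosure_normal.mem_comm h1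
  rw [← Subgroup.inv_mem_iff] at h2
  simpa using h2

theorem extendOne_mulSingle {I J : Finset (Fin m)} (h : I ⊆ J) (i : I) (g : G i) :
    extendOne I J (Pi.mulSingle i g) = Pi.mulSingle (M := fun j : J => G j) ⟨i, h i.2⟩ g := by
  funext j
  rcases eq_or_ne j ⟨i, h i.2⟩ with rfl | hj
  · simp [extendOne]
  · rw [Pi.mulSingle_eq_of_ne hj]
    unfold extendOne
    split_ifs with hI
    · exact Pi.mulSingle_eq_of_ne (fun e => hj (by rw [← e])) _
    · rfl

theorem ofVertex_eq_ofFace (I : SFace K) (i : I.1) (g : G i) :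
    ofVertex K G i g = ofFace K G I (Pi.mulSingle i g) := by
  have h : (vertexFace K i).1 ⊆ I.1 := Finset.singleton_subset_iff.mpr i.2
  rw [← extendOne_mulSingle G h ⟨i, Finset.mem_singleton_self _⟩ g, ofFace_extendOne K G h]
  rfl

theorem commute_ofVertex {I : SFace K} {i j : Fin m} (hi : i ∈ I.1) (hj : j ∈ I.1) (hij : i ≠ j)
    (g : G i) (h : G j) : Commute (ofVertex K G i g) (ofVertex K G j h) := by
  rw [ofVertex_eq_ofFace K G I ⟨i, hi⟩, ofVertex_eq_ofFace K G I ⟨j, hj⟩]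
  exact (Pi.mulSingle_commute (f := fun i : I.1 => G i) (i := ⟨i, hi⟩) (j := ⟨j, hj⟩)
    (fun e => hij (congrArg Subtype.val e)) g h).map _

/-- The products over the faces generate the colimit, and each of them is generated by its factors.
-/
theorem mem_of_ofVertex_mem {H : Subgroup (GraphProd K G)}
    (h : ∀ i g, ofVertex K G i g ∈ H) (x : GraphProd K G) : x ∈ H := by
  obtain ⟨x, rfl⟩ := QuotientGroup.mk'_surjective _ x
  change x ∈ H.comap (QuotientGroup.mk' (Subgroup.normalClosure (polyhedralRels K G)))
  induction x using Monoid.CoprodI.induction_on with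
  | one => exact Subgroup.one_mem _
  | of I x =>
    have h1 : x ∈ H.comap (ofFace K G I) :=
      Subgroup.pi_mem_of_mulSingle_mem x fun i => by
        rw [Subgroup.mem_comap, ← ofVertex_eq_ofFace]
        exact h _ _
    exact h1
  | mul x y hx hy => exact Subgroup.mul_mem _ hx hy

instance group_fg [∀ i, Finite (G i)] : Group.FG (GraphProd K G) := by
  refine Group.fg_iff.mpr ⟨⋃ i, Set.range (ofVertex K G i), ?_,
    Set.finite_iUnion fun i => Set.finite_range (ofVertex K G i)⟩
  rw [eq_top_iff]
  intro x _
  exact mem_of_ofVertex_mem K G (fun i g => Subgroup.subset_closure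
    (Set.mem_iUnion.mpr ⟨i, Set.mem_range_self g⟩)) x

variable {G} {M : Type*} [Group M] (ρ : ∀ i, G i →* M)
  (hρ : ∀ (I : SFace K) (i j : I.1), i ≠ j → ∀ g h, Commute (ρ i g) (ρ j h))

/-- The homomorphism on the product over a face defined by homomorphisms with commuting images. -/
def faceHom (I : SFace K) : (∀ i : I.1, G i) →* M :=
  MonoidHom.noncommPiCoprod (fun i : I.1 => ρ i) fun i j hij => hρ I i j hij

theorem faceHom_mulSingle (I : SFace K) (i : I.1) (g : G i) :
    faceHom K ρ hρ I (Pi.mulSingle i g) = ρ i g :=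
  MonoidHom.noncommPiCoprod_mulSingle _ _ _

/-- Extension by one as a homomorphism. -/
def extendOneHom (G : Fin m → Type*) [∀ i, Group (G i)] (I J : Finset (Fin m)) :
    (∀ i : I, G i) →* ∀ j : J, G j where
  toFun := extendOne I J
  map_one' := by
    funext j
    unfold extendOne
    split_ifs <;> rfl
  map_mul' x y := by
    funext j
    rw [Pi.mul_apply]
    unfold extendOne
    split_ifs
    · rfl
    · exact (one_mul 1).symm

theorem faceHom_extendOne {I J : SFace K} (h : I.1 ⊆ J.1) (x : ∀ i : I.1, G i) :
    faceHom K ρ hρ J (extendOne I.1 J.1 x) = faceHom K ρ hρ I x := by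
  have h1 : x ∈ ((faceHom K ρ hρ J).comp (extendOneHom G I.1 J.1)).eqLocus (faceHom K ρ hρ I) :=
    Subgroup.pi_mem_of_mulSingle_mem x fun i => by
      change faceHom K ρ hρ J (extendOne I.1 J.1 (Pi.mulSingle i (x i))) =
        faceHom K ρ hρ I (Pi.mulSingle i (x i))
      rw [extendOne_mulSingle G h, faceHom_mulSingle]
      exact (faceHom_mulSingle K ρ hρ I i (x i)).symm
  exact h1

/-- The homomorphism from a graph product defined by homomorphisms with commuting images on the
faces. -/
def lift : GraphProd K G →* M :=
  QuotientGroup.lift (Subgroup.normalClosure (polyhedralRels K G))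
    (Monoid.CoprodI.lift (faceHom K ρ hρ)) (by
      have h1 : Subgroup.normalClosure (polyhedralRels K G) ≤
          (Monoid.CoprodI.lift (faceHom K ρ hρ)).ker := by
        refine Subgroup.normalClosure_le_normal ?_
        rintro _ ⟨I, J, x, h, rfl⟩
        rw [SetLike.mem_coe, MonoidHom.mem_ker, map_mul, map_inv, Monoid.CoprodI.lift_of,
          Monoid.CoprodI.lift_of, faceHom_extendOne K ρ hρ h, mul_inv_cancel]
      exact fun x hx => h1 hx)

theorem lift_ofVertex (i : Fin m) (g : G i) : lift K ρ hρ (ofVertex K G i g) = ρ i g := by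
  have h : lift K ρ hρ (ofVertex K G i g) =
      Monoid.CoprodI.lift (faceHom K ρ hρ) (Monoid.CoprodI.of (i := vertexFace K i)
        (Pi.mulSingle ⟨i, Finset.mem_singleton_self i⟩ g)) := rfl
  rw [h, Monoid.CoprodI.lift_of]
  exact faceHom_mulSingle K ρ hρ (vertexFace K i) ⟨i, Finset.mem_singleton_self i⟩ g

end GraphProd

end GraphProducts

/-! ## Elementary abelian groups -/

section ElementaryAbelian

variable {p : ℕ} {n : ℕ} {A M : Type*} [Group A] [Group M]

/-- The basis of an elementary abelian group defined by an isomorphism with `(ZMod p) ^ n`. -/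
def elementaryBasis (e : A ≃* Multiplicative (Fin n → ZMod p)) (j : Fin n) : A := e.symm (Multiplicative.ofAdd (Pi.single j 1))

theorem elementary_commute (e : A ≃* Multiplicative (Fin n → ZMod p)) (a b : A) : Commute a b := by
  apply e.injective
  rw [map_mul, map_mul, mul_comm]

theorem elementary_pow (e : A ≃* Multiplicative (Fin n → ZMod p)) (a : A) : a ^ p = 1 := by
  apply e.injective
  rw [map_pow, map_one]
  apply Multiplicative.toAdd.injective
  funext j
  simp

theorem mem_of_elementaryBasis_mem (e : A ≃* Multiplicative (Fin n → ZMod p))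
    {H : Subgroup A} (h : ∀ j, elementaryBasis e j ∈ H) (a : A) :
    a ∈ H := by
  have key : ∀ v : Fin n → ZMod p, e.symm (Multiplicative.ofAdd v) ∈ H := by
    intro v
    have hv : v ∈ (Subgroup.toAddSubgroup (H.comap e.symm.toMonoidHom)).comap
        (AddMonoidHom.id (Fin n → ZMod p)) := by
      refine AddSubgroup.pi_mem_of_single_mem v fun j => ?_
      obtain ⟨k, hk⟩ := ZMod.intCast_surjective (v j)
      have e1 : Pi.single j (v j) = k • (Pi.single j 1 : Fin n → ZMod p) := by
        rw [← Pi.single_smul', zsmul_eq_mul, mul_one, hk]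
      rw [e1]
      exact AddSubgroup.zsmul_mem _ (h j) _
    exact hv
  simpa using key (Multiplicative.toAdd (e a))

/-- The group is a finite product of cyclic groups of order `p`, so homomorphisms of the factors
with commuting images can be multiplied together. -/
theorem exists_hom_of_elementaryBasis (e : A ≃* Multiplicative (Fin n → ZMod p))
    (c : Fin n → M) (hc : ∀ j, c j ^ p = 1)
    (hcomm : ∀ i j, Commute (c i) (c j)) : ∃ f : A →* M, ∀ j, f (elementaryBasis e j) = c j := by
  let φ : ∀ _ : Fin n, Multiplicative (ZMod p) →* M := fun j =>
    AddMonoidHom.toMultiplicativeLeft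
      (ZMod.lift p ⟨zmultiplesHom (Additive M) (Additive.ofMul (c j)), by
        simp [← ofMul_pow, hc]⟩)
  have hφ : ∀ j (k : ℤ), φ j (Multiplicative.ofAdd (k : ZMod p)) = c j ^ k := by
    intro j k
    simp [φ]
  have hcom : Pairwise fun i j => ∀ x y, Commute (φ i x) (φ j y) := by
    intro i j _ x y
    obtain ⟨a, ha⟩ := ZMod.intCast_surjective (Multiplicative.toAdd x)
    obtain ⟨b, hb⟩ := ZMod.intCast_surjective (Multiplicative.toAdd y)
    rw [← ofAdd_toAdd x, ← ofAdd_toAdd y, ← ha, ← hb, hφ, hφ]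
    exact (hcomm i j).zpow_zpow a b
  refine ⟨((MonoidHom.noncommPiCoprod φ hcom).comp
    (MulEquiv.piMultiplicative fun _ => ZMod p).toMonoidHom).comp e.toMonoidHom, fun j => ?_⟩
  have h1 : MulEquiv.piMultiplicative (fun _ : Fin n => ZMod p) (e (elementaryBasis e j)) =
      Pi.mulSingle j (Multiplicative.ofAdd ((1 : ℤ) : ZMod p)) := by
    funext i
    rcases eq_or_ne i j with rfl | hij
    · simp [elementaryBasis]
    · simp [elementaryBasis, hij]
  change MonoidHom.noncommPiCoprod φ hcom (MulEquiv.piMultiplicative _ (e (elementaryBasis e j))) = _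
  rw [h1, MonoidHom.noncommPiCoprod_mulSingle, hφ, zpow_one]

variable [Fact p.Prime]

/-- The `p`-central series of a commutative group of exponent `p` with trivial second term. -/
def trivialPCentralSeries (hcomm : ∀ a b : A, Commute a b) (hpow : ∀ a : A, a ^ p = 1) :
    PCentralSeries p A where
  toFun k := if k = 1 then ⊤ else ⊥
  one_eq_top := if_pos rfl
  succ_le k := by
    rw [if_neg (by rw [← PNat.coe_inj, PNat.add_coe, PNat.one_coe]; have := k.pos; omega)]
    exact bot_le
  commutator_le k l := by
    rw [Subgroup.commutator_le]
    intro g _ h _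
    rw [commutatorElement_eq_one_iff_commute.mpr (hcomm g h)]
    exact Subgroup.one_mem _
  pow_mem k g _ := by
    rw [hpow]
    exact Subgroup.one_mem _

/-- The series with trivial second term is already `p`-central, so by minimality the lower series is
trivial from degree two on. -/
theorem grMk_eq_zero_of_elementary (e : A ≃* Multiplicative (Fin n → ZMod p))
    {k : ℕ+} (hk : k ≠ 1) {a : A}
    (ha : a ∈ (lowerPCentralSeries p A).toFun k) : (lowerPCentralSeries p A).grMk k a ha = 0 := by
  have h := lowerPCentralSeries_le
    (trivialPCentralSeries (elementary_commute e) (elementary_pow e)) k ha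
  change a ∈ (if k = 1 then (⊤ : Subgroup A) else ⊥) at h
  rw [if_neg hk, Subgroup.mem_bot] at h
  exact PCentralSeries.grMk_eq_zero _ _ (by rw [h]; exact Subgroup.one_mem _)

end ElementaryAbelian

/-! ## Representations in a polynomial ring -/

section PolynomialRepresentations

open Polynomial
open scoped commutatorElement

namespace MulFiltration

variable {p : ℕ} {G : Type*} [Group G] {Λ : Type*} [Ring Λ] [Algebra (ZMod p) Λ]
  (J : MulFiltration p Λ)

theorem map_mul_sub_one_mem (ρ : G →* Λ) {k : ℕ} {g h : G} (hg : ρ g - 1 ∈ J.toFun k)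
    (hh : ρ h - 1 ∈ J.toFun k) : ρ (g * h) - 1 ∈ J.toFun k := by
  have e : ρ (g * h) - 1 = (ρ g - 1) * ρ h + (ρ h - 1) := by
    rw [map_mul]
    noncomm_ring
  rw [e]
  exact Submodule.add_mem _ (J.mul_mem_right _ hg) hh

variable [Fact p.Prime]

/-- The `p`-central series defined by a representation which is trivial modulo the first term of
the filtration. -/
def pCentralSeries (ρ : G →* Λ) (h1 : ∀ g, ρ g - 1 ∈ J.toFun 1) : PCentralSeries p G where
  toFun k :=
    { carrier := {g | ρ g - 1 ∈ J.toFun k}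
      mul_mem' := J.map_mul_sub_one_mem ρ
      one_mem' := by
        change ρ 1 - 1 ∈ J.toFun k
        rw [map_one, sub_self]
        exact Submodule.zero_mem _
      inv_mem' := by
        intro g hg
        change ρ g⁻¹ - 1 ∈ J.toFun k
        have e : ρ g⁻¹ - 1 = -(ρ g⁻¹ * (ρ g - 1)) := by
          rw [mul_sub, ← map_mul, inv_mul_cancel, map_one, mul_one, neg_sub]
        rw [e]
        exact Submodule.neg_mem _ (J.mul_mem_left _ hg) }
  one_eq_top := by
    rw [eq_top_iff]
    exact fun g _ => h1 g
  succ_le k := fun g hg => J.succ_le k hg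
  commutator_le k l := by
    rw [Subgroup.commutator_le]
    intro g hg h hh
    change ρ ⁅g, h⁆ - 1 ∈ J.toFun ((k + l : ℕ+) : ℕ)
    rw [PNat.add_coe]
    have e : ρ ⁅g, h⁆ - 1 =
        ((ρ g - 1) * (ρ h - 1) - (ρ h - 1) * (ρ g - 1)) * ρ ((h * g)⁻¹) := by
      have e1 : ρ ⁅g, h⁆ = ρ g * ρ h * ρ (h * g)⁻¹ := by
        rw [← map_mul, ← map_mul, commutatorElement_def]
        congr 1
        group
      have e2 : (ρ g - 1) * (ρ h - 1) - (ρ h - 1) * (ρ g - 1) = ρ g * ρ h - ρ (h * g) := by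
        rw [map_mul]
        noncomm_ring
      rw [e1, e2, sub_mul, ← map_mul ρ (h * g), mul_inv_cancel, map_one]
    rw [e]
    refine J.mul_mem_right _ (Submodule.sub_mem _ (J.mul_mem' hg hh) ?_)
    rw [add_comm]
    exact J.mul_mem' hh hg
  pow_mem k g hg := by
    change ρ (g ^ p) - 1 ∈ J.toFun (p * (k : ℕ))
    have e : ρ (g ^ p) - 1 = (ρ g - 1) ^ p := by
      rcases subsingleton_or_nontrivial Λ with h | h
      · exact Subsingleton.elim _ _
      · have : CharP Λ p := charP_of_injective_algebraMap (algebraMap (ZMod p) Λ).injective p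
        rw [sub_pow_char_of_commute _ (Commute.one_right _), one_pow, map_pow]
    rw [e]
    exact J.pow_mem hg p

theorem map_sub_one_mem_of_lower (ρ : G →* Λ) (h1 : ∀ g, ρ g - 1 ∈ J.toFun 1) (k : ℕ+) (g : G)
    (hg : g ∈ (lowerPCentralSeries p G).toFun k) : ρ g - 1 ∈ J.toFun k :=
  lowerPCentralSeries_le (J.pCentralSeries ρ h1) k hg

end MulFiltration

variable (p : ℕ) (U : Type*) [Ring U] [Algebra (ZMod p) U]

/-- The filtration of a polynomial ring by the powers of `X`. -/
def xFiltration : MulFiltration p U[X] where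
  toFun k :=
    { carrier := {f | ∀ i < k, f.coeff i = 0}
      add_mem' := fun ha hb i hi => by rw [coeff_add, ha i hi, hb i hi, add_zero]
      zero_mem' := fun i _ => coeff_zero i
      smul_mem' := fun c f hf i hi => by rw [coeff_smul, hf i hi, smul_zero] }
  zero_eq_top := by
    rw [eq_top_iff]
    exact fun f _ i hi => absurd hi (Nat.not_lt_zero i)
  succ_le k f hf i hi := hf i (by omega)
  mul_mem' {k l a b} ha hb i hi := by
    rw [coeff_mul]
    refine Finset.sum_eq_zero fun x hx => ?_
    have := Finset.HasAntidiagonal.mem_antidiagonal.mp hx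
    rcases lt_or_ge x.1 k with h | h
    · rw [ha _ h, zero_mul]
    · rw [hb _ (by omega), mul_zero]

/-- The coefficients as symbols for the filtration by the powers of `X`. -/
def coeffSymbol : SymbolMap (xFiltration p U) U where
  toFun k f := f.coeff k
  map_add' _ _ := coeff_add _ _ _
  map_mul' {k l a b} ha hb := by
    rw [coeff_mul]
    refine Finset.sum_eq_single (k, l) (fun x hx hne => ?_)
      (fun h => (h (by simp)).elim)
    have := Finset.HasAntidiagonal.mem_antidiagonal.mp hx
    rcases lt_trichotomy x.1 k with h | h | h
    · rw [ha _ h, zero_mul]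
    · exact absurd (Prod.ext h (by simp only at *; omega)) hne
    · rw [hb _ (by omega), mul_zero]
  map_eq_zero {k a} ha := ha k (Nat.lt_succ_self k)

variable {p U} [Fact p.Prime]

/-- In characteristic `p`, `(1 + uX) ^ p = 1 + u ^ p X ^ p`. This lets `1 + uX` be the image of a
generator of order `p`. -/
theorem one_add_monomial_pow {u : U} (hu : u ^ p = 0) : (1 + monomial 1 u : U[X]) ^ p = 1 := by
  rcases subsingleton_or_nontrivial U with h | h
  · exact Subsingleton.elim _ _
  · have : CharP U[X] p := charP_of_injective_algebraMap (algebraMap (ZMod p) U[X]).injective p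
    rw [add_pow_char_of_commute _ (Commute.one_left _), one_pow, monomial_pow, hu, map_zero,
      add_zero]

theorem commute_one_add_monomial {u v : U} (h : Commute u v) :
    Commute (1 + monomial 1 u : U[X]) (1 + monomial 1 v) := by
  refine (Commute.add_right (Commute.one_right _) (Commute.add_left (Commute.one_left _) ?_))
  change _ * _ = _ * _
  rw [monomial_mul_monomial, monomial_mul_monomial, h.eq]

end PolynomialRepresentations

/-! ## Homomorphisms from the Lie algebra of a graph product -/

section GraphProductHom

open Polynomial

variable {p : ℕ} [Fact p.Prime]

theorem PCentralSeries.mem_one {G : Type*} [Group G] (Γ : PCentralSeries p G) (g : G) :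
    g ∈ Γ.toFun 1 := by
  rw [Γ.one_eq_top]
  trivial

/-- The class in degree one as a homomorphism. -/
noncomputable def PCentralSeries.grOne {G : Type*} [Group G] (Γ : PCentralSeries p G) :
    G →* Multiplicative Γ.Gr where
  toFun g := Multiplicative.ofAdd (Γ.grMk 1 g (Γ.mem_one g))
  map_one' := congrArg Multiplicative.ofAdd (Γ.grMk_eq_zero _ (Subgroup.one_mem _))
  map_mul' g h := congrArg Multiplicative.ofAdd (Γ.grMk_mul (Γ.mem_one g) (Γ.mem_one h))

/-- Centralizers are subgroups, so commutation passes from basis elements to the groups in one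
argument at a time. -/
theorem commute_of_elementaryBasis {n n' : ℕ} {A A' M : Type*} [Group A] [Group A'] [Group M]
    (e : A ≃* Multiplicative (Fin n → ZMod p)) (e' : A' ≃* Multiplicative (Fin n' → ZMod p))
    (f : A →* M) (f' : A' →* M)
    (h : ∀ i j, Commute (f (elementaryBasis e i)) (f' (elementaryBasis e' j))) (a : A) (a' : A') :
    Commute (f a) (f' a') := by
  have h1 : ∀ i a', Commute (f (elementaryBasis e i)) (f' a') := fun i a' => by
    have : a' ∈ (Subgroup.centralizer {f (elementaryBasis e i)}).comap f' :=
      mem_of_elementaryBasis_mem e' (fun j => by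
        rw [Subgroup.mem_comap, Subgroup.mem_centralizer_singleton_iff]
        exact (h i j).symm) a'
    rw [Subgroup.mem_comap, Subgroup.mem_centralizer_singleton_iff] at this
    exact Eq.symm this
  have : a ∈ (Subgroup.centralizer {f' a'}).comap f :=
    mem_of_elementaryBasis_mem e (fun j => by
      rw [Subgroup.mem_comap, Subgroup.mem_centralizer_singleton_iff]
      exact h1 j a') a
  rw [Subgroup.mem_comap, Subgroup.mem_centralizer_singleton_iff] at this
  exact this

variable {m : ℕ} (K : AbstractSimplicialComplex (Fin m)) {n : Fin m → ℕ}
  {G : Fin m → Type*} [∀ i, Group (G i)]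
  (e : ∀ i, G i ≃* Multiplicative (Fin (n i) → ZMod p))

theorem GraphProd.mem_of_elementaryBasis_mem {H : Subgroup (GraphProd K G)}
    (h : ∀ i j, ofVertex K G i (elementaryBasis (e i) j) ∈ H) (x : GraphProd K G) : x ∈ H :=
  mem_of_ofVertex_mem K G (fun i g =>
    _root_.mem_of_elementaryBasis_mem (H := H.comap (ofVertex K G i)) (e i) (h i) g) x

/-- The units `1 + uX` satisfy the relations of the generators: they have `p`-th power one, and they
commute when the coefficients `u` do. The case of equal vertices in `hcomm` covers each group `G i`
itself. -/
theorem GraphProd.exists_representation {U : Type*} [Ring U] [Algebra (ZMod p) U]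
    (u : ∀ i, Fin (n i) → U) (hu : ∀ i j, u i j ^ p = 0)
    (hcomm : ∀ (I : SFace K) (i i' : I.1) (j : Fin (n i)) (j' : Fin (n i')),
      Commute (u i j) (u i' j')) :
    ∃ ρ : GraphProd K G →* U[X], ∀ i j,
      ρ (ofVertex K G i (elementaryBasis (e i) j)) = 1 + monomial 1 (u i j) := by
  let c : ∀ i, Fin (n i) → (U[X])ˣ := fun i j =>
    Units.ofPowEqOne (1 + monomial 1 (u i j)) p (one_add_monomial_pow (hu i j))
      (Fact.out : p.Prime).ne_zero
  have hc : ∀ (I : SFace K) (i i' : I.1) (j : Fin (n i)) (j' : Fin (n i')),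
      Commute (c i j) (c i' j') := fun I i i' j j' =>
    Units.ext (commute_one_add_monomial (hcomm I i i' j j'))
  have h := fun i => exists_hom_of_elementaryBasis (e i) (c i)
    (fun j => Units.ext (one_add_monomial_pow (hu i j)))
    (fun j j' => hc (vertexFace K i) ⟨i, Finset.mem_singleton_self i⟩
      ⟨i, Finset.mem_singleton_self i⟩ j j')
  choose f hf using h
  have hfc : ∀ (I : SFace K) (i j : I.1), i ≠ j → ∀ g h, Commute (f i g) (f j h) :=
    fun I i j _ => commute_of_elementaryBasis (e i) (e j) (f i) (f j) fun a b => by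
      rw [hf, hf]
      exact hc I i j a b
  refine ⟨(Units.coeHom U[X]).comp (lift K f hfc), fun i j => ?_⟩
  rw [MonoidHom.comp_apply, lift_ofVertex, hf]
  rfl

attribute [local instance] LieRing.ofAssociativeRing

/-- Restricted homomorphisms from the Lie algebra of a graph product of elementary abelian groups
may be prescribed on the basis elements. -/
theorem GraphProd.exists_restrictedLieHom {N : Type*} [LieRing N] [LieAlgebra (ZMod p) N]
    [RestrictedLieAlgebra p N] [S : RestrictedLieAlgebra p (grLower p (GraphProd K G))]
    (hS : (lowerPCentralSeries p (GraphProd K G)).IsGrPower S.pPow) (v : ∀ i, Fin (n i) → N)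
    (hv : ∀ i j, RestrictedLieAlgebra.pPow p (v i j) = 0)
    (hcomm : ∀ (I : SFace K) (i i' : I.1) (j : Fin (n i)) (j' : Fin (n i')),
      ⁅v i j, v i' j'⁆ = 0) :
    ∃ f : RestrictedLieHom p (grLower p (GraphProd K G)) N, ∀ i j,
      f.toLieHom ((lowerPCentralSeries p (GraphProd K G)).grMk 1
        (ofVertex K G i (elementaryBasis (e i) j)) (PCentralSeries.mem_one _ _)) = v i j := by
  obtain ⟨U, _, _, ι, hι, hιp⟩ := exists_restricted_embedding p N
  obtain ⟨ρ, hρ⟩ := exists_representation K e (fun i j => ι (v i j))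
    (fun i j => by rw [← hιp, hv, map_zero]) (fun I i i' j j' => by
      have := ι.map_lie (v i j) (v i' j')
      rw [hcomm, map_zero, Ring.lie_def] at this
      exact (sub_eq_zero.mp this.symm))
  -- All generators act as the identity modulo `X`, so the lower series lands in the filtration by
  -- powers of `X`.
  have h1 : ∀ g, ρ g - 1 ∈ (xFiltration p U).toFun 1 := by
    intro g
    have hg : g ∈ ((constantCoeff : U[X] →+* U).toMonoidHom.comp ρ).ker := by
      refine mem_of_elementaryBasis_mem K e (fun i j => ?_) g
      rw [MonoidHom.mem_ker, MonoidHom.comp_apply, hρ]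
      simp
    intro i hi
    obtain rfl : i = 0 := by omega
    rw [coeff_sub, coeff_one_zero, sub_eq_zero]
    exact hg
  let Γ := lowerPCentralSeries p (GraphProd K G)
  have hρ' := (xFiltration p U).map_sub_one_mem_of_lower ρ h1
  -- The class of `g` in degree `k` is sent to the coefficient of `X ^ k` in `ρ g - 1`.
  let F : Γ.Gr →ₗ⁅ZMod p⁆ U := (coeffSymbol p U).grHom Γ ρ hρ'
  have hF1 : ∀ i j, F (Γ.grMk 1 (ofVertex K G i (elementaryBasis (e i) j)) (Γ.mem_one _)) =
      ι (v i j) := by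
    intro i j
    refine (SymbolMap.grHom_grMk _ _ _ _ _).trans ?_
    rw [hρ, add_sub_cancel_left]
    exact coeff_monomial_same 1 _
  have hFp : ∀ (k : ℕ+) (g : GraphProd K G) (hg : g ∈ Γ.toFun k),
      F (Γ.grMk (⟨p, (Fact.out : p.Prime).pos⟩ * k) (g ^ p) (Γ.pow_mem k g hg)) =
        F (Γ.grMk k g hg) ^ p := fun k g hg => SymbolMap.grHom_grMk_pow _ _ _ _ hg
  -- The image of `N` in `U` is closed under brackets and `p`-th powers and contains the values in
  -- degree one, which generates. So `F` factors through the embedding `ι`.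
  have hrange : ∀ x, ∃ a, ι a = F x := by
    let C : AddSubgroup Γ.Gr := (ι : N →+ U).range.comap (F : Γ.Gr →+ U)
    refine mem_of_grLower_degree_one C ?_ ?_ ?_
    · rintro x ⟨a, ha⟩ y ⟨b, hb⟩
      change ι a = F x at ha
      change ι b = F y at hb
      refine ⟨⁅a, b⁆, ?_⟩
      change ι ⁅a, b⁆ = F ⁅x, y⁆
      rw [LieHom.map_lie, LieHom.map_lie, ha, hb]
    · rintro k g hg ⟨a, ha⟩
      change ι a = F (Γ.grMk k g hg) at ha
      refine ⟨RestrictedLieAlgebra.pPow p a, ?_⟩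
      exact (hιp a).trans ((congrArg (· ^ p) ha).trans (hFp k g hg).symm)
    · intro g _
      exact mem_of_elementaryBasis_mem K e
        (H := (AddSubgroup.toSubgroup C).comap Γ.grOne)
        (fun i j => ⟨v i j, (hF1 i j).symm⟩) g
  choose f hf using hrange
  let f' : Γ.Gr →ₗ⁅ZMod p⁆ N :=
    { toFun := f
      map_add' := fun x y => by
        apply hι
        rw [map_add, hf, hf, hf, map_add]
      map_smul' := fun c x => by
        apply hι
        rw [hf, map_smul, map_smul, hf, RingHom.id_apply]
      map_lie' := by
        intro x y
        apply hι
        rw [LieHom.map_lie, hf x, hf y]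
        exact (hf _).trans (F.map_lie x y) }
  refine ⟨⟨f', PCentralSeries.map_pPow_of_grMk (Γ := Γ) f' fun k g hg => hι ?_⟩,
    fun i j => hι ((hf _).trans (hF1 i j))⟩
  change ι (f _) = ι (RestrictedLieAlgebra.pPow p (f _))
  rw [hf, hιp, hf, hS]
  exact hFp k g hg

end GraphProductHom

/-! ## The colimit cocone -/

section Cocone

variable {p : ℕ} [Fact p.Prime] {m : ℕ} (K : AbstractSimplicialComplex (Fin m))

theorem piSingle_lie {ι : Type*} [DecidableEq ι] {L : ι → Type*} [∀ i, LieRing (L i)] (i : ι)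
    (x y : L i) : ⁅(Pi.single i x : ∀ i, L i), Pi.single i y⁆ = Pi.single i ⁅x, y⁆ := by
  funext j
  rw [piProd_lie_apply]
  rcases eq_or_ne j i with rfl | h
  · simp
  · simp [h]

theorem piSingle_lie_of_ne {ι : Type*} [DecidableEq ι] {L : ι → Type*} [∀ i, LieRing (L i)]
    {i j : ι} (h : i ≠ j) (x : L i) (y : L j) :
    ⁅(Pi.single i x : ∀ i, L i), Pi.single j y⁆ = 0 := by
  funext k
  rw [piProd_lie_apply]
  rcases eq_or_ne k i with rfl | hk
  · simp [h]
  · simp [hk]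

theorem piSingle_pPow {ι : Type*} [DecidableEq ι] {L : ι → Type*} [∀ i, LieRing (L i)]
    [∀ i, LieAlgebra (ZMod p) (L i)] [∀ i, RestrictedLieAlgebra p (L i)] (i : ι) (x : L i) :
    RestrictedLieAlgebra.pPow p (Pi.single i x : ∀ i, L i) =
      Pi.single i (RestrictedLieAlgebra.pPow p x) := by
  funext j
  change RestrictedLieAlgebra.pPow p ((Pi.single i x : ∀ i, L i) j) = _
  rcases eq_or_ne j i with rfl | h
  · simp
  · simp [h, pPow_zero]

section

variable {L : Fin m → Type*} [∀ i, LieRing (L i)] [∀ i, LieAlgebra (ZMod p) (L i)]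
  [∀ i, RestrictedLieAlgebra p (L i)] {N : Type*} [LieRing N] [LieAlgebra (ZMod p) N]
  [RestrictedLieAlgebra p N] {K}

theorem extendZero_single {I J : Finset (Fin m)} (h : I ⊆ J) (i : I) (x : L i) :
    extendZero I J (Pi.single i x) = Pi.single (M := fun j : J => L j) ⟨i, h i.2⟩ x := by
  funext j
  rcases eq_or_ne j ⟨i, h i.2⟩ with rfl | hj
  · simp [extendZero]
  · rw [Pi.single_eq_of_ne hj]
    unfold extendZero
    split_ifs with hI
    · exact Pi.single_eq_of_ne (fun e => hj (by rw [← e])) _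
    · rfl

theorem IsFaceCocone.single {ψ : ∀ I : SFace K, RestrictedLieHom p (∀ i : I.1, L i) N}
    (hψ : IsFaceCocone K p ψ) (I : SFace K) (i : I.1) (x : L i) :
    (ψ (vertexFace K i)).toLieHom (Pi.single ⟨i, Finset.mem_singleton_self _⟩ x) =
      (ψ I).toLieHom (Pi.single i x) := by
  have h : (vertexFace K i).1 ⊆ I.1 := Finset.singleton_subset_iff.mpr i.2
  rw [← hψ _ _ h, extendZero_single h]

end

variable {G : Fin m → Type*} [∀ i, Group (G i)]

theorem grLowerMap_ofVertex_lie (I : SFace K) {i j : I.1} (hij : i ≠ j) (x : grLower p (G i))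
    (y : grLower p (G j)) :
    ⁅grLowerMap p (GraphProd.ofVertex K G i) x, grLowerMap p (GraphProd.ofVertex K G j) y⁆ = 0 := by
  refine (lowerPCentralSeries p (G i)).gr_induction (P := fun x =>
    ⁅grLowerMap p (GraphProd.ofVertex K G i) x, grLowerMap p (GraphProd.ofVertex K G j) y⁆ = 0)
    (by simp) ?_ (fun a b ha hb => by rw [map_add, add_lie, ha, hb, add_zero]) x
  intro k g hg
  refine (lowerPCentralSeries p (G j)).gr_induction (P := fun y =>
    ⁅grLowerMap p (GraphProd.ofVertex K G i) ((lowerPCentralSeries p (G i)).grMk k g hg),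
      grLowerMap p (GraphProd.ofVertex K G j) y⁆ = 0)
    (by simp) ?_ (fun a b ha hb => by rw [map_add, lie_add, ha, hb, add_zero]) y
  intro l h hh
  rw [grLowerMap_grMk, grLowerMap_grMk, PCentralSeries.grMk_lie]
  refine PCentralSeries.grMk_eq_zero _ _ ?_
  rw [commutatorElement_eq_one_iff_commute.mpr (GraphProd.commute_ofVertex K G i.2 j.2
    (fun e => hij (Subtype.ext e)) g h)]
  exact Subgroup.one_mem _

/-- The canonical homomorphism from the product of the associated Lie algebras over a face. -/
noncomputable def faceGrHom [S : RestrictedLieAlgebra p (grLower p (GraphProd K G))]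
    [T : ∀ i, RestrictedLieAlgebra p (grLower p (G i))]
    (hS : (lowerPCentralSeries p (GraphProd K G)).IsGrPower S.pPow)
    (hT : ∀ i, (lowerPCentralSeries p (G i)).IsGrPower (T i).pPow) (I : SFace K) :
    RestrictedLieHom p (∀ i : I.1, grLower p (G i)) (grLower p (GraphProd K G)) where
  toLieHom :=
    { toFun := fun x => ∑ i : I.1, grLowerMap p (GraphProd.ofVertex K G i) (x i)
      map_add' := fun x y => by
        simp only [Pi.add_apply, map_add, Finset.sum_add_distrib]
      map_smul' := fun c x => by
        rw [RingHom.id_apply, Finset.smul_sum]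
        exact Finset.sum_congr rfl fun i _ => ZMod.map_smul _ c (x i)
      map_lie' := by
        intro x y
        rw [sum_lie]
        refine Finset.sum_congr rfl fun i _ => ?_
        rw [lie_sum, Finset.sum_eq_single i
          (fun j _ hj => grLowerMap_ofVertex_lie K I hj.symm _ _) (by simp)]
        exact (grLowerLieHom (GraphProd.ofVertex K G i)).map_lie (x i) (y i) }
  map_pPow x := by
    refine (Finset.sum_congr rfl fun (i : I.1) _ =>
      grLowerLieHom_pPow (hT i) hS (GraphProd.ofVertex K G i) (x i)).trans ?_
    exact (pPow_sum_of_lie_eq_zero _ _ fun i j hij => grLowerMap_ofVertex_lie K I hij _ _).symm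

section

variable [S : RestrictedLieAlgebra p (grLower p (GraphProd K G))]
  [T : ∀ i, RestrictedLieAlgebra p (grLower p (G i))]
  (hS : (lowerPCentralSeries p (GraphProd K G)).IsGrPower S.pPow)
  (hT : ∀ i, (lowerPCentralSeries p (G i)).IsGrPower (T i).pPow)

theorem faceGrHom_apply (I : SFace K) (x : ∀ i : I.1, grLower p (G i)) :
    (faceGrHom K hS hT I).toLieHom x = ∑ i : I.1, grLowerMap p (GraphProd.ofVertex K G i) (x i) :=
  rfl

theorem faceGrHom_isFaceCocone : IsFaceCocone (L := fun i => grLower p (G i)) K p (faceGrHom K hS hT) := by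
  intro I J h x
  rw [faceGrHom_apply, faceGrHom_apply]
  symm
  refine Fintype.sum_of_injective (fun i : I.1 => (⟨i, h i.2⟩ : J.1))
    (fun i j hij => Subtype.ext (congrArg (fun a : J.1 => (a : Fin m)) hij)) _ _ (fun j hj => ?_)
    (fun i => ?_)
  · have hj' : (j : Fin m) ∉ I.1 := fun hI => hj ⟨⟨j, hI⟩, rfl⟩
    rw [extendZero, dif_neg hj', map_zero]
  · rw [extendZero, dif_pos i.2]

theorem faceGrHom_single (I : SFace K) (i : I.1) (x : grLower p (G i)) :
    (faceGrHom K hS hT I).toLieHom (Pi.single i x) =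
      grLowerMap p (GraphProd.ofVertex K G i) x := by
  rw [faceGrHom_apply, Finset.sum_eq_single i (fun j _ hj => by
    rw [Pi.single_eq_of_ne hj, map_zero]) (by simp), Pi.single_eq_same]

/-- The Lie algebra is generated in degree one, and its degree-one part is generated additively by
the classes coming from the vertex groups. -/
theorem faceGrHom_hom_ext {N : Type*} [LieRing N] [LieAlgebra (ZMod p) N]
    [RestrictedLieAlgebra p N] (f f' : RestrictedLieHom p (grLower p (GraphProd K G)) N)
    (h : ∀ (I : SFace K) (x : ∀ i : I.1, grLower p (G i)),
      f.toLieHom ((faceGrHom K hS hT I).toLieHom x) =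
        f'.toLieHom ((faceGrHom K hS hT I).toLieHom x)) : f = f' := by
  refine grLower_hom_ext hS f f' fun g _ => ?_
  let E : AddSubgroup (grLower p (GraphProd K G)) := AddMonoidHom.eqLocus
    (f.toLieHom : grLower p (GraphProd K G) →+ N) (f'.toLieHom : grLower p (GraphProd K G) →+ N)
  refine GraphProd.mem_of_ofVertex_mem K G
    (H := (AddSubgroup.toSubgroup E).comap (lowerPCentralSeries p (GraphProd K G)).grOne)
    (fun i g => ?_) g
  have h1 := h (vertexFace K i) (Pi.single ⟨i, Finset.mem_singleton_self _⟩
    ((lowerPCentralSeries p (G i)).grMk 1 g (PCentralSeries.mem_one _ g)))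
  rw [faceGrHom_single K hS hT (vertexFace K i) ⟨i, Finset.mem_singleton_self _⟩,
    grLowerMap_grMk] at h1
  exact h1

/-- The cocone is determined by its values on the degree-one classes of the bases, since the Lie
algebras of the vertex groups live in degree one only. -/
theorem exists_hom_of_isFaceCocone {n : Fin m → ℕ}
    (e : ∀ i, G i ≃* Multiplicative (Fin (n i) → ZMod p)) {N : Type*} [LieRing N]
    [LieAlgebra (ZMod p) N] [RestrictedLieAlgebra p N]
    (ψ : ∀ I : SFace K, RestrictedLieHom p (∀ i : I.1, grLower p (G i)) N)
    (hψ : IsFaceCocone (L := fun i => grLower p (G i)) K p ψ) :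
    ∃ f : RestrictedLieHom p (grLower p (GraphProd K G)) N,
      ∀ (I : SFace K) (x : ∀ i : I.1, grLower p (G i)),
        f.toLieHom ((faceGrHom K hS hT I).toLieHom x) = (ψ I).toLieHom x := by
  let ψ' : ∀ i, grLower p (G i) →+ N := fun i =>
    ((ψ (vertexFace K i)).toLieHom : (∀ i : (vertexFace K i).1, grLower p (G i)) →+ N).comp
      (AddMonoidHom.single (fun i : (vertexFace K i).1 => grLower p (G i))
        ⟨i, Finset.mem_singleton_self _⟩)
  have hψ' : ∀ (I : SFace K) (i : I.1) (x : grLower p (G i)),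
      ψ' i x = (ψ I).toLieHom (Pi.single i x) := fun I i x => hψ.single I i x
  have hzero : ∀ (i : Fin m) (k : ℕ+) (a : G i) (ha : a ∈ (lowerPCentralSeries p (G i)).toFun k),
      k ≠ 1 → (lowerPCentralSeries p (G i)).grMk k a ha = 0 := fun i k a ha hk =>
    grMk_eq_zero_of_elementary (e i) hk ha
  let b : ∀ i, Fin (n i) → grLower p (G i) := fun i j =>
    (lowerPCentralSeries p (G i)).grMk 1 (elementaryBasis (e i) j) (PCentralSeries.mem_one _ _)
  obtain ⟨f, hf⟩ := GraphProd.exists_restrictedLieHom K e hS (fun i j => ψ' i (b i j))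
    -- The `p`-power of a degree-one class lies in degree `p > 1` of the Lie algebra of `G i`, which
    -- is zero.
    (fun i j => by
      rw [hψ' (vertexFace K i) ⟨i, Finset.mem_singleton_self _⟩, ← RestrictedLieHom.map_pPow,
        piSingle_pPow, hT, hzero, Pi.single_zero, map_zero]
      intro h
      have h' : p * 1 = 1 := congrArg PNat.val h
      exact (Fact.out : p.Prime).ne_one (by rwa [mul_one] at h'))
    -- For equal vertices the bracket lies in degree two, which vanishes; for distinct vertices of a
    -- face it vanishes in the product.
    (fun I i i' j j' => by
      rw [hψ' I, hψ' I, ← LieHom.map_lie]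
      rcases eq_or_ne i i' with rfl | h
      · rw [piSingle_lie, PCentralSeries.grMk_lie, hzero, Pi.single_zero, map_zero]
        decide
      · rw [piSingle_lie_of_ne h, map_zero])
  refine ⟨f, fun I x => ?_⟩
  have key : ∀ (i : Fin m) (y : grLower p (G i)),
      f.toLieHom (grLowerMap p (GraphProd.ofVertex K G i) y) = ψ' i y := by
    intro i y
    let E : AddSubgroup (grLower p (G i)) := AddMonoidHom.eqLocus
      ((f.toLieHom : grLower p (GraphProd K G) →+ N).comp
        (grLowerMap p (GraphProd.ofVertex K G i))) (ψ' i)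
    refine (lowerPCentralSeries p (G i)).gr_induction (P := (· ∈ E)) E.zero_mem ?_
      (fun _ _ => E.add_mem) y
    intro k g hg
    rcases eq_or_ne k 1 with rfl | hk
    · refine mem_of_elementaryBasis_mem (e i)
        (H := (AddSubgroup.toSubgroup E).comap (lowerPCentralSeries p (G i)).grOne) (fun j => ?_) g
      change f.toLieHom (grLowerMap p (GraphProd.ofVertex K G i) (b i j)) = ψ' i (b i j)
      rw [grLowerMap_grMk]
      exact hf i j
    · rw [hzero i k g hg hk]
      exact E.zero_mem
  rw [faceGrHom_apply, map_sum]
  simp only [key, hψ' I]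
  rw [← map_sum, Finset.univ_sum_single]

end

end Cocone


/-! ### The colimit theorem. -/

theorem proposition5p3 (p : ℕ) [Fact p.Prime] (m : ℕ)
    (K : AbstractSimplicialComplex (Fin m)) (n : Fin m → ℕ)
    (G : Fin m → Type u) [∀ i, Group (G i)]
    (hG : ∀ i, Nonempty (G i ≃* Multiplicative (Fin (n i) → ZMod p))) :
    ∃ (S : RestrictedLieAlgebra p (grLower p (GraphProd K G)))
      (T : ∀ i, RestrictedLieAlgebra p (grLower p (G i))),
      (lowerPCentralSeries p (GraphProd K G)).IsGrPower S.pPow ∧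
      (∀ i, (lowerPCentralSeries p (G i)).IsGrPower (T i).pPow) ∧
      ∃ φ : ∀ I : SFace K,
          RestrictedLieHom p (∀ i : I.1, grLower p (G i)) (grLower p (GraphProd K G)),
        (∀ (I : SFace K) (x : ∀ i : I.1, grLower p (G i)),
          (φ I).toLieHom x = ∑ i : I.1, grLowerMap p (GraphProd.ofVertex K G i) (x i)) ∧
        IsGraphProdLie.{u, u, w} K p (fun i => grLower p (G i)) (grLower p (GraphProd K G)) φ := by
  let e := fun i => (hG i).some
  -- Finiteness of the vertex groups makes the graph product finitely generated, as
  -- `exists_restricted` requires.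
  have hfin : ∀ i, Finite (G i) := fun i => Finite.of_equiv _ (e i).symm.toEquiv
  obtain ⟨S, hS⟩ := (lowerPCentralSeries p (GraphProd K G)).exists_restricted
  choose T hT using fun i => (lowerPCentralSeries p (G i)).exists_restricted
  refine ⟨S, T, hS, hT, faceGrHom K hS hT, fun _ _ => rfl, faceGrHom_isFaceCocone K hS hT, ?_⟩
  intro N _ _ _ ψ hψ
  obtain ⟨f, hf⟩ := exists_hom_of_isFaceCocone K hS hT e ψ hψ
  exact ⟨f, hf, fun f' hf' => faceGrHom_hom_ext K hS hT f' f fun I x => by rw [hf', hf]⟩
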